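/- Let $0<\alpha\le 1$, $1<\beta\le 2$, $p,q>0$, $\Omega=(0,1)\times(-p,q)$, $\Omega^+=\Omega\cap\{t>0\}$, $\Omega^-=\Omega\cap\{t<0\}$. Let $${}_CD_{0t}^{\alpha}g(t)=\frac1{\Gamma(1-\alpha)}\int_0^t\frac{g'(z)}{(t-z)^{\alpha}}\,dz\ (0<\alpha<1),\qquad {}_CD_{0t}^{1}g=g',$$ $${}_CD_{t0}^{\beta}g(t)=\frac1{\Gamma(2-\beta)}\int_t^0\frac{g''(z)}{(z-t)^{\beta-1}}\,dz\ (1<\beta<2),\qquad {}_CD_{t0}^{2}g=g'',$$ be the Caputo derivatives ($t>0$ and $t<0$ respectively). For $\alpha<1$ existence of ${}_CD^\alpha_{0t}g$ at $t$ means that $g$ is absolutely continuous on $[0,t]$ and the integral converges absolutely; for $\beta<2$ existence of ${}_CD^\beta_{t0}g$ at $t$ means that $g$ is differentiable on $[t,0)$, $g'$ is absolutely continuous on $[t,s]$ for all $s\in(t,0)$, and the integral converges absolutely. Let $E_{a,b}(z)=\sum_{n\ge0} z^n/\Gamma(an+b)$. Consider the problem of finding a pair of real functions $(u,f)$ such that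 (i) $u\in C(\overline\Omega)$; $u_x$ and $u_{xx}$ exist in $\Omega^+\cup\Omega^-$ and $u_{xx}$ is continuous there; ${}_CD_{0t}^\alpha u$ exists and is continuous in $\Omega^+$; ${}_CD_{t0}^\beta u$ exists and is continuous in $\Omega^-$; $f\in C(0,1)$. Moreover the derivatives that enter the conditions (iii) and (iv) below are locally bounded up to the part of the boundary where they are prescribed (as is the case when they are continuous up to it): $u_x$ is bounded in $U\cap(\Omega^+\cup\Omega^-)$ for some neighbourhood $U$ of each point $(0,t_0)$, $-p<t_0<q$; and ${}_CD_{0t}^\alpha u$ is bounded in $U\cap\Omega^+$ and $u_t$ in $U\cap\Omega^-$ for some neighbourhood $U$ of each point $(x_0,0)$, $0<x_0<1$; (ii) $f(x)={}_CD_{0t}^\alpha u-u_{xx}$ in $\Omega^+$ and $f(x)={}_CD_{t0}^\beta u-u_{xx}$ in $\Omega^-$; (iii) $u(0,t)=u(1,t)$ and $u_x(0,t)=0$ (one-sided derivative) for $-p\le t\le q$; $u(x,-p)=u(x,q)=0$ for $0\le x\le1$; (iv) for each $x\in(0,1)$ the limits below exist, are finite, and $$\lim_{t\to+0}{}_CD_{0t}^\alpha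 u(x,t)=\lim_{t\to-0}\frac{\partial u(x,t)}{\partial(-t)}.$$ Theorem. If $$\Delta_0=p+\frac{p^\beta}{\Gamma(\beta+1)}-\frac{q^\alpha}{\Gamma(\alpha+1)}\ne0$$ and, for every integer $k\ge1$, $$\Delta_k=p^\beta E_{\beta,\beta+1}\!\left(-(2k\pi)^2p^\beta\right)+p\,E_{\beta,2}\!\left(-(2k\pi)^2p^\beta\right)-q^\alpha E_{\alpha,\alpha+1}\!\left(-(2k\pi)^2q^\alpha\right)\ne0,$$ then the problem has only the trivial solution: $(u,f)$ solves it if and only if $u=0$ on $\overline\Omega$ and $f=0$ on $(0,1)$. -/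

import Mathlib

open Set Filter Topology MeasureTheory

noncomputable section

namespace MixedFractional

/-- The two-parameter Mittag-Leffler function `E_{a,b}(z) = ∑ zⁿ / Γ(a n + b)`. -/
def mittagLeffler (a b z : ℝ) : ℝ :=
  ∑' n : ℕ, z ^ n / Real.Gamma (a * n + b)

/-- The upper part `Ω⁺ = (0,1) × (0,q)` of the domain. -/
def domPlus (q : ℝ) : Set (ℝ × ℝ) := Ioo 0 1 ×ˢ Ioo 0 q

/-- The lower part `Ω⁻ = (0,1) × (-p,0)` of the domain. -/
def domMinus (p : ℝ) : Set (ℝ × ℝ) := Ioo 0 1 ×ˢ Ioo (-p) 0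

/-- The left Caputo derivative of order `0 < α ≤ 1` with base point `0`, at `t > 0`. -/
def caputoRight (α : ℝ) (g : ℝ → ℝ) (t : ℝ) : ℝ :=
  if α = 1 then deriv g t
  else 1 / Real.Gamma (1 - α) * ∫ z in (0 : ℝ)..t, deriv g z / (t - z) ^ α

/-- The Caputo derivative `caputoRight α g t` exists: for `α = 1` the function is differentiable
at `t`; for `α < 1` it is absolutely continuous on `[0,t]` and the defining integral converges. -/
def CaputoRightExists (α : ℝ) (g : ℝ → ℝ) (t : ℝ) : Prop :=
  if α = 1 then DifferentiableAt ℝ g t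
  else AbsolutelyContinuousOnInterval g 0 t ∧
    IntervalIntegrable (fun z => deriv g z / (t - z) ^ α) volume 0 t

/-- The right Caputo derivative of order `1 < β ≤ 2` with base point `0`, at `t < 0`. -/
def caputoLeft (β : ℝ) (g : ℝ → ℝ) (t : ℝ) : ℝ :=
  if β = 2 then deriv (deriv g) t
  else 1 / Real.Gamma (2 - β) * ∫ z in t..(0 : ℝ), deriv (deriv g) z / (z - t) ^ (β - 1)

/-- The Caputo derivative `caputoLeft β g t` exists: for `β = 2` the function is twice
differentiable at `t`; for `β < 2` it is differentiable on `[t,0)`, its derivative is absolutely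
continuous on every `[t,s]` with `s < 0`, and the defining integral converges. -/
def CaputoLeftExists (β : ℝ) (g : ℝ → ℝ) (t : ℝ) : Prop :=
  if β = 2 then (∀ᶠ s in 𝓝 t, DifferentiableAt ℝ g s) ∧ DifferentiableAt ℝ (deriv g) t
  else (∀ z ∈ Ico t 0, DifferentiableAt ℝ g z) ∧
    (∀ s ∈ Ioo t 0, AbsolutelyContinuousOnInterval (deriv g) t s) ∧
    IntervalIntegrable (fun z => deriv (deriv g) z / (z - t) ^ (β - 1)) volume t 0

/-- The partial derivative `u_x(x,t)`. -/
def dx (u : ℝ → ℝ → ℝ) (x t : ℝ) : ℝ := deriv (fun y => u y t) x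

/-- The partial derivative `u_xx(x,t)`. -/
def dxx (u : ℝ → ℝ → ℝ) (x t : ℝ) : ℝ := deriv (fun y => dx u y t) x

/-- The pair `(u, f)` solves the inverse source problem; `u x t` is the value of `u` at `(x,t)`,
and only the values of `u` on `[0,1] × [-p,q]` and of `f` on `(0,1)` matter. -/
structure IsSolution (α β p q : ℝ) (u : ℝ → ℝ → ℝ) (f : ℝ → ℝ) : Prop where
  /-- `u` is continuous on the closed rectangle. -/
  cont : ContinuousOn (fun z : ℝ × ℝ => u z.1 z.2) (Icc 0 1 ×ˢ Icc (-p) q)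
  /-- `u_x` and `u_xx` exist in `Ω⁺ ∪ Ω⁻`. -/
  diff_x : ∀ z ∈ domPlus q ∪ domMinus p,
    DifferentiableAt ℝ (fun y => u y z.2) z.1 ∧ DifferentiableAt ℝ (fun y => dx u y z.2) z.1
  /-- `u_xx` is continuous in `Ω⁺ ∪ Ω⁻`. -/
  cont_dxx : ContinuousOn (fun z : ℝ × ℝ => dxx u z.1 z.2) (domPlus q ∪ domMinus p)
  /-- The Caputo derivative of order `α` exists in `Ω⁺`. -/
  exists_plus : ∀ z ∈ domPlus q, CaputoRightExists α (u z.1) z.2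
  /-- The Caputo derivative of order `α` is continuous in `Ω⁺`. -/
  cont_plus : ContinuousOn (fun z : ℝ × ℝ => caputoRight α (u z.1) z.2) (domPlus q)
  /-- The Caputo derivative of order `β` exists in `Ω⁻`. -/
  exists_minus : ∀ z ∈ domMinus p, CaputoLeftExists β (u z.1) z.2
  /-- The Caputo derivative of order `β` is continuous in `Ω⁻`. -/
  cont_minus : ContinuousOn (fun z : ℝ × ℝ => caputoLeft β (u z.1) z.2) (domMinus p)
  /-- `f` is continuous on the open interval `(0,1)`. -/
  cont_f : ContinuousOn f (Ioo 0 1)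
  /-- The equation in `Ω⁺`. -/
  eq_plus : ∀ z ∈ domPlus q, f z.1 = caputoRight α (u z.1) z.2 - dxx u z.1 z.2
  /-- The equation in `Ω⁻`. -/
  eq_minus : ∀ z ∈ domMinus p, f z.1 = caputoLeft β (u z.1) z.2 - dxx u z.1 z.2
  /-- `u(0,t) = u(1,t)`. -/
  periodic : ∀ t ∈ Icc (-p) q, u 0 t = u 1 t
  /-- `u_x(0,t) = 0`, a one-sided derivative. -/
  neumann : ∀ t ∈ Icc (-p) q, HasDerivWithinAt (fun y => u y t) 0 (Ici 0) 0
  /-- `u(x,-p) = 0`. -/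
  bottom : ∀ x ∈ Icc (0 : ℝ) 1, u x (-p) = 0
  /-- `u(x,q) = 0`. -/
  top : ∀ x ∈ Icc (0 : ℝ) 1, u x q = 0
  /-- The transmitting condition: both one-sided limits exist (and are finite) and coincide. -/
  transmit : ∀ x ∈ Ioo (0 : ℝ) 1, ∃ L : ℝ,
    Tendsto (fun t => caputoRight α (u x) t) (𝓝[>] 0) (𝓝 L) ∧
    Tendsto (fun t => -deriv (u x) t) (𝓝[<] 0) (𝓝 L)
  /-- The derivative `u_x`, which has a prescribed boundary value on the side `x = 0`, is
  locally bounded up to that side (in particular if it is continuous up to it). -/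
  bdd_dx : ∀ t₀ ∈ Ioo (-p) q, ∃ M : ℝ,
    ∀ᶠ z in 𝓝[domPlus q ∪ domMinus p] ((0 : ℝ), t₀), |dx u z.1 z.2| ≤ M
  /-- The Caputo derivative of order `α` is locally bounded up to the line `t = 0`
  (in particular if it is continuous up to it from above). -/
  bdd_plus : ∀ x₀ ∈ Ioo (0 : ℝ) 1, ∃ M : ℝ,
    ∀ᶠ z in 𝓝[domPlus q] (x₀, (0 : ℝ)), |caputoRight α (u z.1) z.2| ≤ M
  /-- The derivative `u_t` is locally bounded up to the line `t = 0` from below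
  (in particular if it is continuous up to it from below). -/
  bdd_minus : ∀ x₀ ∈ Ioo (0 : ℝ) 1, ∃ M : ℝ,
    ∀ᶠ z in 𝓝[domMinus p] (x₀, (0 : ℝ)), |deriv (u z.1) z.2| ≤ M

/-- The determinant `Δ₀`. -/
def delta0 (α β p q : ℝ) : ℝ :=
  p + p ^ β / Real.Gamma (β + 1) - q ^ α / Real.Gamma (α + 1)

/-- The determinant `Δ_k`, used for `k ≥ 1`. -/
def delta (α β p q : ℝ) (k : ℕ) : ℝ :=
  p ^ β * mittagLeffler β (β + 1) (-(2 * k * Real.pi) ^ 2 * p ^ β)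
    + p * mittagLeffler β 2 (-(2 * k * Real.pi) ^ 2 * p ^ β)
    - q ^ α * mittagLeffler α (α + 1) (-(2 * k * Real.pi) ^ 2 * q ^ α)

end MixedFractional

end

/-!
The trivial pair is a solution because every condition only involves the values of `u` on the
closed rectangle and of `f` on `(0,1)`. The converse is a spectral argument. The spatial operator
`X ↦ X''` with `X 0 = X 1`, `X' 0 = 0` is not self-adjoint; the adjoint conditions are `Y 1 = 0`,
`Y' 0 = Y' 1`, with eigenfunctions `sin 2kπx` (`k ≥ 1`) and `1 - x`, and associated functions
`(1 - x) cos 2kπx` (`k ≥ 1`). Since `u` is orthogonal to the sines, the associated functions behave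
as eigenfunctions, and this system is complete (`eq_zero_of_orthogonal`), so it suffices to show
that each moment `V t = ∫ u(x,t) Y(x) dx` vanishes.

With `Y'' = -μ Y`, and with `F`, `Φ` standing for the moments of `f` and of the common limit in the
transmitting condition, `V` satisfies the Volterra equations
`V - V 0 = F t ^ α / Γ(α + 1) - μ I^α V` for `t > 0`,
`V - V 0 - s Φ = F s ^ β / Γ(β + 1) - μ I^β V` for `t = -s < 0`, and `Φ = F - μ V 0`. Picard
iteration solves them by Mittag-Leffler functions (`eq_mittagLeffler_of_volterra`), and
`V q = V (-p) = 0` forces `Φ Δ_k = 0`, whence `Φ = 0` and `V = 0` (`eq_zero_of_moment_equations`).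

The delicate point is the derivation of the moment equations, since `u_xx`, the fractional
derivatives and `f` are only continuous in the open domain and need not be integrable up to the
lateral sides. The equation is therefore first tested in `x` against functions `ψ` supported in a
compact subinterval of `(0,1)`. For `t > 0` the Caputo derivative is bounded up to `t = 0` on such
subintervals and Fubini's theorem suffices (`integral_mul_sub_plus`). For `t < 0` the Caputo
derivative of order `β` is not known to be bounded near `t = 0`, and the passage to the limit in the
truncated integrals `∫_δ^s (s - r) ^ (β - 1) D^β u` uses an integration by parts and the bound on
`u_t` (`truncated_fracInt_caputoLeft`). Finally `ψ` is let tend to `Y`: the cutoffs contribute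
`∫ u ψ''` over shrinking intervals at the two ends, which is small because `u - u(0,t) = o(x)` and
`Y` is arbitrary at `x = 0`, whereas `u - u(1,t) = o(1)` and `Y = O(1 - x)` at `x = 1`
(`exists_abs_integral_truncation_sub_le`). No integrability of `f` is needed: its moments against
the truncations converge because all other terms of the equation do.
-/

open Set Filter Topology MeasureTheory

noncomputable section

namespace MixedFractional

/-! ### Fractional integrals -/

/-- The Riemann-Liouville fractional integral of order `a` with base point `0`. -/
def fracInt (a : ℝ) (h : ℝ → ℝ) (t : ℝ) : ℝ :=
  1 / Real.Gamma a * ∫ r in (0 : ℝ)..t, (t - r) ^ (a - 1) * h r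

lemma integral_rpow_mul_rpow {a b c : ℝ} (ha : 0 < a) (hb : 0 < b) (hc : 0 < c) :
    ∫ x in (0 : ℝ)..c, (c - x) ^ (a - 1) * x ^ (b - 1)
      = Real.Gamma a * Real.Gamma b / Real.Gamma (a + b) * c ^ (a + b - 1) := by
  have h1 := Complex.betaIntegral_scaled (b : ℂ) (a : ℂ) hc
  rw [Complex.betaIntegral_eq_Gamma_mul_div _ _ (by simpa) (by simpa)] at h1
  have h2 : (∫ x in (0 : ℝ)..c, (x : ℂ) ^ ((b : ℂ) - 1) * ((c : ℂ) - x) ^ ((a : ℂ) - 1))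
      = ((∫ x in (0 : ℝ)..c, (c - x) ^ (a - 1) * x ^ (b - 1) : ℝ) : ℂ) := by
    rw [← intervalIntegral.integral_ofReal]
    refine intervalIntegral.integral_congr fun x hx => ?_
    rw [uIcc_of_le hc.le] at hx
    have e1 : ((x ^ (b - 1) : ℝ) : ℂ) = (x : ℂ) ^ ((b : ℂ) - 1) := by
      rw [Complex.ofReal_cpow hx.1]; push_cast; rfl
    have e2 : (((c - x) ^ (a - 1) : ℝ) : ℂ) = ((c : ℂ) - x) ^ ((a : ℂ) - 1) := by
      rw [Complex.ofReal_cpow (sub_nonneg.2 hx.2)]; push_cast; rfl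
    simp only [Complex.ofReal_mul, e1, e2, mul_comm]
  have h3 : (c : ℂ) ^ ((b : ℂ) + a - 1) = ((c ^ (a + b - 1) : ℝ) : ℂ) := by
    rw [Complex.ofReal_cpow hc.le]; push_cast; ring_nf
  rw [h2, h3, ← Complex.ofReal_add, Complex.Gamma_ofReal, Complex.Gamma_ofReal,
    Complex.Gamma_ofReal] at h1
  have h4 : (∫ x in (0 : ℝ)..c, (c - x) ^ (a - 1) * x ^ (b - 1))
      = c ^ (a + b - 1) * (Real.Gamma b * Real.Gamma a / Real.Gamma (b + a)) := by
    exact_mod_cast h1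
  rw [h4, add_comm b a]; ring

/-- The Beta integral on an arbitrary interval. -/
lemma integral_sub_rpow_mul_sub_rpow {a b z t : ℝ} (ha : 0 < a) (hb : 0 < b) (hzt : z < t) :
    ∫ r in z..t, (t - r) ^ (a - 1) * (r - z) ^ (b - 1)
      = Real.Gamma a * Real.Gamma b / Real.Gamma (a + b) * (t - z) ^ (a + b - 1) := by
  rw [← integral_rpow_mul_rpow ha hb (sub_pos.2 hzt)]
  have := intervalIntegral.integral_comp_sub_right
    (fun x => (t - z - x) ^ (a - 1) * x ^ (b - 1)) z (a := z) (b := t)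
  simp only [sub_sub_sub_cancel_right, sub_self] at this
  exact this

lemma intervalIntegrable_sub_rpow_mul_sub_rpow {a b z t : ℝ} (ha : 0 < a) (hb : 0 < b)
    (hzt : z < t) :
    IntervalIntegrable (fun r => (t - r) ^ (a - 1) * (r - z) ^ (b - 1)) volume z t := by
  by_contra h
  have h0 := intervalIntegral.integral_undef h
  rw [integral_sub_rpow_mul_sub_rpow ha hb hzt] at h0
  have := Real.Gamma_pos_of_pos ha
  have := Real.Gamma_pos_of_pos hb
  have := Real.Gamma_pos_of_pos (add_pos ha hb)
  have := Real.rpow_pos_of_pos (sub_pos.2 hzt) (a + b - 1)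
  have : 0 < Real.Gamma a * Real.Gamma b / Real.Gamma (a + b) * (t - z) ^ (a + b - 1) := by
    positivity
  exact this.ne' h0

/-- The kernel of the fractional integral is integrable. -/
lemma intervalIntegrable_kernel {a : ℝ} (ha : 0 < a) (c d t : ℝ) :
    IntervalIntegrable (fun r => (t - r) ^ (a - 1)) volume c d := by
  have := (intervalIntegral.intervalIntegrable_rpow' (a := t - d) (b := t - c)
    (show -1 < a - 1 by linarith)).comp_sub_left t
  simpa using this.symm

lemma integral_kernel {a t : ℝ} (ha : 0 < a) :
    ∫ r in (0 : ℝ)..t, (t - r) ^ (a - 1) = t ^ a / a := by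
  rw [intervalIntegral.integral_comp_sub_left (fun x => x ^ (a - 1)) t]
  rw [integral_rpow (Or.inl (by linarith))]
  simp [Real.zero_rpow ha.ne']

lemma fracInt_rpow {a b t : ℝ} (ha : 0 < a) (hb : 0 < b) (ht : 0 < t) :
    fracInt a (fun r => r ^ (b - 1) / Real.Gamma b) t
      = t ^ (a + b - 1) / Real.Gamma (a + b) := by
  have h := integral_rpow_mul_rpow ha hb ht
  simp only [fracInt, ← mul_div_assoc]
  rw [intervalIntegral.integral_div, h]
  have := (Real.Gamma_pos_of_pos ha).ne'
  have := (Real.Gamma_pos_of_pos hb).ne'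
  field_simp

lemma fracInt_const {a t : ℝ} (ha : 0 < a) (c : ℝ) :
    fracInt a (fun _ => c) t = c * t ^ a / Real.Gamma (a + 1) := by
  simp only [fracInt]
  rw [intervalIntegral.integral_mul_const, integral_kernel ha, Real.Gamma_add_one ha.ne']
  have := (Real.Gamma_pos_of_pos ha).ne'
  field_simp

lemma fracInt_one (h : ℝ → ℝ) (t : ℝ) : fracInt 1 h t = ∫ r in (0 : ℝ)..t, h r := by
  simp [fracInt]

lemma fracInt_congr {a t : ℝ} (ht : 0 ≤ t) {g h : ℝ → ℝ} (H : ∀ r ∈ Ioo 0 t, g r = h r) :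
    fracInt a g t = fracInt a h t := by
  simp only [fracInt]
  congr 1
  refine intervalIntegral.integral_congr_ae ?_
  have : ∀ᵐ r : ℝ, r ≠ t := by simp [ae_iff]
  filter_upwards [this] with r hr hr2
  rw [uIoc_of_le ht] at hr2
  simp only [H r ⟨hr2.1, lt_of_le_of_ne hr2.2 hr⟩]

lemma abs_fracInt_le_fracInt {a t : ℝ} (ha : 0 < a) (ht : 0 ≤ t) {g h : ℝ → ℝ}
    (hg : IntervalIntegrable (fun r => (t - r) ^ (a - 1) * g r) volume 0 t)
    (H : ∀ r ∈ Ioo 0 t, |h r| ≤ g r) : |fracInt a h t| ≤ fracInt a g t := by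
  have hG := Real.Gamma_pos_of_pos ha
  simp only [fracInt, abs_mul, abs_of_pos (one_div_pos.2 hG)]
  refine mul_le_mul_of_nonneg_left ?_ (by positivity)
  rw [← Real.norm_eq_abs]
  refine intervalIntegral.norm_integral_le_of_norm_le ht ?_ hg
  have : ∀ᵐ r : ℝ, r ≠ t := by simp [ae_iff]
  filter_upwards [this] with r hr hr2
  have h1 : 0 ≤ (t - r) ^ (a - 1) := Real.rpow_nonneg (sub_nonneg.2 hr2.2) _
  rw [Real.norm_eq_abs, abs_mul, abs_of_nonneg h1]
  exact mul_le_mul_of_nonneg_left (H r ⟨hr2.1, lt_of_le_of_ne hr2.2 hr⟩) h1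

lemma abs_fracInt_le {a t C : ℝ} (ha : 0 < a) (ht : 0 ≤ t) {h : ℝ → ℝ}
    (H : ∀ r ∈ Ioo 0 t, |h r| ≤ C) :
    |fracInt a h t| ≤ C * t ^ a / Real.Gamma (a + 1) := by
  rw [← fracInt_const ha C]
  exact abs_fracInt_le_fracInt ha ht ((intervalIntegrable_kernel ha 0 t t).mul_const C) H

lemma intervalIntegrable_kernel_mul {a t : ℝ} (ha : 0 < a) (ht : 0 ≤ t) {h : ℝ → ℝ}
    (hh : ContinuousOn h (Icc 0 t)) :
    IntervalIntegrable (fun r => (t - r) ^ (a - 1) * h r) volume 0 t :=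
  (intervalIntegrable_kernel ha 0 t t).mul_continuousOn (by rwa [uIcc_of_le ht])

/-- The semigroup property of the fractional integral, at every point, for integrable functions
and total order at least one. -/
lemma fracInt_fracInt {a b t : ℝ} (ha : 0 < a) (hb : 0 < b) (hab : 1 ≤ a + b) (ht : 0 < t)
    {h : ℝ → ℝ} (hh : IntervalIntegrable h volume 0 t) :
    IntervalIntegrable (fun r => (t - r) ^ (a - 1) * fracInt b h r) volume 0 t ∧
      fracInt a (fracInt b h) t = fracInt (a + b) h t := by
  set μ : Measure ℝ := volume.restrict (Ioc 0 t) with hμ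
  have hhμ : Integrable h μ := (intervalIntegrable_iff_integrableOn_Ioc_of_le ht.le).1 hh
  set F : ℝ × ℝ → ℝ := {y : ℝ × ℝ | y.2 < y.1}.indicator
    (fun y => (t - y.1) ^ (a - 1) * (y.1 - y.2) ^ (b - 1) * h y.2) with hF
  have hS : MeasurableSet {y : ℝ × ℝ | y.2 < y.1} := measurableSet_lt measurable_snd measurable_fst
  have hmeas : AEStronglyMeasurable F (μ.prod μ) := by
    refine AEStronglyMeasurable.indicator ?_ hS
    refine AEStronglyMeasurable.mul ?_ hhμ.1.comp_snd
    exact Measurable.aestronglyMeasurable (by fun_prop)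
  have hsec : ∀ z r, F (r, z) = (Ioi z).indicator
      (fun r => (t - r) ^ (a - 1) * (r - z) ^ (b - 1) * h z) r := fun z r => by
    simp [hF, indicator_apply]
  have hsec2 : ∀ r z, F (r, z) = (Iio r).indicator
      (fun z => (t - r) ^ (a - 1) * (r - z) ^ (b - 1) * h z) z := fun r z => by
    simp [hF, indicator_apply]
  have hIoc : ∀ z ∈ Ioo 0 t, Ioi z ∩ Ioc 0 t = Ioc z t := fun z hz => by
    ext y; simp only [mem_inter_iff, mem_Ioi, mem_Ioc]
    exact ⟨fun H => ⟨H.1, H.2.2⟩, fun H => ⟨H.1, hz.1.trans H.1, H.2⟩⟩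
  have hae : ∀ᵐ z ∂μ, z ∈ Ioo 0 t := by
    have h1 : ∀ᵐ z ∂μ, z ∈ Ioc 0 t := ae_restrict_mem measurableSet_Ioc
    have h2 : ∀ᵐ z ∂μ, z ≠ t := ae_restrict_of_ae (by simp [ae_iff])
    filter_upwards [h1, h2] with z hz hz2 using ⟨hz.1, lt_of_le_of_ne hz.2 hz2⟩
  have hint : ∀ z ∈ Ioo 0 t, Integrable (fun r => F (r, z)) μ := fun z hz => by
    simp only [hsec]
    rw [integrable_indicator_iff measurableSet_Ioi, IntegrableOn, hμ,
      Measure.restrict_restrict measurableSet_Ioi, hIoc z hz]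
    exact (((intervalIntegrable_sub_rpow_mul_sub_rpow ha hb hz.2).mul_const (h z)).1)
  set B := Real.Gamma a * Real.Gamma b / Real.Gamma (a + b) with hB
  have hval : ∀ z ∈ Ioo 0 t, ∫ r, F (r, z) ∂μ = B * (t - z) ^ (a + b - 1) * h z := fun z hz => by
    simp only [hsec]
    rw [integral_indicator measurableSet_Ioi, hμ,
      Measure.restrict_restrict measurableSet_Ioi, hIoc z hz,
      ← intervalIntegral.integral_of_le hz.2.le, intervalIntegral.integral_mul_const,
      integral_sub_rpow_mul_sub_rpow ha hb hz.2]
  have hnorm : ∀ z ∈ Ioo 0 t, ∫ r, ‖F (r, z)‖ ∂μ = B * (t - z) ^ (a + b - 1) * |h z| :=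
      fun z hz => by
    have : ∀ r ∈ Ioc 0 t, ‖F (r, z)‖ = (Ioi z).indicator
        (fun r => (t - r) ^ (a - 1) * (r - z) ^ (b - 1) * |h z|) r := fun r hr => by
      rw [hsec, Real.norm_eq_abs, indicator_apply, indicator_apply]
      split_ifs with hzr
      · rw [abs_mul, abs_of_nonneg]
        exact mul_nonneg (Real.rpow_nonneg (sub_nonneg.2 hr.2) _)
          (Real.rpow_nonneg (sub_nonneg.2 (le_of_lt hzr)) _)
      · simp
    rw [hμ, setIntegral_congr_fun measurableSet_Ioc this, integral_indicator measurableSet_Ioi,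
      Measure.restrict_restrict measurableSet_Ioi, hIoc z hz,
      ← intervalIntegral.integral_of_le hz.2.le, intervalIntegral.integral_mul_const,
      integral_sub_rpow_mul_sub_rpow ha hb hz.2]
  have hFint : Integrable F (μ.prod μ) := by
    rw [integrable_prod_iff' hmeas]
    refine ⟨hae.mono hint, ?_⟩
    have hmaj : Integrable (fun z => B * t ^ (a + b - 1) * |h z|) μ :=
      (hhμ.norm).const_mul _
    have hBpos : 0 ≤ B := by
      have := Real.Gamma_pos_of_pos ha
      have := Real.Gamma_pos_of_pos hb
      have := Real.Gamma_pos_of_pos (add_pos ha hb)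
      positivity
    refine hmaj.mono' hmeas.norm.prod_swap.integral_prod_right' ?_
    filter_upwards [hae] with z hz
    rw [hnorm z hz, Real.norm_eq_abs, abs_of_nonneg (mul_nonneg (mul_nonneg hBpos
      (Real.rpow_nonneg (sub_nonneg.2 hz.2.le) _)) (abs_nonneg _))]
    gcongr
    · linarith [hz.2]
    · linarith [hz.1]
  have hin : ∀ r ∈ Ioo 0 t, ∫ z, F (r, z) ∂μ
      = Real.Gamma b * ((t - r) ^ (a - 1) * fracInt b h r) := fun r hr => by
    have : Iio r ∩ Ioc 0 t = Ioo 0 r := by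
      ext y; simp only [mem_inter_iff, mem_Iio, mem_Ioc, mem_Ioo]
      exact ⟨fun H => ⟨H.2.1, H.1⟩, fun H => ⟨H.2, H.1, (H.2.trans hr.2).le⟩⟩
    simp only [hsec2]
    rw [integral_indicator measurableSet_Iio, hμ,
      Measure.restrict_restrict measurableSet_Iio, this, ← integral_Ioc_eq_integral_Ioo,
      ← intervalIntegral.integral_of_le hr.1.le, fracInt]
    simp only [mul_assoc]
    rw [intervalIntegral.integral_const_mul]
    have := (Real.Gamma_pos_of_pos hb).ne'
    field_simp
  have hGb := (Real.Gamma_pos_of_pos hb).ne'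
  refine ⟨?_, ?_⟩
  · rw [intervalIntegrable_iff_integrableOn_Ioc_of_le ht.le]
    have := (hFint.integral_prod_left).const_mul (1 / Real.Gamma b)
    refine Integrable.congr this ?_
    filter_upwards [hae] with r hr
    rw [hin r hr]; field_simp
  · have hsw := integral_integral_swap (μ := μ) (ν := μ) (f := fun r z => F (r, z)) hFint
    rw [integral_congr_ae (hae.mono hin), integral_congr_ae (hae.mono hval)] at hsw
    simp only [mul_assoc] at hsw
    rw [integral_const_mul, integral_const_mul, hμ, ← intervalIntegral.integral_of_le ht.le,
      ← intervalIntegral.integral_of_le ht.le] at hsw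
    have e : ∫ r in (0 : ℝ)..t, (t - r) ^ (a - 1) * fracInt b h r
        = (1 / Real.Gamma b) * (B * ∫ z in (0 : ℝ)..t, (t - z) ^ (a + b - 1) * h z) := by
      rw [← hsw]; field_simp
    rw [fracInt, e, fracInt, hB]
    have := (Real.Gamma_pos_of_pos ha).ne'
    have := (Real.Gamma_pos_of_pos (add_pos ha hb)).ne'
    field_simp

/-! ### Mittag-Leffler functions and Volterra equations -/

/-- The part of Euler's integral over `(R, ∞)`, where `t ^ (x - 1) ≥ R ^ (x - 1)`, bounds `Γ`. -/
lemma rpow_mul_exp_neg_le_Gamma {x R : ℝ} (hx : 1 ≤ x) (hR : 0 < R) :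
    R ^ (x - 1) * Real.exp (-R) ≤ Real.Gamma x := by
  rw [Real.Gamma_eq_integral (by linarith)]
  have hint := Real.GammaIntegral_convergent (s := x) (by linarith)
  have h1 : ∫ t in Ioi R, Real.exp (-t) * t ^ (x - 1)
      ≤ ∫ t in Ioi (0 : ℝ), Real.exp (-t) * t ^ (x - 1) := by
    refine setIntegral_mono_set hint ?_ (Ioi_subset_Ioi hR.le).eventuallyLE
    filter_upwards [ae_restrict_mem measurableSet_Ioi] with t ht
    exact mul_nonneg (Real.exp_pos _).le (Real.rpow_nonneg (le_of_lt ht) _)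
  refine le_trans ?_ h1
  rw [mul_comm, ← integral_exp_neg_Ioi R, ← integral_mul_const]
  refine setIntegral_mono_on ?_ (hint.mono_set (Ioi_subset_Ioi hR.le)) measurableSet_Ioi ?_
  · exact (integrableOn_exp_neg_Ioi R).mul_const _
  · intro t ht
    have ht' : R < t := ht
    gcongr

lemma summable_mittagLeffler {a b : ℝ} (ha : 0 < a) (hb : 1 ≤ b) (z : ℝ) :
    Summable fun n : ℕ => |z| ^ n / Real.Gamma (a * n + b) := by
  -- With `Q ^ a = 2 |z| + 1` the bound `Γ(x) ≥ Q ^ (x - 1) exp (-Q)` gives a geometric majorant.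
  set q := 2 * |z| + 1 with hq
  have hq1 : 1 ≤ q := by have := abs_nonneg z; linarith
  set Q := q ^ (1 / a) with hQ
  have hQ1 : 1 ≤ Q := Real.one_le_rpow hq1 (by positivity)
  have hQa : Q ^ a = q := by
    rw [hQ, ← Real.rpow_mul (by linarith), one_div_mul_cancel ha.ne', Real.rpow_one]
  have hgeo : Summable fun n : ℕ => Real.exp Q * (|z| / q) ^ n := by
    refine (summable_geometric_of_lt_one (by positivity) ?_).mul_left _
    rw [div_lt_one (by linarith)]; have := abs_nonneg z; linarith
  refine hgeo.of_nonneg_of_le (fun n => ?_) fun n => ?_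
  · have := Real.Gamma_pos_of_pos (s := a * n + b) (by positivity)
    positivity
  · have hx : 1 ≤ a * n + b := by
      have : 0 ≤ a * n := by positivity
      linarith
    have h1 := rpow_mul_exp_neg_le_Gamma hx (by linarith : 0 < Q)
    have h2 : q ^ n ≤ Q ^ (a * n + b - 1) := by
      rw [← hQa, ← Real.rpow_natCast, ← Real.rpow_mul (by linarith)]
      exact Real.rpow_le_rpow_of_exponent_le hQ1 (by linarith)
    have h3 : q ^ n * Real.exp (-Q) ≤ Real.Gamma (a * n + b) :=
      (mul_le_mul_of_nonneg_right h2 (Real.exp_pos _).le).trans h1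
    have hqn : 0 < q ^ n := by positivity
    calc |z| ^ n / Real.Gamma (a * n + b) ≤ |z| ^ n / (q ^ n * Real.exp (-Q)) := by gcongr
      _ = Real.exp Q * (|z| / q) ^ n := by
        rw [Real.exp_neg, div_pow]; field_simp

lemma hasSum_mittagLeffler {a b : ℝ} (ha : 0 < a) (hb : 1 ≤ b) (z : ℝ) :
    HasSum (fun n : ℕ => z ^ n / Real.Gamma (a * n + b)) (mittagLeffler a b z) := by
  refine (Summable.of_norm ?_).hasSum
  refine (summable_mittagLeffler ha hb z).congr fun n => ?_
  have hG : 0 < Real.Gamma (a * n + b) := Real.Gamma_pos_of_pos (by positivity)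
  rw [norm_div, norm_pow, Real.norm_eq_abs, Real.norm_eq_abs, abs_of_pos hG]

lemma continuous_mittagLeffler {a b : ℝ} (ha : 0 < a) (hb : 1 ≤ b) :
    Continuous (mittagLeffler a b) := by
  rw [continuous_iff_continuousAt]
  intro z₀
  have hC : ContinuousOn (mittagLeffler a b) (Metric.ball 0 (|z₀| + 1)) := by
    refine continuousOn_tsum (fun n => by fun_prop) (summable_mittagLeffler ha hb (|z₀| + 1))
      fun n z hz => ?_
    have hG : 0 < Real.Gamma (a * n + b) := Real.Gamma_pos_of_pos (by positivity)
    rw [norm_div, norm_pow, Real.norm_eq_abs, Real.norm_eq_abs, abs_of_pos hG]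
    have : |z| ≤ |(|z₀| + 1)| := by
      have h1 : |z| < |z₀| + 1 := by simpa using hz
      exact h1.le.trans (le_abs_self _)
    gcongr
  refine hC.continuousAt (Metric.isOpen_ball.mem_nhds ?_)
  simp

lemma mittagLeffler_zero (a b : ℝ) : mittagLeffler a b 0 = 1 / Real.Gamma b := by
  rw [mittagLeffler, tsum_eq_single 0 (fun n hn => by simp [hn])]
  simp

lemma fracInt_sub {a t : ℝ} {g h : ℝ → ℝ}
    (hg : IntervalIntegrable (fun r => (t - r) ^ (a - 1) * g r) volume 0 t)
    (hh : IntervalIntegrable (fun r => (t - r) ^ (a - 1) * h r) volume 0 t) :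
    fracInt a (fun r => g r - h r) t = fracInt a g t - fracInt a h t := by
  simp only [fracInt, mul_sub]
  rw [intervalIntegral.integral_sub hg hh, mul_sub]

lemma fracInt_add {a t : ℝ} {g h : ℝ → ℝ}
    (hg : IntervalIntegrable (fun r => (t - r) ^ (a - 1) * g r) volume 0 t)
    (hh : IntervalIntegrable (fun r => (t - r) ^ (a - 1) * h r) volume 0 t) :
    fracInt a (fun r => g r + h r) t = fracInt a g t + fracInt a h t := by
  simp only [fracInt, mul_add]
  rw [intervalIntegral.integral_add hg hh, mul_add]

lemma fracInt_const_mul {a t : ℝ} (c : ℝ) (h : ℝ → ℝ) :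
    fracInt a (fun r => c * h r) t = c * fracInt a h t := by
  simp only [fracInt, mul_left_comm _ c]
  rw [intervalIntegral.integral_const_mul]; ring

/-- The `N`-th Picard approximation of the solution `t ^ (b - 1) E_{a,b}(-μ t ^ a)` of
`X = t ^ (b - 1) / Γ(b) - μ I^a X`. -/
def picard (a b μ : ℝ) (N : ℕ) (t : ℝ) : ℝ :=
  ∑ n ∈ Finset.range N, (-μ) ^ n * (t ^ (a * n + b - 1) / Real.Gamma (a * n + b))

lemma continuous_picard {a b : ℝ} (ha : 0 < a) (hb : 1 ≤ b) (μ : ℝ) (N : ℕ) :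
    Continuous (picard a b μ N) := by
  refine continuous_finsetSum _ fun n _ => ?_
  have : 0 ≤ a * n + b - 1 := by
    have : 0 ≤ a * n := by positivity
    linarith
  exact continuous_const.mul ((Real.continuous_rpow_const this).div_const _)

lemma picard_succ {a b t : ℝ} (ha : 0 < a) (hb : 1 ≤ b) (μ : ℝ) (ht : 0 < t) (N : ℕ) :
    picard a b μ (N + 1) t
      = t ^ (b - 1) / Real.Gamma b - μ * fracInt a (picard a b μ N) t := by
  induction N with
  | zero => simp [picard, fracInt]
  | succ N ih =>
    have hp : 0 ≤ a * N := by positivity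
    have hex : 0 ≤ a * N + b - 1 := by linarith
    have e : picard a b μ (N + 1) = fun r => picard a b μ N r
        + (-μ) ^ N * (r ^ (a * N + b - 1) / Real.Gamma (a * N + b)) := by
      funext r; simp only [picard, Finset.sum_range_succ]
    have hc : Continuous fun r : ℝ => (-μ) ^ N * (r ^ (a * N + b - 1) / Real.Gamma (a * N + b)) :=
      continuous_const.mul ((Real.continuous_rpow_const hex).div_const _)
    rw [e, fracInt_add
      (intervalIntegrable_kernel_mul ha ht.le (continuous_picard ha hb μ N).continuousOn)
      (intervalIntegrable_kernel_mul ha ht.le hc.continuousOn),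
      fracInt_const_mul, fracInt_rpow ha (by linarith) ht]
    rw [picard, Finset.sum_range_succ, ← picard, ih]
    have e2 : a * ((N + 1 : ℕ) : ℝ) + b = a + (a * N + b) := by push_cast; ring
    rw [e2]; ring

lemma tendsto_picard {a b t : ℝ} (ha : 0 < a) (hb : 1 ≤ b) (μ : ℝ) (ht : 0 < t) :
    Tendsto (fun N => picard a b μ N t) atTop
      (𝓝 (t ^ (b - 1) * mittagLeffler a b (-μ * t ^ a))) := by
  have h := ((hasSum_mittagLeffler ha hb (-μ * t ^ a)).mul_left (t ^ (b - 1))).tendsto_sum_nat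
  refine h.congr fun N => Finset.sum_congr rfl fun n _ => ?_
  have : t ^ (a * n + b - 1) = t ^ (b - 1) * (t ^ a) ^ n := by
    rw [← Real.rpow_natCast, ← Real.rpow_mul ht.le, ← Real.rpow_add ht]; ring_nf
  rw [this, mul_pow]; ring

/-- A continuous solution of the Volterra equation
`X = c₁ t ^ (b₁ - 1) / Γ(b₁) + c₂ t ^ (b₂ - 1) / Γ(b₂) - μ I^a X` is given by Mittag-Leffler
functions: the `N`-th Picard iterate differs from `X` by at most
`M |μ| ^ N t ^ (a N) / Γ(a N + 1)`. -/
lemma eq_mittagLeffler_of_volterra {a b₁ b₂ μ c₁ c₂ T : ℝ} (ha : 0 < a) (hb₁ : 1 ≤ b₁)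
    (hb₂ : 1 ≤ b₂) {X : ℝ → ℝ} (hX : ContinuousOn X (Icc 0 T))
    (h : ∀ t ∈ Ioc 0 T, X t = c₁ * (t ^ (b₁ - 1) / Real.Gamma b₁)
      + c₂ * (t ^ (b₂ - 1) / Real.Gamma b₂) - μ * fracInt a X t) :
    ∀ t ∈ Ioc 0 T, X t = c₁ * (t ^ (b₁ - 1) * mittagLeffler a b₁ (-μ * t ^ a))
      + c₂ * (t ^ (b₂ - 1) * mittagLeffler a b₂ (-μ * t ^ a)) := by
  obtain ⟨M, hM⟩ := isCompact_Icc.exists_bound_of_continuousOn hX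
  have hS : ∀ N, Continuous fun t => c₁ * picard a b₁ μ N t + c₂ * picard a b₂ μ N t := fun N =>
    ((continuous_picard ha hb₁ μ N).const_mul c₁).add ((continuous_picard ha hb₂ μ N).const_mul c₂)
  have key : ∀ N : ℕ, ∀ t ∈ Ioc 0 T,
      |X t - (c₁ * picard a b₁ μ N t + c₂ * picard a b₂ μ N t)|
        ≤ M * |μ| ^ N * (t ^ (a * N + 1 - 1) / Real.Gamma (a * N + 1)) := by
    intro N
    induction N with
    | zero =>
      intro t ht
      simpa [picard] using hM t ⟨ht.1.le, ht.2⟩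
    | succ N ih =>
      intro t ht
      have hXt : ContinuousOn X (Icc 0 t) := hX.mono (Icc_subset_Icc_right ht.2)
      have hp : 0 ≤ a * N := by positivity
      have e : X t - (c₁ * picard a b₁ μ (N + 1) t + c₂ * picard a b₂ μ (N + 1) t)
          = -μ * fracInt a (fun r => X r -
            (c₁ * picard a b₁ μ N r + c₂ * picard a b₂ μ N r)) t := by
        rw [fracInt_sub (intervalIntegrable_kernel_mul ha ht.1.le hXt)
          (intervalIntegrable_kernel_mul ha ht.1.le (hS N).continuousOn),
          fracInt_add (intervalIntegrable_kernel_mul ha ht.1.le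
            ((continuous_picard ha hb₁ μ N).const_mul c₁).continuousOn)
            (intervalIntegrable_kernel_mul ha ht.1.le
            ((continuous_picard ha hb₂ μ N).const_mul c₂).continuousOn),
          fracInt_const_mul, fracInt_const_mul, picard_succ ha hb₁ μ ht.1,
          picard_succ ha hb₂ μ ht.1, h t ht]
        ring
      have hc : Continuous fun r : ℝ =>
          M * |μ| ^ N * (r ^ (a * N + 1 - 1) / Real.Gamma (a * N + 1)) :=
        continuous_const.mul ((Real.continuous_rpow_const (by linarith)).div_const _)
      have h2 := abs_fracInt_le_fracInt ha ht.1.le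
        (intervalIntegrable_kernel_mul ha ht.1.le hc.continuousOn)
        fun r hr => ih r ⟨hr.1, hr.2.le.trans ht.2⟩
      rw [fracInt_const_mul, fracInt_rpow ha (by linarith) ht.1] at h2
      rw [e, abs_mul, abs_neg]
      have e2 : a * ((N + 1 : ℕ) : ℝ) + 1 = a + (a * N + 1) := by push_cast; ring
      rw [e2]
      calc _ ≤ |μ| * _ := mul_le_mul_of_nonneg_left h2 (abs_nonneg _)
        _ = _ := by rw [pow_succ]; ring
  intro t ht
  have hlim := ((tendsto_picard ha hb₁ μ ht.1).const_mul c₁).add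
    ((tendsto_picard ha hb₂ μ ht.1).const_mul c₂)
  refine tendsto_nhds_unique (tendsto_of_tendsto_of_dist tendsto_const_nhds ?_) hlim
  have h0 := ((summable_mittagLeffler ha le_rfl (|μ| * t ^ a)).tendsto_atTop_zero).const_mul M
  rw [mul_zero] at h0
  refine squeeze_zero (fun _ => dist_nonneg) (fun N => ?_) h0
  refine (key N t ht).trans (le_of_eq ?_)
  have h1 : 0 ≤ t ^ a := Real.rpow_nonneg ht.1.le _
  rw [abs_mul, abs_abs, abs_of_nonneg h1, mul_pow, add_sub_cancel_right, Real.rpow_mul ht.1.le,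
    Real.rpow_natCast]
  ring

/-! ### Completeness of the adjoint system -/

/-- A continuous function on `[0,1]` with `g 0 = g 1` is determined by its Fourier
coefficients. -/
lemma eq_zero_of_fourier {g : ℝ → ℝ} (hg : ContinuousOn g (Icc 0 1)) (h01 : g 0 = g 1)
    (hs : ∀ k : ℕ, 1 ≤ k → ∫ x in (0 : ℝ)..1, g x * Real.sin (2 * k * Real.pi * x) = 0)
    (hc : ∀ k : ℕ, ∫ x in (0 : ℝ)..1, g x * Real.cos (2 * k * Real.pi * x) = 0) :
    ∀ x ∈ Icc (0 : ℝ) 1, g x = 0 := by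
  have hcZ : ∀ n : ℤ, ∫ x in (0 : ℝ)..1, g x * Real.cos (2 * n * Real.pi * x) = 0 := fun n => by
    obtain ⟨k, rfl | rfl⟩ := n.eq_nat_or_neg
    · exact_mod_cast hc k
    · refine Eq.trans (intervalIntegral.integral_congr fun x _ => ?_) (hc k)
      push_cast
      rw [← Real.cos_neg]; ring_nf
  have hsZ : ∀ n : ℤ, ∫ x in (0 : ℝ)..1, g x * Real.sin (2 * n * Real.pi * x) = 0 := fun n => by
    have h0 : ∀ k : ℕ, ∫ x in (0 : ℝ)..1, g x * Real.sin (2 * k * Real.pi * x) = 0 := fun k => by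
      rcases Nat.eq_zero_or_pos k with rfl | hk
      · simp
      · exact hs k hk
    obtain ⟨k, rfl | rfl⟩ := n.eq_nat_or_neg
    · exact_mod_cast h0 k
    · rw [← neg_eq_zero, ← intervalIntegral.integral_neg]
      refine Eq.trans (intervalIntegral.integral_congr fun x _ => ?_) (h0 k)
      push_cast
      rw [← mul_neg, ← Real.sin_neg]; ring_nf
  have hgi : IntervalIntegrable g volume 0 1 :=
    ContinuousOn.intervalIntegrable (by rwa [uIcc_of_le zero_le_one])
  have : Fact ((0 : ℝ) < 1) := ⟨one_pos⟩
  let G : ℝ → ℂ := fun x => (g x : ℂ)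
  have hcont : Continuous (AddCircle.liftIco (1 : ℝ) 0 G) := by
    refine AddCircle.liftIco_continuous (by simp [G, h01]) ?_
    rw [zero_add]
    exact Complex.continuous_ofReal.comp_continuousOn hg
  have hcoef : ∀ n : ℤ, fourierCoeff (AddCircle.liftIco (1 : ℝ) 0 G) n = 0 := fun n => by
    rw [fourierCoeff_liftIco_eq, fourierCoeffOn_eq_integral]
    have e : ∀ x : ℝ, (fourier (-n)) (x : AddCircle ((0 : ℝ) + 1 - 0)) • G x
        = ((g x * Real.cos (2 * n * Real.pi * x) : ℝ) : ℂ)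
          - ((g x * Real.sin (2 * n * Real.pi * x) : ℝ) : ℂ) * Complex.I := fun x => by
      rw [fourier_coe_apply]
      have : 2 * (Real.pi : ℂ) * Complex.I * ((-n : ℤ) : ℂ) * (x : ℂ)
          / (((0 : ℝ) + 1 - 0 : ℝ) : ℂ)
          = ((-(2 * n * Real.pi * x) : ℝ) : ℂ) * Complex.I := by push_cast; ring
      rw [this, Complex.exp_mul_I, ← Complex.ofReal_cos, ← Complex.ofReal_sin, Real.cos_neg,
        Real.sin_neg]
      simp only [G, smul_eq_mul]
      push_cast; ring
    simp only [e, zero_add, sub_zero, div_one, one_smul]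
    have i1 : IntervalIntegrable (fun x => ((g x * Real.cos (2 * n * Real.pi * x) : ℝ) : ℂ))
        volume 0 1 := by
      have := (hgi.mul_continuousOn (g := fun x => Real.cos (2 * n * Real.pi * x))
        (by fun_prop))
      exact ⟨this.1.ofReal, this.2.ofReal⟩
    have i2 : IntervalIntegrable (fun x => ((g x * Real.sin (2 * n * Real.pi * x) : ℝ) : ℂ)
        * Complex.I) volume 0 1 := by
      have := (hgi.mul_continuousOn (g := fun x => Real.sin (2 * n * Real.pi * x))
        (by fun_prop))
      exact IntervalIntegrable.mul_const ⟨this.1.ofReal, this.2.ofReal⟩ _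
    rw [intervalIntegral.integral_sub i1 i2, intervalIntegral.integral_mul_const,
      intervalIntegral.integral_ofReal, intervalIntegral.integral_ofReal, hcZ, hsZ]
    simp
  let f : C(AddCircle (1 : ℝ), ℂ) := ⟨_, hcont⟩
  have hf0 : ∀ y, f y = 0 := fun y => by
    have hs : Summable (fourierCoeff (f : AddCircle (1 : ℝ) → ℂ)) := by
      have : fourierCoeff (f : AddCircle (1 : ℝ) → ℂ) = 0 := funext hcoef
      rw [this]; exact summable_zero
    have := has_pointwise_sum_fourier_series_of_summable hs y
    have e : (fun i : ℤ => fourierCoeff (f : AddCircle (1 : ℝ) → ℂ) i • (fourier i) y)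
        = fun _ => 0 := by
      funext i
      have := hcoef i
      change fourierCoeff (AddCircle.liftIco (1 : ℝ) 0 G) i • _ = _
      rw [this, zero_smul]
    rw [e] at this
    exact this.unique hasSum_zero
  have hIco : ∀ x ∈ Ico (0 : ℝ) 1, g x = 0 := fun x hx => by
    have h1 : AddCircle.liftIco (1 : ℝ) 0 G x = G x :=
      AddCircle.liftIco_coe_apply (by simpa using hx)
    have h2 : AddCircle.liftIco (1 : ℝ) 0 G x = 0 := hf0 x
    rw [h1] at h2
    exact Complex.ofReal_eq_zero.1 h2
  intro x hx
  rcases hx.2.lt_or_eq with h | rfl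
  · exact hIco x ⟨hx.1, h⟩
  · rw [← h01]; exact hIco 0 ⟨le_rfl, one_pos⟩

lemma integral_comp_one_sub (φ : ℝ → ℝ) :
    ∫ x in (0 : ℝ)..1, φ (1 - x) = ∫ x in (0 : ℝ)..1, φ x := by
  simp [intervalIntegral.integral_comp_sub_left φ 1]

/-- Completeness of the system `sin 2kπx`, `(1 - x) cos 2kπx`. Orthogonality to the sines makes
`g` symmetric about `1/2`; for symmetric `g` the part of `(1 - x) g` symmetric about `1/2` is
`g / 2`, so the remaining conditions say that `g` is orthogonal to the cosines. -/
lemma eq_zero_of_orthogonal {g : ℝ → ℝ} (hg : ContinuousOn g (Icc 0 1)) (h01 : g 0 = g 1)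
    (hs : ∀ k : ℕ, 1 ≤ k → ∫ x in (0 : ℝ)..1, g x * Real.sin (2 * k * Real.pi * x) = 0)
    (hc : ∀ k : ℕ, ∫ x in (0 : ℝ)..1, g x * ((1 - x) * Real.cos (2 * k * Real.pi * x)) = 0) :
    ∀ x ∈ Icc (0 : ℝ) 1, g x = 0 := by
  have hgr : ContinuousOn (fun x => g (1 - x)) (Icc 0 1) :=
    hg.comp (by fun_prop) fun x hx => ⟨by linarith [hx.2], by linarith [hx.1]⟩
  have hi : ∀ {f h : ℝ → ℝ}, ContinuousOn f (Icc 0 1) → Continuous h →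
      IntervalIntegrable (fun x => f x * h x) volume 0 1 := fun hf hh =>
    ContinuousOn.intervalIntegrable (by rw [uIcc_of_le zero_le_one]; exact hf.mul hh.continuousOn)
  have ecos : ∀ (k : ℕ) (x : ℝ), Real.cos (2 * k * Real.pi * (1 - x))
      = Real.cos (2 * k * Real.pi * x) := fun k x => by
    have : 2 * k * Real.pi * (1 - x) = k * (2 * Real.pi) - 2 * k * Real.pi * x := by ring
    rw [this, Real.cos_nat_mul_two_pi_sub]
  have esin : ∀ (k : ℕ) (x : ℝ), Real.sin (2 * k * Real.pi * (1 - x))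
      = -Real.sin (2 * k * Real.pi * x) := fun k x => by
    have : 2 * k * Real.pi * (1 - x) = k * (2 * Real.pi) - 2 * k * Real.pi * x := by ring
    rw [this, Real.sin_nat_mul_two_pi_sub]
  have hodd : ∀ x ∈ Icc (0 : ℝ) 1, g x - g (1 - x) = 0 := by
    refine eq_zero_of_fourier (hg.sub hgr) (by simp [h01]) (fun k hk => ?_) fun k => ?_
    · simp only [sub_mul]
      rw [intervalIntegral.integral_sub (hi hg (by fun_prop)) (hi hgr (by fun_prop)),
        ← integral_comp_one_sub (fun x => g (1 - x) * _), hs k hk]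
      simp [esin, hs k hk]
    · simp only [sub_mul]
      rw [intervalIntegral.integral_sub (hi hg (by fun_prop)) (hi hgr (by fun_prop)),
        ← integral_comp_one_sub (fun x => g (1 - x) * _)]
      simp [ecos]
  refine eq_zero_of_fourier hg h01 hs fun k => ?_
  have h1 := hc k
  have h2 := hc k
  rw [← integral_comp_one_sub] at h2
  have h3 : ∫ x in (0 : ℝ)..1, g x * (x * Real.cos (2 * k * Real.pi * x)) = 0 := by
    refine Eq.trans (intervalIntegral.integral_congr fun x hx => ?_) h2
    rw [uIcc_of_le zero_le_one] at hx
    simp only [ecos, sub_sub_cancel, sub_eq_zero.1 (hodd x hx)]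
  have h4 := intervalIntegral.integral_add
    (hi hg (h := fun x => (1 - x) * Real.cos (2 * k * Real.pi * x)) (by fun_prop))
    (hi hg (h := fun x => x * Real.cos (2 * k * Real.pi * x)) (by fun_prop))
  rw [h1, h3, add_zero] at h4
  refine Eq.trans (intervalIntegral.integral_congr fun x _ => ?_) h4
  ring

/-! ### Truncation of the adjoint functions at the end points -/

/-- A smooth function equal to `1` on `(-∞, 1]` and to `0` on `[2, ∞)`. -/
def cutoff (y : ℝ) : ℝ := 1 - Real.smoothTransition (y - 1)

lemma contDiff_cutoff : ContDiff ℝ 2 cutoff :=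
  contDiff_const.sub
    ((Real.smoothTransition.contDiff (n := 2)).comp (contDiff_id.sub contDiff_const))

lemma cutoff_of_le {y : ℝ} (hy : y ≤ 1) : cutoff y = 1 := by
  simp [cutoff, Real.smoothTransition.zero_of_nonpos (sub_nonpos.2 hy)]

lemma cutoff_of_ge {y : ℝ} (hy : 2 ≤ y) : cutoff y = 0 := by
  simp [cutoff, Real.smoothTransition.one_of_one_le (show 1 ≤ y - 1 by linarith)]

lemma abs_cutoff_le (y : ℝ) : |cutoff y| ≤ 1 := by
  have h0 := Real.smoothTransition.nonneg (y - 1)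
  have h1 := Real.smoothTransition.le_one (y - 1)
  rw [cutoff, abs_le]; constructor <;> linarith

lemma deriv_cutoff_of_gt {y : ℝ} (hy : 2 < y) : deriv cutoff y = 0 := by
  have : cutoff =ᶠ[𝓝 y] fun _ => 0 := by
    filter_upwards [lt_mem_nhds hy] with z hz using cutoff_of_ge (le_of_lt hz)
  rw [this.deriv_eq]; simp

lemma deriv_deriv_cutoff_of_gt {y : ℝ} (hy : 2 < y) : deriv (deriv cutoff) y = 0 := by
  have : deriv cutoff =ᶠ[𝓝 y] fun _ => 0 := by
    filter_upwards [lt_mem_nhds hy] with z hz using deriv_cutoff_of_gt hz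
  rw [this.deriv_eq]; simp

lemma contDiff_one_deriv {Z : ℝ → ℝ} (hZ : ContDiff ℝ 2 Z) : ContDiff ℝ 1 (deriv Z) :=
  ((contDiff_succ_iff_deriv (n := 1)).1 hZ).2.2

lemma continuous_deriv_deriv {Z : ℝ → ℝ} (hZ : ContDiff ℝ 2 Z) : Continuous (deriv (deriv Z)) :=
  (contDiff_one_deriv hZ).continuous_deriv le_rfl

lemma hasDerivAt_of_contDiff_two {Z : ℝ → ℝ} (hZ : ContDiff ℝ 2 Z) (x : ℝ) :
    HasDerivAt Z (deriv Z x) x ∧ HasDerivAt (deriv Z) (deriv (deriv Z) x) x :=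
  ⟨((hZ.differentiable (by norm_num)) x).hasDerivAt,
    (((contDiff_one_deriv hZ).differentiable (by norm_num)) x).hasDerivAt⟩

lemma deriv_deriv_cutoff_mul {Z : ℝ → ℝ} (hZ : ContDiff ℝ 2 Z) (N x : ℝ) :
    deriv (deriv fun x => cutoff (N * x) * Z x) x
      = N ^ 2 * deriv (deriv cutoff) (N * x) * Z x + 2 * N * deriv cutoff (N * x) * deriv Z x
        + cutoff (N * x) * deriv (deriv Z) x := by
  have hlin : ∀ x, HasDerivAt (fun x : ℝ => N * x) N x := fun x => by
    simpa using (hasDerivAt_id x).const_mul N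
  have h1 : deriv (fun x => cutoff (N * x) * Z x)
      = fun x => deriv cutoff (N * x) * N * Z x + cutoff (N * x) * deriv Z x := by
    funext x
    exact (((hasDerivAt_of_contDiff_two contDiff_cutoff (N * x)).1.comp x (hlin x)).mul
      (hasDerivAt_of_contDiff_two hZ x).1).deriv
  rw [h1]
  have h2 := (((((hasDerivAt_of_contDiff_two contDiff_cutoff (N * x)).2.comp x (hlin x)).mul_const
    N).mul (hasDerivAt_of_contDiff_two hZ x).1).add
    (((hasDerivAt_of_contDiff_two contDiff_cutoff (N * x)).1.comp x (hlin x)).mul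
      (hasDerivAt_of_contDiff_two hZ x).2)).deriv
  refine Eq.trans h2 ?_
  simp only [Function.comp_apply]
  ring

lemma deriv_deriv_comp_one_sub (R : ℝ → ℝ) (x : ℝ) :
    deriv (deriv fun x => R (1 - x)) x = deriv (deriv R) (1 - x) := by
  have : deriv (fun x => R (1 - x)) = fun x => -deriv R (1 - x) := by
    funext y; rw [deriv_comp_const_sub]
  rw [this, deriv.fun_neg, deriv_comp_const_sub, neg_neg]

/-- The contribution of a cutoff at the end point `0`: although the second derivative of
`cutoff (N x)` is of size `N ^ 2`, it lives on an interval of length `2 / N`, where `D Z` is at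
most `2 η / N`. -/
lemma exists_abs_integral_cutoff_le {Z : ℝ → ℝ} (hZ : ContDiff ℝ 2 Z) :
    ∃ C, 0 ≤ C ∧ ∀ D : ℝ → ℝ, ContinuousOn D (Icc 0 1) → ∀ N : ℝ, 2 ≤ N → ∀ η : ℝ, 0 ≤ η →
      (∀ x ∈ Icc 0 (2 / N), |D x * Z x| ≤ η * x ∧ |D x| ≤ η) →
      |∫ x in (0 : ℝ)..1, D x * deriv (deriv fun x => cutoff (N * x) * Z x) x| ≤ C * η := by
  obtain ⟨K₁, hK₁⟩ := (isCompact_Icc (a := (0 : ℝ)) (b := 2)).exists_bound_of_continuousOn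
    ((contDiff_one_deriv contDiff_cutoff).continuous.continuousOn)
  obtain ⟨K₂, hK₂⟩ := (isCompact_Icc (a := (0 : ℝ)) (b := 2)).exists_bound_of_continuousOn
    ((continuous_deriv_deriv contDiff_cutoff).continuousOn)
  obtain ⟨L₁, hL₁⟩ := (isCompact_Icc (a := (0 : ℝ)) (b := 1)).exists_bound_of_continuousOn
    ((contDiff_one_deriv hZ).continuous.continuousOn)
  obtain ⟨L₂, hL₂⟩ := (isCompact_Icc (a := (0 : ℝ)) (b := 1)).exists_bound_of_continuousOn
    ((continuous_deriv_deriv hZ).continuousOn)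
  have hK₁0 : 0 ≤ K₁ := (norm_nonneg _).trans (hK₁ 0 (by simp))
  have hK₂0 : 0 ≤ K₂ := (norm_nonneg _).trans (hK₂ 0 (by simp))
  have hL₁0 : 0 ≤ L₁ := (norm_nonneg _).trans (hL₁ 0 (by simp))
  have hL₂0 : 0 ≤ L₂ := (norm_nonneg _).trans (hL₂ 0 (by simp))
  refine ⟨4 * K₂ + 4 * K₁ * L₁ + L₂, by positivity, fun D hD N hN η hη H => ?_⟩
  have hN0 : 0 < N := by linarith
  have h2N : 2 / N ≤ 1 := by rw [div_le_one hN0]; exact hN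
  have h2N0 : 0 ≤ 2 / N := by positivity
  have hcont : Continuous (deriv (deriv fun x => cutoff (N * x) * Z x)) :=
    continuous_deriv_deriv ((contDiff_cutoff.comp (contDiff_const.mul contDiff_id)).mul hZ)
  have hint : ∀ c d, 0 ≤ c → c ≤ d → d ≤ 1 → IntervalIntegrable
      (fun x => D x * deriv (deriv fun x => cutoff (N * x) * Z x) x) volume c d :=
    fun c d hc hcd hd => ContinuousOn.intervalIntegrable (by
      rw [uIcc_of_le hcd]
      exact (hD.mono (Icc_subset_Icc hc hd)).mul hcont.continuousOn)
  rw [← intervalIntegral.integral_add_adjacent_intervals (hint 0 (2 / N) le_rfl h2N0 h2N)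
    (hint (2 / N) 1 h2N0 h2N le_rfl)]
  have hzero : ∫ x in (2 / N)..1, D x * deriv (deriv fun x => cutoff (N * x) * Z x) x = 0 := by
    rw [intervalIntegral.integral_congr_ae (g := fun _ => 0)]
    · simp
    refine Eventually.of_forall fun x hx => ?_
    rw [uIoc_of_le h2N] at hx
    have : 2 < N * x := by have := hx.1; rw [div_lt_iff₀ hN0] at this; linarith
    rw [deriv_deriv_cutoff_mul hZ, deriv_cutoff_of_gt this, deriv_deriv_cutoff_of_gt this,
      cutoff_of_ge this.le]
    ring
  rw [hzero, add_zero]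
  have hb : ∀ x ∈ uIoc 0 (2 / N), ‖D x * deriv (deriv fun x => cutoff (N * x) * Z x) x‖
      ≤ (N ^ 2 * K₂ * (2 / N) + 2 * N * K₁ * L₁ + L₂) * η := fun x hx => by
    rw [uIoc_of_le h2N0] at hx
    have hx1 : x ∈ Icc (0 : ℝ) 1 := ⟨hx.1.le, hx.2.trans h2N⟩
    have hNx : N * x ∈ Icc (0 : ℝ) 2 := ⟨by have := hx.1; positivity, by
      have := hx.2; rw [le_div_iff₀ hN0] at this; linarith⟩
    obtain ⟨hDZ, hDη⟩ := H x ⟨hx.1.le, hx.2⟩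
    have k1 := hK₁ _ hNx
    have k2 := hK₂ _ hNx
    have l1 := hL₁ _ hx1
    have l2 := hL₂ _ hx1
    rw [Real.norm_eq_abs] at k1 k2 l1 l2
    have e : D x * deriv (deriv fun x => cutoff (N * x) * Z x) x
        = N ^ 2 * deriv (deriv cutoff) (N * x) * (D x * Z x)
          + 2 * N * deriv cutoff (N * x) * deriv Z x * D x
          + cutoff (N * x) * deriv (deriv Z) x * D x := by
      rw [deriv_deriv_cutoff_mul hZ]; ring
    rw [e, Real.norm_eq_abs]
    have t1 : |N ^ 2 * deriv (deriv cutoff) (N * x) * (D x * Z x)|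
        ≤ N ^ 2 * K₂ * (η * (2 / N)) := by
      rw [abs_mul, abs_mul, abs_of_nonneg (by positivity : 0 ≤ N ^ 2)]
      have : |D x * Z x| ≤ η * (2 / N) := hDZ.trans (mul_le_mul_of_nonneg_left hx.2 hη)
      gcongr
    have t2 : |2 * N * deriv cutoff (N * x) * deriv Z x * D x| ≤ 2 * N * K₁ * L₁ * η := by
      rw [abs_mul, abs_mul, abs_mul, abs_of_nonneg (by positivity : 0 ≤ 2 * N)]
      gcongr
    have t3 : |cutoff (N * x) * deriv (deriv Z) x * D x| ≤ 1 * L₂ * η := by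
      rw [abs_mul, abs_mul]
      have := abs_cutoff_le (N * x)
      gcongr
    calc _ ≤ _ := abs_add_three _ _ _
      _ ≤ N ^ 2 * K₂ * (η * (2 / N)) + 2 * N * K₁ * L₁ * η + 1 * L₂ * η := by linarith
      _ = _ := by ring
  have := intervalIntegral.norm_integral_le_of_norm_le_const hb
  rw [Real.norm_eq_abs, sub_zero, abs_of_nonneg h2N0] at this
  refine this.trans ?_
  have e : (N ^ 2 * K₂ * (2 / N) + 2 * N * K₁ * L₁ + L₂) * η * (2 / N)
      = (4 * K₂ + 4 * K₁ * L₁ + L₂ * (2 / N)) * η := by field_simp; ring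
  rw [e]
  refine mul_le_mul_of_nonneg_right ?_ hη
  have : L₂ * (2 / N) ≤ L₂ * 1 := mul_le_mul_of_nonneg_left h2N hL₂0
  linarith

/-- The function `Y`, cut off to the interval `(1 / (n + 3), 1 - 1 / (n + 3))`. The sum of the
two cutoffs (rather than their product) keeps the end points separate in the second derivative. -/
def truncation (Y : ℝ → ℝ) (n : ℕ) (x : ℝ) : ℝ :=
  Y x - cutoff ((n + 3) * x) * Y x - cutoff ((n + 3) * (1 - x)) * Y x

lemma contDiff_cutoff_mul {Z : ℝ → ℝ} (hZ : ContDiff ℝ 2 Z) (N : ℝ) :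
    ContDiff ℝ 2 fun x => cutoff (N * x) * Z x :=
  (contDiff_cutoff.comp (contDiff_const.mul contDiff_id)).mul hZ

lemma contDiff_comp_one_sub {Z : ℝ → ℝ} (hZ : ContDiff ℝ 2 Z) :
    ContDiff ℝ 2 fun x => Z (1 - x) := hZ.comp (contDiff_const.sub contDiff_id)

lemma contDiff_truncation {Y : ℝ → ℝ} (hY : ContDiff ℝ 2 Y) (n : ℕ) :
    ContDiff ℝ 2 (truncation Y n) :=
  (hY.sub (contDiff_cutoff_mul hY _)).sub
    ((contDiff_cutoff.comp (contDiff_const.mul (contDiff_const.sub contDiff_id))).mul hY)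

lemma truncation_of_le (Y : ℝ → ℝ) (n : ℕ) {x : ℝ} (hx : x ≤ 1 / ((n : ℝ) + 3)) :
    truncation Y n x = 0 := by
  have hn : (0 : ℝ) ≤ n := n.cast_nonneg
  rw [le_div_iff₀ (by positivity)] at hx
  rw [truncation, cutoff_of_le (by linarith), cutoff_of_ge (by nlinarith)]
  ring

lemma truncation_of_ge (Y : ℝ → ℝ) (n : ℕ) {x : ℝ} (hx : 1 - 1 / ((n : ℝ) + 3) ≤ x) :
    truncation Y n x = 0 := by
  have hn : (0 : ℝ) ≤ n := n.cast_nonneg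
  have hx' : 1 - x ≤ 1 / ((n : ℝ) + 3) := by linarith
  rw [le_div_iff₀ (by positivity)] at hx'
  rw [truncation, cutoff_of_ge (y := (n + 3) * x) (by nlinarith), cutoff_of_le (by linarith)]
  ring

lemma abs_truncation_le (Y : ℝ → ℝ) (n : ℕ) (x : ℝ) : |truncation Y n x| ≤ 3 * |Y x| := by
  have h1 := abs_cutoff_le ((n + 3) * x)
  have h2 := abs_cutoff_le ((n + 3) * (1 - x))
  have e : truncation Y n x
      = (1 - cutoff ((n + 3) * x) - cutoff ((n + 3) * (1 - x))) * Y x := by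
    rw [truncation]; ring
  rw [e, abs_mul]
  refine mul_le_mul_of_nonneg_right ?_ (abs_nonneg _)
  rw [abs_le] at *
  constructor <;> linarith

lemma tendsto_truncation (Y : ℝ → ℝ) {x : ℝ} (hx : x ∈ Ioo (0 : ℝ) 1) :
    Tendsto (fun n => truncation Y n x) atTop (𝓝 (Y x)) := by
  have hbig : ∀ c : ℝ, 0 < c → ∀ᶠ n : ℕ in atTop, 2 ≤ ((n : ℝ) + 3) * c := fun c hc => by
    have h : Tendsto (fun n : ℕ => ((n : ℝ) + 3) * c) atTop atTop :=
      (tendsto_natCast_atTop_atTop.atTop_add tendsto_const_nhds).atTop_mul_const hc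
    exact h.eventually_ge_atTop 2
  refine Tendsto.congr' ?_ tendsto_const_nhds
  filter_upwards [hbig x hx.1, hbig (1 - x) (by linarith [hx.2])] with n h1 h2
  rw [truncation, cutoff_of_ge h1, cutoff_of_ge h2]; ring

lemma integral_deriv_deriv {Z : ℝ → ℝ} (hZ : ContDiff ℝ 2 Z) (c d : ℝ) :
    ∫ x in c..d, deriv (deriv Z) x = deriv Z d - deriv Z c :=
  intervalIntegral.integral_eq_sub_of_hasDerivAt
    (fun x _ => (hasDerivAt_of_contDiff_two hZ x).2)
    ((continuous_deriv_deriv hZ).intervalIntegrable _ _)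

lemma deriv_truncation_zero (Y : ℝ → ℝ) (n : ℕ) : deriv (truncation Y n) 0 = 0 := by
  have : truncation Y n =ᶠ[𝓝 0] fun _ => 0 := by
    filter_upwards [gt_mem_nhds (show (0 : ℝ) < 1 / ((n : ℝ) + 3) by positivity)] with x hx
      using truncation_of_le Y n hx.le
  rw [this.deriv_eq]; simp

lemma deriv_truncation_one (Y : ℝ → ℝ) (n : ℕ) : deriv (truncation Y n) 1 = 0 := by
  have : truncation Y n =ᶠ[𝓝 1] fun _ => 0 := by
    have h : (1 : ℝ) - 1 / ((n : ℝ) + 3) < 1 := by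
      have : 0 < 1 / ((n : ℝ) + 3) := by positivity
      linarith
    filter_upwards [lt_mem_nhds h] with x hx using truncation_of_ge Y n hx.le
  rw [this.deriv_eq]; simp

lemma deriv_deriv_truncation {Y : ℝ → ℝ} (hY : ContDiff ℝ 2 Y) (n : ℕ) (x : ℝ) :
    deriv (deriv (truncation Y n)) x = deriv (deriv Y) x
      - deriv (deriv fun x => cutoff (((n : ℝ) + 3) * x) * Y x) x
      - deriv (deriv fun x => cutoff (((n : ℝ) + 3) * x) * Y (1 - x)) (1 - x) := by
  have hR := contDiff_cutoff_mul (contDiff_comp_one_sub hY) ((n : ℝ) + 3)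
  have hR' := contDiff_comp_one_sub hR
  have hP := contDiff_cutoff_mul hY ((n : ℝ) + 3)
  have e : truncation Y n = fun x => Y x - cutoff (((n : ℝ) + 3) * x) * Y x
      - (fun x => cutoff (((n : ℝ) + 3) * x) * Y (1 - x)) (1 - x) := by
    funext y; simp [truncation]
  rw [← deriv_deriv_comp_one_sub]
  have h1 : deriv (truncation Y n) = fun x => deriv Y x
      - deriv (fun x => cutoff (((n : ℝ) + 3) * x) * Y x) x
      - deriv (fun x => (fun x => cutoff (((n : ℝ) + 3) * x) * Y (1 - x)) (1 - x)) x := by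
    funext y
    rw [e]
    exact (((hasDerivAt_of_contDiff_two hY y).1.sub (hasDerivAt_of_contDiff_two hP y).1).sub
      (hasDerivAt_of_contDiff_two hR' y).1).deriv
  rw [h1]
  exact (((hasDerivAt_of_contDiff_two hY x).2.sub (hasDerivAt_of_contDiff_two hP x).2).sub
      (hasDerivAt_of_contDiff_two hR' x).2).deriv

/-- Replacing `Y` by its truncation changes `∫ A Y''` by at most `C η`, if `A` has slope at most
`η` at the end point `0` and oscillation at most `η` at the end point `1`. The two boundary
conditions on `Y`, which are those adjoint to `A 0 = A 1`, `A' 0 = 0`, make this possible. -/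
lemma exists_abs_integral_truncation_sub_le {Y : ℝ → ℝ} (hY : ContDiff ℝ 2 Y) (hY1 : Y 1 = 0)
    (hY' : deriv Y 0 = deriv Y 1) :
    ∃ C, 0 ≤ C ∧ ∀ A : ℝ → ℝ, ContinuousOn A (Icc 0 1) → A 0 = A 1 → ∀ n : ℕ, ∀ η : ℝ, 0 ≤ η →
      (∀ x ∈ Icc (0 : ℝ) (2 / ((n : ℝ) + 3)), |A x - A 0| ≤ η * x ∧ |A (1 - x) - A 1| ≤ η) →
      |(∫ x in (0 : ℝ)..1, A x * deriv (deriv (truncation Y n)) x)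
        - ∫ x in (0 : ℝ)..1, A x * deriv (deriv Y) x| ≤ C * η := by
  obtain ⟨C₁, hC₁, H₁⟩ := exists_abs_integral_cutoff_le hY
  obtain ⟨C₂, hC₂, H₂⟩ := exists_abs_integral_cutoff_le (contDiff_comp_one_sub hY)
  obtain ⟨K₀, hK₀⟩ := (isCompact_Icc (a := (0 : ℝ)) (b := 1)).exists_bound_of_continuousOn
    (hY.continuous.continuousOn)
  obtain ⟨K₁, hK₁⟩ := (isCompact_Icc (a := (0 : ℝ)) (b := 1)).exists_bound_of_continuousOn
    ((contDiff_one_deriv hY).continuous.continuousOn)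
  have hK₀0 : 0 ≤ K₀ := (norm_nonneg _).trans (hK₀ 0 (by simp))
  have hK₁0 : 0 ≤ K₁ := (norm_nonneg _).trans (hK₁ 0 (by simp))
  refine ⟨C₁ * (K₀ + 1) + C₂ * (K₁ + 1), by positivity, fun A hA hA01 n η hη H => ?_⟩
  set N : ℝ := (n : ℝ) + 3 with hN
  have hn : (0 : ℝ) ≤ n := n.cast_nonneg
  have hN2 : 2 ≤ N := by linarith
  have h2N : 2 / N ≤ 1 := by rw [div_le_one (by linarith)]; exact hN2
  have hAr : ContinuousOn (fun x => A (1 - x)) (Icc 0 1) :=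
    hA.comp (by fun_prop) fun x hx => ⟨by linarith [hx.2], by linarith [hx.1]⟩
  set P := deriv (deriv fun x => cutoff (N * x) * Y x) with hP
  set R := deriv (deriv fun x => cutoff (N * x) * Y (1 - x)) with hR
  have hPc : Continuous P := continuous_deriv_deriv (contDiff_cutoff_mul hY N)
  have hRc : Continuous R :=
    continuous_deriv_deriv (contDiff_cutoff_mul (contDiff_comp_one_sub hY) N)
  have hi : ∀ {f h : ℝ → ℝ}, ContinuousOn f (Icc 0 1) → Continuous h →
      IntervalIntegrable (fun x => f x * h x) volume 0 1 := fun hf hh =>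
    ContinuousOn.intervalIntegrable (by rw [uIcc_of_le zero_le_one]; exact hf.mul hh.continuousOn)
  have hD : ContinuousOn (fun x => A x - A 0) (Icc 0 1) := hA.sub continuousOn_const
  have hDr : ContinuousOn (fun x => A (1 - x) - A 0) (Icc 0 1) := hAr.sub continuousOn_const
  have hT'' := continuous_deriv_deriv (contDiff_truncation hY n)
  have hY'' := continuous_deriv_deriv hY
  -- The constant `A 0` integrates to zero against both second derivatives.
  have eT : ∫ x in (0 : ℝ)..1, A x * deriv (deriv (truncation Y n)) x
      = ∫ x in (0 : ℝ)..1, (A x - A 0) * deriv (deriv (truncation Y n)) x := by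
    simp only [sub_mul]
    rw [intervalIntegral.integral_sub (hi hA hT'') (hi continuousOn_const hT''),
      intervalIntegral.integral_const_mul, integral_deriv_deriv (contDiff_truncation hY n),
      deriv_truncation_zero, deriv_truncation_one]
    simp
  have eY : ∫ x in (0 : ℝ)..1, A x * deriv (deriv Y) x
      = ∫ x in (0 : ℝ)..1, (A x - A 0) * deriv (deriv Y) x := by
    simp only [sub_mul]
    rw [intervalIntegral.integral_sub (hi hA hY'') (hi continuousOn_const hY''),
      intervalIntegral.integral_const_mul, integral_deriv_deriv hY, hY']
    simp
  have eR : ∫ x in (0 : ℝ)..1, (A (1 - x) - A 0) * R x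
      = ∫ x in (0 : ℝ)..1, (A x - A 0) * R (1 - x) := by
    rw [← integral_comp_one_sub]; simp
  have e : (∫ x in (0 : ℝ)..1, A x * deriv (deriv (truncation Y n)) x)
        - ∫ x in (0 : ℝ)..1, A x * deriv (deriv Y) x
      = -((∫ x in (0 : ℝ)..1, (A x - A 0) * P x)
        + ∫ x in (0 : ℝ)..1, (A (1 - x) - A 0) * R x) := by
    rw [eT, eY, eR, ← intervalIntegral.integral_sub (hi hD hT'') (hi hD hY''),
      ← intervalIntegral.integral_add (hi hD hPc)
        (hi hD (h := fun x => R (1 - x)) (by fun_prop)), ← intervalIntegral.integral_neg]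
    refine intervalIntegral.integral_congr fun x _ => ?_
    simp only [deriv_deriv_truncation hY n x]
    ring
  have b1 := H₁ (fun x => A x - A 0) hD N hN2 ((K₀ + 1) * η) (by positivity) fun x hx => by
    have hx1 : x ≤ 1 := hx.2.trans h2N
    have h1 := (H x hx).1
    have h2 : |Y x| ≤ K₀ := hK₀ x ⟨hx.1, hx1⟩
    have h3 : η * x ≤ η * 1 := mul_le_mul_of_nonneg_left hx1 hη
    have h4 : 0 ≤ η * x := mul_nonneg hη hx.1
    refine ⟨?_, ?_⟩
    · rw [abs_mul]
      calc |A x - A 0| * |Y x| ≤ (η * x) * K₀ := by gcongr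
        _ ≤ (K₀ + 1) * η * x := by nlinarith
    · nlinarith
  have b2 := H₂ (fun x => A (1 - x) - A 0) hDr N hN2 ((K₁ + 1) * η) (by positivity) fun x hx => by
    have hx1 : x ≤ 1 := hx.2.trans h2N
    have h1 := (H x hx).2
    rw [← hA01] at h1
    have h2 : |Y (1 - x)| ≤ K₁ * x := by
      have := Convex.norm_image_sub_le_of_norm_deriv_le (f := Y) (s := Icc 0 1) (C := K₁)
        (fun y _ => (hasDerivAt_of_contDiff_two hY y).1.differentiableAt) hK₁ (convex_Icc 0 1)
        (show (1 : ℝ) ∈ Icc (0 : ℝ) 1 by simp)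
        (show 1 - x ∈ Icc (0 : ℝ) 1 from ⟨by linarith, by linarith [hx.1]⟩)
      rw [hY1, sub_zero, Real.norm_eq_abs, Real.norm_eq_abs] at this
      have e1 : |1 - x - 1| = x := by rw [sub_sub_cancel_left, abs_neg, abs_of_nonneg hx.1]
      rwa [e1] at this
    refine ⟨?_, ?_⟩
    · rw [abs_mul]
      calc |A (1 - x) - A 0| * |Y (1 - x)| ≤ η * (K₁ * x) := by gcongr
        _ ≤ (K₁ + 1) * η * x := by nlinarith [mul_nonneg hη hx.1]
    · nlinarith
  rw [e, abs_neg]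
  calc _ ≤ |∫ x in (0 : ℝ)..1, (A x - A 0) * P x|
        + |∫ x in (0 : ℝ)..1, (A (1 - x) - A 0) * R x| := abs_add_le _ _
    _ ≤ C₁ * ((K₀ + 1) * η) + C₂ * ((K₁ + 1) * η) := add_le_add b1 b2
    _ = _ := by ring

/-- For `A` satisfying the boundary conditions, `∫ A Y''` is the limit of the same integrals for
the truncations of `Y`. -/
lemma tendsto_integral_deriv_deriv_truncation {Y : ℝ → ℝ} (hY : ContDiff ℝ 2 Y) (hY1 : Y 1 = 0)
    (hY' : deriv Y 0 = deriv Y 1) {A : ℝ → ℝ} (hA : ContinuousOn A (Icc 0 1)) (hA01 : A 0 = A 1)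
    (hA' : HasDerivWithinAt A 0 (Ici 0) 0) :
    Tendsto (fun n => ∫ x in (0 : ℝ)..1, A x * deriv (deriv (truncation Y n)) x) atTop
      (𝓝 (∫ x in (0 : ℝ)..1, A x * deriv (deriv Y) x)) := by
  obtain ⟨C, hC, H⟩ := exists_abs_integral_truncation_sub_le hY hY1 hY'
  rw [Metric.tendsto_atTop]
  intro ε hε
  set η := ε / (2 * (C + 1)) with hη
  have hη0 : 0 < η := by positivity
  have h0 : ∀ᶠ x in 𝓝[≥] (0 : ℝ), |A x - A 0| ≤ η * x := by
    rw [hasDerivWithinAt_iff_isLittleO] at hA'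
    filter_upwards [hA'.def hη0, self_mem_nhdsWithin] with x hx hx0
    have hx0' : (0 : ℝ) ≤ x := hx0
    simpa [abs_of_nonneg hx0'] using hx
  have h1 : ∀ᶠ x in 𝓝[≥] (0 : ℝ), |A (1 - x) - A 1| ≤ η := by
    have hc : ContinuousWithinAt (fun x => A (1 - x)) (Icc 0 1) 0 :=
      (hA.comp (s := Icc 0 1) (f := fun x : ℝ => 1 - x) (by fun_prop)
        fun x hx => ⟨by linarith [hx.2], by linarith [hx.1]⟩) 0 (by simp)
    have hc' : Tendsto (fun x => A (1 - x)) (𝓝[≥] 0) (𝓝 (A 1)) := by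
      have := hc.tendsto
      rwa [nhdsWithin_Icc_eq_nhdsGE one_pos, sub_zero] at this
    filter_upwards [hc' (Metric.ball_mem_nhds _ hη0)] with x hx
    exact (le_of_lt hx)
  obtain ⟨δ, hδ, Hδ⟩ := (mem_nhdsGE_iff_exists_Icc_subset (a := (0 : ℝ))).1 (h0.and h1)
  have hlim : Tendsto (fun n : ℕ => 2 / ((n : ℝ) + 3)) atTop (𝓝 0) :=
    tendsto_const_nhds.div_atTop (tendsto_natCast_atTop_atTop.atTop_add tendsto_const_nhds)
  obtain ⟨n₀, hn₀⟩ := eventually_atTop.1 (hlim.eventually (gt_mem_nhds hδ))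
  refine ⟨n₀, fun n hn => ?_⟩
  have := H A hA hA01 n η hη0.le fun x hx => Hδ ⟨hx.1, hx.2.trans (hn₀ n hn).le⟩
  rw [Real.dist_eq]
  refine this.trans_lt ?_
  rw [hη, mul_div_assoc', div_lt_iff₀ (by positivity)]
  nlinarith

/-! ### Test functions, Fubini's theorem and bounds near compact sets -/

/-- A twice continuously differentiable test function that vanishes outside
`[a,b] ⊆ (0,1)`. -/
structure IsTest (ψ : ℝ → ℝ) (a b : ℝ) : Prop where
  contDiff : ContDiff ℝ 2 ψ
  pos : 0 < a
  le : a ≤ b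
  lt_one : b < 1
  left : ∀ x ≤ a, ψ x = 0
  right : ∀ x, b ≤ x → ψ x = 0

lemma deriv_eq_zero_of_Iic {g : ℝ → ℝ} {a : ℝ} (hg : Differentiable ℝ g)
    (h : ∀ x ≤ a, g x = 0) : ∀ x ≤ a, deriv g x = 0 := fun x hx => by
  have h1 : HasDerivWithinAt g 0 (Iic x) x :=
    (hasDerivWithinAt_const x (Iic x) (0 : ℝ)).congr (fun y hy => h y (le_trans hy hx)) (h x hx)
  exact (uniqueDiffOn_Iic x x self_mem_Iic).eq_deriv _ (hg x).hasDerivAt.hasDerivWithinAt h1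

lemma deriv_eq_zero_of_Ici {g : ℝ → ℝ} {b : ℝ} (hg : Differentiable ℝ g)
    (h : ∀ x, b ≤ x → g x = 0) : ∀ x, b ≤ x → deriv g x = 0 := fun x hx => by
  have h1 : HasDerivWithinAt g 0 (Ici x) x :=
    (hasDerivWithinAt_const x (Ici x) (0 : ℝ)).congr (fun y hy => h y (le_trans hx hy)) (h x hx)
  exact (uniqueDiffOn_Ici x x self_mem_Ici).eq_deriv _ (hg x).hasDerivAt.hasDerivWithinAt h1

namespace IsTest

variable {ψ : ℝ → ℝ} {a b : ℝ}

lemma deriv_left (h : IsTest ψ a b) : ∀ x ≤ a, deriv ψ x = 0 :=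
  deriv_eq_zero_of_Iic (h.contDiff.differentiable (by norm_num)) h.left

lemma deriv_right (h : IsTest ψ a b) : ∀ x, b ≤ x → deriv ψ x = 0 :=
  deriv_eq_zero_of_Ici (h.contDiff.differentiable (by norm_num)) h.right

lemma deriv_deriv_left (h : IsTest ψ a b) : ∀ x ≤ a, deriv (deriv ψ) x = 0 :=
  deriv_eq_zero_of_Iic ((contDiff_one_deriv h.contDiff).differentiable (by norm_num)) h.deriv_left

lemma deriv_deriv_right (h : IsTest ψ a b) : ∀ x, b ≤ x → deriv (deriv ψ) x = 0 :=
  deriv_eq_zero_of_Ici ((contDiff_one_deriv h.contDiff).differentiable (by norm_num)) h.deriv_right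

lemma Icc_subset (h : IsTest ψ a b) : Icc a b ⊆ Ioo 0 1 :=
  fun _ hx => ⟨h.pos.trans_le hx.1, hx.2.trans_lt h.lt_one⟩

/-- Integrals of functions that vanish outside `[a,b]` may be taken over `(0,1)`. -/
lemma integral_eq (h : IsTest ψ a b) {g : ℝ → ℝ} (hl : ∀ x ≤ a, g x = 0)
    (hr : ∀ x, b ≤ x → g x = 0) : ∫ x in a..b, g x = ∫ x in (0 : ℝ)..1, g x := by
  rw [intervalIntegral.integral_of_le h.le, intervalIntegral.integral_of_le zero_le_one]
  refine (setIntegral_eq_of_subset_of_forall_sdiff_eq_zero measurableSet_Ioc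
    (Ioc_subset_Ioc h.pos.le h.lt_one.le) fun x hx => ?_).symm
  by_cases hxa : x ≤ a
  · exact hl x hxa
  · refine hr x (le_of_lt ?_)
    by_contra hb
    exact hx.2 ⟨not_le.1 hxa, not_lt.1 hb⟩

/-- Two integrations by parts. -/
lemma integral_mul_deriv_deriv (h : IsTest ψ a b) {g : ℝ → ℝ}
    (hg : ∀ x ∈ Icc a b, DifferentiableAt ℝ g x)
    (hg' : ∀ x ∈ Icc a b, DifferentiableAt ℝ (deriv g) x)
    (hg'' : ContinuousOn (deriv (deriv g)) (Icc a b)) :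
    ∫ x in a..b, ψ x * deriv (deriv g) x = ∫ x in a..b, g x * deriv (deriv ψ) x := by
  have hψ := hasDerivAt_of_contDiff_two h.contDiff
  have hu : uIcc a b = Icc a b := uIcc_of_le h.le
  have ig'' : IntervalIntegrable (deriv (deriv g)) volume a b :=
    ContinuousOn.intervalIntegrable (by rwa [hu])
  have ig' : IntervalIntegrable (deriv g) volume a b := ContinuousOn.intervalIntegrable (by
    rw [hu]; exact fun x hx => (hg' x hx).continuousAt.continuousWithinAt)
  have iψ' : IntervalIntegrable (deriv ψ) volume a b :=
    (contDiff_one_deriv h.contDiff).continuous.intervalIntegrable _ _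
  have iψ'' : IntervalIntegrable (deriv (deriv ψ)) volume a b :=
    (continuous_deriv_deriv h.contDiff).intervalIntegrable _ _
  rw [intervalIntegral.integral_mul_deriv_eq_deriv_mul (fun x _ => (hψ x).1)
    (fun x hx => (hg' x (hu ▸ hx)).hasDerivAt) iψ' ig'',
    intervalIntegral.integral_mul_deriv_eq_deriv_mul (fun x _ => (hψ x).2)
    (fun x hx => (hg x (hu ▸ hx)).hasDerivAt) iψ'' ig', h.left a le_rfl, h.right b le_rfl,
    h.deriv_left a le_rfl, h.deriv_right b le_rfl]
  simp only [sub_zero, zero_sub, neg_neg, mul_comm, mul_zero]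

lemma integral_mul_eq (h : IsTest ψ a b) (g : ℝ → ℝ) :
    ∫ x in a..b, g x * ψ x = ∫ x in (0 : ℝ)..1, g x * ψ x :=
  h.integral_eq (fun x hx => by rw [h.left x hx, mul_zero])
    fun x hx => by rw [h.right x hx, mul_zero]

lemma integral_mul_deriv_deriv_eq (h : IsTest ψ a b) (g : ℝ → ℝ) :
    ∫ x in a..b, g x * deriv (deriv ψ) x = ∫ x in (0 : ℝ)..1, g x * deriv (deriv ψ) x :=
  h.integral_eq (fun x hx => by rw [h.deriv_deriv_left x hx, mul_zero])
    fun x hx => by rw [h.deriv_deriv_right x hx, mul_zero]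

end IsTest

lemma isTest_truncation {Y : ℝ → ℝ} (hY : ContDiff ℝ 2 Y) (n : ℕ) :
    IsTest (truncation Y n) (1 / ((n : ℝ) + 3)) (1 - 1 / ((n : ℝ) + 3)) where
  contDiff := contDiff_truncation hY n
  pos := by positivity
  le := by
    have : 1 / ((n : ℝ) + 3) ≤ 1 / 2 := by
      apply one_div_le_one_div_of_le two_pos
      have : (0 : ℝ) ≤ n := n.cast_nonneg
      linarith
    linarith
  lt_one := by
    have : 0 < 1 / ((n : ℝ) + 3) := by positivity
    linarith
  left := fun _ hx => truncation_of_le Y n hx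
  right := fun _ hx => truncation_of_ge Y n hx

/-- Fubini's theorem for a product of a continuous function of `x`, an integrable kernel in `r`,
and a bounded continuous function of both variables. -/
lemma integral_mul_integral_mul_swap {w : ℝ → ℝ → ℝ} {κ ψ : ℝ → ℝ} {a b c d M : ℝ} (hab : a ≤ b)
    (hcd : c ≤ d) (hw : ContinuousOn (fun z : ℝ × ℝ => w z.1 z.2) (Icc a b ×ˢ Ioo c d))
    (hM : ∀ x ∈ Icc a b, ∀ r ∈ Ioo c d, |w x r| ≤ M) (hκ : IntervalIntegrable κ volume c d)
    (hψ : ContinuousOn ψ (Icc a b)) :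
    IntervalIntegrable (fun x => ψ x * ∫ r in c..d, κ r * w x r) volume a b ∧
      ∫ x in a..b, ψ x * ∫ r in c..d, κ r * w x r
        = ∫ r in c..d, κ r * ∫ x in a..b, ψ x * w x r := by
  rw [intervalIntegrable_iff_integrableOn_Ioc_of_le hab]
  simp only [intervalIntegral.integral_of_le hab, intervalIntegral.integral_of_le hcd,
    integral_Ioc_eq_integral_Ioo (x := c), ← integral_const_mul]
  have hκ' : Integrable κ (volume.restrict (Ioo c d)) :=
    ((intervalIntegrable_iff_integrableOn_Ioo_of_le hcd).1 hκ)
  have hψ' : Integrable ψ (volume.restrict (Ioc a b)) :=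
    (hψ.integrableOn_Icc.mono_set Ioc_subset_Icc_self)
  have hint : Integrable (Function.uncurry fun x r => ψ x * (κ r * w x r))
      ((volume.restrict (Ioc a b)).prod (volume.restrict (Ioo c d))) := by
    have hprod := (hψ'.mul_prod hκ').norm.mul_const M
    have hmw : AEStronglyMeasurable (fun z : ℝ × ℝ => w z.1 z.2)
        ((volume.restrict (Ioc a b)).prod (volume.restrict (Ioo c d))) := by
      rw [Measure.prod_restrict]
      exact (hw.mono (prod_mono_left Ioc_subset_Icc_self)).aestronglyMeasurable
        (measurableSet_Ioc.prod measurableSet_Ioo)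
    refine hprod.mono' (hψ'.1.comp_fst.mul (hκ'.1.comp_snd.mul hmw)) ?_
    rw [Measure.prod_restrict]
    filter_upwards [ae_restrict_mem (measurableSet_Ioc.prod measurableSet_Ioo)] with z hz
    have := hM z.1 ⟨hz.1.1.le, hz.1.2⟩ z.2 hz.2
    simp only [Function.uncurry, Real.norm_eq_abs, abs_mul]
    rw [mul_assoc]
    gcongr
  refine ⟨hint.integral_prod_left, ?_⟩
  rw [integral_integral_swap hint]
  simp only [mul_left_comm]

/-- Continuity in `t` of the integral of a function continuous on a rectangle. -/
lemma continuousOn_integral_mul {u : ℝ → ℝ → ℝ} {c d a b : ℝ} (hcd : c ≤ d)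
    (hu : ContinuousOn (fun z : ℝ × ℝ => u z.1 z.2) (Icc 0 1 ×ˢ Icc c d)) (ha : 0 ≤ a)
    (hab : a ≤ b) (hb : b ≤ 1) {h : ℝ → ℝ} (hh : Continuous h) :
    ContinuousOn (fun t => ∫ x in a..b, u x t * h x) (Icc c d) := by
  let P : ℝ × ℝ → ℝ × ℝ := fun z =>
    ((projIcc (0 : ℝ) 1 zero_le_one z.1 : ℝ), (projIcc c d hcd z.2 : ℝ))
  have hP : Continuous P := by
    refine Continuous.prodMk ?_ ?_
    · exact continuous_subtype_val.comp (continuous_projIcc.comp continuous_fst)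
    · exact continuous_subtype_val.comp (continuous_projIcc.comp continuous_snd)
  have hc : Continuous fun z : ℝ × ℝ => u (P z).1 (P z).2 :=
    hu.comp_continuous hP fun z => ⟨Subtype.prop _, Subtype.prop _⟩
  have h1 : Continuous fun t => ∫ x in a..b, u (P (x, t)).1 (P (x, t)).2 * h x := by
    apply intervalIntegral.continuous_parametric_intervalIntegral_of_continuous'
    have : Continuous fun z : ℝ × ℝ => (z.2, z.1) := by fun_prop
    exact (hc.comp this).mul (hh.comp continuous_snd)
  refine h1.continuousOn.congr fun t ht => intervalIntegral.integral_congr fun x hx => ?_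
  rw [uIcc_of_le hab] at hx
  have hx' : x ∈ Icc (0 : ℝ) 1 := ⟨ha.trans hx.1, hx.2.trans hb⟩
  simp only [P, projIcc_of_mem zero_le_one hx', projIcc_of_mem hcd ht]

/-- Local boundedness near each point of a compact set gives a bound near the whole set. -/
lemma exists_bound_near_compact {S K : Set (ℝ × ℝ)} {F : ℝ × ℝ → ℝ} (hK : IsCompact K)
    (h : ∀ z ∈ K, ∃ M, ∀ᶠ y in 𝓝[S] z, |F y| ≤ M) :
    ∃ M, ∃ U, IsOpen U ∧ K ⊆ U ∧ ∀ y ∈ U, y ∈ S → |F y| ≤ M := by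
  refine hK.induction_on (p := fun K => ∃ M, ∃ U, IsOpen U ∧ K ⊆ U ∧ ∀ y ∈ U, y ∈ S → |F y| ≤ M)
    ⟨0, ∅, isOpen_empty, Subset.rfl, fun _ h => h.elim⟩ ?_ ?_ ?_
  · rintro s t hst ⟨M, U, hU, hsU, H⟩
    exact ⟨M, U, hU, hst.trans hsU, H⟩
  · rintro s t ⟨M, U, hU, hsU, H⟩ ⟨M', U', hU', hsU', H'⟩
    refine ⟨max M M', U ∪ U', hU.union hU', union_subset_union hsU hsU', ?_⟩
    rintro y (hy | hy) hS
    · exact (H y hy hS).trans (le_max_left _ _)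
    · exact (H' y hy hS).trans (le_max_right _ _)
  · intro z hz
    obtain ⟨M, hM⟩ := h z hz
    rw [eventually_nhdsWithin_iff] at hM
    obtain ⟨U, hU, hUo, hzU⟩ := eventually_nhds_iff.1 hM
    exact ⟨U, mem_nhdsWithin_of_mem_nhds (hUo.mem_nhds hzU), M, U, hUo, Subset.rfl, hU⟩

lemma eventually_bound_of_continuousOn {S : Set (ℝ × ℝ)} {F : ℝ × ℝ → ℝ} (hF : ContinuousOn F S)
    {z : ℝ × ℝ} (hz : z ∈ S) : ∃ M, ∀ᶠ y in 𝓝[S] z, |F y| ≤ M := by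
  refine ⟨|F z| + 1, ?_⟩
  have := (hF z hz).abs.tendsto.eventually (gt_mem_nhds (lt_add_one |F z|))
  filter_upwards [this] with y hy using le_of_lt hy

/-! ### The equation for positive times -/

lemma caputoRight_one (g : ℝ → ℝ) (t : ℝ) : caputoRight 1 g t = deriv g t := by
  simp [caputoRight]

lemma caputoRight_eq_fracInt {α : ℝ} (hα : α ≠ 1) (g : ℝ → ℝ) {t : ℝ} (ht : 0 ≤ t) :
    caputoRight α g t = fracInt (1 - α) (deriv g) t := by
  rw [caputoRight, if_neg hα, fracInt]
  congr 1
  refine intervalIntegral.integral_congr fun z hz => ?_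
  rw [uIcc_of_le ht] at hz
  have : (1 : ℝ) - α - 1 = -α := by ring
  simp only [this, Real.rpow_neg (sub_nonneg.2 hz.2)]
  rw [div_eq_mul_inv, mul_comm]

namespace IsSolution

variable {α β p q : ℝ} {u : ℝ → ℝ → ℝ} {f : ℝ → ℝ}

lemma continuousOn_section (S : IsSolution α β p q u f) {x : ℝ} (hx : x ∈ Icc (0 : ℝ) 1) :
    ContinuousOn (u x) (Icc (-p) q) :=
  S.cont.comp (f := fun t : ℝ => (x, t)) (by fun_prop) fun _ ht => ⟨hx, ht⟩

lemma continuousOn_slice (S : IsSolution α β p q u f) {t : ℝ} (ht : t ∈ Icc (-p) q) :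
    ContinuousOn (fun x => u x t) (Icc 0 1) :=
  S.cont.comp (f := fun x : ℝ => (x, t)) (by fun_prop) fun _ hx => ⟨hx, ht⟩

/-- The weak form in `x` of the term `u_xx`. -/
lemma integral_mul_dxx (S : IsSolution α β p q u f) {ψ : ℝ → ℝ} {a b : ℝ} (hψ : IsTest ψ a b)
    {t : ℝ} (ht : t ∈ Ioo 0 q ∪ Ioo (-p) 0) :
    ∫ x in a..b, ψ x * dxx u x t = ∫ x in a..b, u x t * deriv (deriv ψ) x := by
  have hmem : ∀ x ∈ Icc a b, (x, t) ∈ domPlus q ∪ domMinus p := fun x hx =>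
    ht.elim (fun h => Or.inl ⟨hψ.Icc_subset hx, h⟩) fun h => Or.inr ⟨hψ.Icc_subset hx, h⟩
  refine hψ.integral_mul_deriv_deriv (g := fun x => u x t) (fun x hx => (S.diff_x _ (hmem x hx)).1)
    (fun x hx => (S.diff_x _ (hmem x hx)).2) ?_
  exact S.cont_dxx.comp (f := fun x : ℝ => (x, t)) (by fun_prop) fun x hx => hmem x hx

lemma continuousOn_dxx_slice (S : IsSolution α β p q u f) {t : ℝ}
    (ht : t ∈ Ioo 0 q ∪ Ioo (-p) 0) : ContinuousOn (fun x => dxx u x t) (Ioo 0 1) :=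
  S.cont_dxx.comp (f := fun x : ℝ => (x, t)) (by fun_prop) fun _ hx =>
    ht.elim (fun h => Or.inl ⟨hx, h⟩) fun h => Or.inr ⟨hx, h⟩

/-- If `w = f + u_xx` at time `t`, then `∫ ψ w = ∫ ψ f + ∫ u ψ''`. -/
lemma integral_mul_eq_add (S : IsSolution α β p q u f) {ψ : ℝ → ℝ} {a b : ℝ} (hψ : IsTest ψ a b)
    {t : ℝ} (ht : t ∈ Ioo 0 q ∪ Ioo (-p) 0) {w : ℝ → ℝ}
    (hw : ∀ x ∈ Ioo (0 : ℝ) 1, f x = w x - dxx u x t) :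
    ∫ x in a..b, ψ x * w x
      = (∫ x in a..b, ψ x * f x) + ∫ x in a..b, u x t * deriv (deriv ψ) x := by
  have hi : ∀ {g : ℝ → ℝ}, ContinuousOn g (Ioo 0 1) →
      IntervalIntegrable (fun x => ψ x * g x) volume a b := fun hg =>
    ContinuousOn.intervalIntegrable (by
      rw [uIcc_of_le hψ.le]
      exact hψ.contDiff.continuous.continuousOn.mul (hg.mono hψ.Icc_subset))
  rw [← S.integral_mul_dxx hψ ht, ← intervalIntegral.integral_add (hi S.cont_f)
    (hi (S.continuousOn_dxx_slice ht))]
  refine intervalIntegral.integral_congr fun x hx => ?_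
  rw [uIcc_of_le hψ.le] at hx
  simp only [hw x (hψ.Icc_subset hx)]
  ring

/-- The Caputo derivative is bounded on `[a,b] × (0,T]`, including near `t = 0`. -/
lemma exists_bound_caputoRight (S : IsSolution α β p q u f) {a b T : ℝ} (ha : 0 < a) (hb : b < 1)
    (hT : T < q) : ∃ M, ∀ x ∈ Icc a b, ∀ t ∈ Ioc 0 T, |caputoRight α (u x) t| ≤ M := by
  obtain ⟨M, U, -, hKU, H⟩ := exists_bound_near_compact (S := domPlus q)
    (F := fun z => caputoRight α (u z.1) z.2)
    ((isCompact_Icc (a := a) (b := b)).prod (isCompact_Icc (a := (0 : ℝ)) (b := T))) fun z hz => by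
      have hz1 : z.1 ∈ Ioo (0 : ℝ) 1 := ⟨ha.trans_le hz.1.1, hz.1.2.trans_lt hb⟩
      rcases hz.2.1.eq_or_lt with h0 | h0
      · have e : z = (z.1, 0) := Prod.ext rfl h0.symm
        rw [e]; exact S.bdd_plus z.1 hz1
      · exact eventually_bound_of_continuousOn S.cont_plus ⟨hz1, h0, hz.2.2.trans_lt hT⟩
  exact ⟨M, fun x hx t ht => H (x, t) (hKU ⟨hx, ht.1.le, ht.2⟩)
    ⟨⟨ha.trans_le hx.1, hx.2.trans_lt hb⟩, ht.1, ht.2.trans_lt hT⟩⟩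

/-- `I^α D^α u = u - u(·,0)`, at each `x` separately. -/
lemma fracInt_caputoRight (S : IsSolution α β p q u f) (hα0 : 0 < α) (hα1 : α ≤ 1) (hp : 0 < p)
    {x t : ℝ} (hx : x ∈ Ioo (0 : ℝ) 1) (ht : t ∈ Ioo 0 q) :
    fracInt α (caputoRight α (u x)) t = u x t - u x 0 := by
  have hxI := Ioo_subset_Icc_self hx
  rcases hα1.eq_or_lt with rfl | hα
  · rw [fracInt_one]
    simp only [caputoRight_one]
    obtain ⟨M, hM⟩ := S.exists_bound_caputoRight hx.1 hx.2 ht.2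
    refine intervalIntegral.integral_eq_sub_of_hasDerivAt_of_le ht.1.le
      ((S.continuousOn_section hxI).mono (Icc_subset_Icc (by linarith) ht.2.le)) (fun r hr => ?_) ?_
    · have h := S.exists_plus (x, r) ⟨hx, hr.1, hr.2.trans ht.2⟩
      rw [CaputoRightExists, if_pos rfl] at h
      exact h.hasDerivAt
    · rw [intervalIntegrable_iff_integrableOn_Ioc_of_le ht.1.le]
      refine Measure.integrableOn_of_bounded (M := M) (by simp)
        (measurable_deriv _).aestronglyMeasurable ?_
      filter_upwards [ae_restrict_mem measurableSet_Ioc] with r hr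
      have := hM x ⟨le_rfl, le_rfl⟩ r hr
      rwa [caputoRight_one] at this
  · have h := S.exists_plus (x, t) ⟨hx, ht⟩
    rw [CaputoRightExists, if_neg hα.ne] at h
    rw [fracInt_congr (h := fracInt (1 - α) (deriv (u x))) ht.1.le fun r hr =>
        caputoRight_eq_fracInt hα.ne (u x) hr.1.le,
      (fracInt_fracInt hα0 (sub_pos.2 hα) (by linarith) ht.1 h.1.intervalIntegrable_deriv).2,
      add_sub_cancel, fracInt_one, h.1.integral_deriv_eq_sub]

/-- The equation for `t > 0`, tested against `ψ` in `x` and integrated `α` times in `t`. -/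
lemma integral_mul_sub_plus (S : IsSolution α β p q u f) (hα0 : 0 < α) (hα1 : α ≤ 1) (hp : 0 < p)
    {ψ : ℝ → ℝ} {a b : ℝ} (hψ : IsTest ψ a b) {t : ℝ} (ht : t ∈ Ioo 0 q) :
    ∫ x in a..b, ψ x * (u x t - u x 0)
      = (∫ x in a..b, ψ x * f x) * t ^ α / Real.Gamma (α + 1)
        + fracInt α (fun r => ∫ x in a..b, u x r * deriv (deriv ψ) x) t := by
  obtain ⟨M, hM⟩ := S.exists_bound_caputoRight hψ.pos hψ.lt_one ht.2
  have hG := Real.Gamma_pos_of_pos hα0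
  have h1 : ∫ x in a..b, ψ x * (u x t - u x 0)
      = fracInt α (fun r => ∫ x in a..b, ψ x * caputoRight α (u x) r) t := by
    rw [fracInt, ← (integral_mul_integral_mul_swap (w := fun x r => caputoRight α (u x) r) hψ.le
      ht.1.le (S.cont_plus.mono (prod_mono hψ.Icc_subset (Ioo_subset_Ioo_right ht.2.le)))
      (fun x hx r hr => hM x hx r ⟨hr.1, hr.2.le⟩) (intervalIntegrable_kernel hα0 0 t t)
      hψ.contDiff.continuous.continuousOn).2, ← intervalIntegral.integral_const_mul]
    refine intervalIntegral.integral_congr fun x hx => ?_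
    rw [uIcc_of_le hψ.le] at hx
    simp only [← S.fracInt_caputoRight hα0 hα1 hp (hψ.Icc_subset hx) ht, fracInt]
    ring
  rw [h1, ← fracInt_const hα0, ← fracInt_add
    ((intervalIntegrable_kernel hα0 0 t t).mul_const _)
    (intervalIntegrable_kernel_mul hα0 ht.1.le ((continuousOn_integral_mul
      (by linarith [ht.1, ht.2]) S.cont hψ.pos.le hψ.le hψ.lt_one.le (continuous_deriv_deriv hψ.contDiff)).mono
        (Icc_subset_Icc (by linarith) ht.2.le)))]
  refine fracInt_congr ht.1.le fun r hr => ?_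
  have hr' : r ∈ Ioo 0 q := ⟨hr.1, hr.2.trans ht.2⟩
  exact S.integral_mul_eq_add hψ (Or.inl hr') fun x hx => S.eq_plus (x, r) ⟨hx, hr'⟩

/-- The limit `L` of the Caputo derivative as `t → 0+`, tested against `ψ`. -/
lemma integral_mul_limit (S : IsSolution α β p q u f) (hp : 0 < p) (hq : 0 < q)
    {ψ : ℝ → ℝ} {a b : ℝ} (hψ : IsTest ψ a b) {L : ℝ → ℝ}
    (hL : ∀ x ∈ Ioo (0 : ℝ) 1, Tendsto (fun t => caputoRight α (u x) t) (𝓝[>] 0) (𝓝 (L x))) :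
    IntervalIntegrable (fun x => ψ x * L x) volume a b ∧
      ∫ x in a..b, ψ x * L x
        = (∫ x in a..b, ψ x * f x) + ∫ x in a..b, u x 0 * deriv (deriv ψ) x := by
  obtain ⟨M, hM⟩ := S.exists_bound_caputoRight (T := q / 2) hψ.pos hψ.lt_one (by linarith)
  set τ : ℕ → ℝ := fun n => q / 2 / ((n : ℝ) + 1) with hτ
  have hτ0 : ∀ n, 0 < τ n := fun n => by positivity
  have hτT : ∀ n, τ n ≤ q / 2 := fun n => div_le_self (by positivity) (by
    have : (0 : ℝ) ≤ n := n.cast_nonneg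
    linarith)
  have hτlim : Tendsto τ atTop (𝓝[>] 0) := by
    refine tendsto_nhdsWithin_iff.2 ⟨?_, Eventually.of_forall hτ0⟩
    exact tendsto_const_nhds.div_atTop (tendsto_natCast_atTop_atTop.atTop_add tendsto_const_nhds)
  have hlim : ∀ x ∈ Ioc a b, Tendsto (fun n => ψ x * caputoRight α (u x) (τ n)) atTop
      (𝓝 (ψ x * L x)) := fun x hx =>
    ((hL x (hψ.Icc_subset (Ioc_subset_Icc_self hx))).comp hτlim).const_mul _
  have hcont : ∀ n, ContinuousOn (fun x => ψ x * caputoRight α (u x) (τ n)) (Icc a b) := fun n =>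
    hψ.contDiff.continuous.continuousOn.mul (S.cont_plus.comp (f := fun x : ℝ => (x, τ n))
      (by fun_prop) fun x hx => ⟨hψ.Icc_subset hx, hτ0 n, by linarith [hτT n]⟩)
  have hmeas : ∀ n, AEStronglyMeasurable (fun x => ψ x * caputoRight α (u x) (τ n))
      (volume.restrict (Ioc a b)) := fun n =>
    ((hcont n).mono Ioc_subset_Icc_self).aestronglyMeasurable measurableSet_Ioc
  have hbound : ∀ n, ∀ x ∈ Ioc a b, ‖ψ x * caputoRight α (u x) (τ n)‖ ≤ |ψ x| * M :=
    fun n x hx => by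
      rw [norm_mul, Real.norm_eq_abs, Real.norm_eq_abs]
      exact mul_le_mul_of_nonneg_left
        (hM x (Ioc_subset_Icc_self hx) _ ⟨hτ0 n, hτT n⟩) (abs_nonneg _)
  have hbi : IntervalIntegrable (fun x => |ψ x| * M) volume a b :=
    (hψ.contDiff.continuous.abs.mul continuous_const).intervalIntegrable _ _
  refine ⟨?_, ?_⟩
  · rw [intervalIntegrable_iff_integrableOn_Ioc_of_le hψ.le] at hbi ⊢
    refine hbi.mono' (aestronglyMeasurable_of_tendsto_ae atTop hmeas ?_) ?_
    · filter_upwards [ae_restrict_mem measurableSet_Ioc] with x hx using hlim x hx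
    · filter_upwards [ae_restrict_mem measurableSet_Ioc] with x hx
      exact le_of_tendsto (hlim x hx).norm (Eventually.of_forall fun n => hbound n x hx)
  · have h1 : Tendsto (fun n => ∫ x in a..b, ψ x * caputoRight α (u x) (τ n)) atTop
        (𝓝 (∫ x in a..b, ψ x * L x)) := by
      refine intervalIntegral.tendsto_integral_filter_of_dominated_convergence
        (fun x => |ψ x| * M) ?_ ?_ hbi ?_
      · rw [uIoc_of_le hψ.le]; exact Eventually.of_forall hmeas
      · rw [uIoc_of_le hψ.le]
        exact Eventually.of_forall fun n => Eventually.of_forall fun x hx => hbound n x hx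
      · rw [uIoc_of_le hψ.le]; exact Eventually.of_forall fun x hx => hlim x hx
    have h2 : Tendsto (fun n => ∫ x in a..b, ψ x * caputoRight α (u x) (τ n)) atTop
        (𝓝 ((∫ x in a..b, ψ x * f x) + ∫ x in a..b, u x 0 * deriv (deriv ψ) x)) := by
      have hc := (continuousOn_integral_mul (by linarith : -p ≤ q) S.cont hψ.pos.le hψ.le
        hψ.lt_one.le (continuous_deriv_deriv hψ.contDiff)).continuousAt
        (Icc_mem_nhds (by linarith : -p < 0) hq)
      have h3 := (hc.tendsto.comp (tendsto_nhdsWithin_iff.1 hτlim).1).const_add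
        (∫ x in a..b, ψ x * f x)
      refine h3.congr fun n => ?_
      have hmem : τ n ∈ Ioo 0 q := ⟨hτ0 n, by linarith [hτT n]⟩
      exact (S.integral_mul_eq_add hψ (Or.inl hmem) fun x hx =>
        S.eq_plus (x, τ n) ⟨hx, hmem⟩).symm
    exact tendsto_nhds_unique h1 h2

end IsSolution

/-! ### The equation for negative times -/

lemma caputoLeft_two (g : ℝ → ℝ) (t : ℝ) : caputoLeft 2 g t = deriv (deriv g) t := by
  simp [caputoLeft]

lemma caputoLeft_neg_eq_fracInt {β : ℝ} (hβ : β ≠ 2) (g : ℝ → ℝ) {s : ℝ} (hs : 0 ≤ s) :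
    caputoLeft β g (-s) = fracInt (2 - β) (fun r => deriv (deriv g) (-r)) s := by
  rw [caputoLeft, if_neg hβ, fracInt]
  congr 1
  have h := intervalIntegral.integral_comp_neg
    (fun z => deriv (deriv g) z / (z - -s) ^ (β - 1)) (a := 0) (b := s)
  rw [neg_zero] at h
  rw [← h]
  refine intervalIntegral.integral_congr fun z hz => ?_
  rw [uIcc_of_le hs] at hz
  have e1 : -z - -s = s - z := by ring
  have e2 : (2 : ℝ) - β - 1 = -(β - 1) := by ring
  simp only [e1, e2, Real.rpow_neg (sub_nonneg.2 hz.2)]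
  rw [div_eq_mul_inv, mul_comm]

/-- If the primitive of `w` is bounded by `C`, then `∫ (s - r) ^ c w` is bounded by `s ^ c C`:
the kernel is decreasing, so that its total variation is at most `s ^ c`. -/
lemma abs_integral_kernel_mul_le {c s δ C : ℝ} (hc : 0 < c) (hδ : 0 ≤ δ) (hδs : δ < s)
    {w : ℝ → ℝ} (hw : ContinuousOn w (Ioo 0 s)) (hi : IntervalIntegrable w volume 0 s)
    (hC : ∀ r ∈ Icc 0 δ, |∫ y in (0 : ℝ)..r, w y| ≤ C) :
    |∫ r in (0 : ℝ)..δ, (s - r) ^ c * w r| ≤ s ^ c * C := by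
  have hu : uIcc 0 δ = Icc 0 δ := uIcc_of_le hδ
  have hiδ : IntervalIntegrable w volume 0 δ := hi.mono_set (by
    rw [hu, uIcc_of_le (hδ.trans hδs.le)]; exact Icc_subset_Icc_right hδs.le)
  have hκ : ContinuousOn (fun r => (s - r) ^ c) (uIcc 0 δ) :=
    ((Real.continuous_rpow_const hc.le).comp (continuous_const.sub continuous_id)).continuousOn
  have hG : ContinuousOn (fun r => ∫ y in (0 : ℝ)..r, w y) (uIcc 0 δ) :=
    intervalIntegral.continuousOn_primitive_interval' hiδ left_mem_uIcc
  have hκ' : ∀ r < s, HasDerivAt (fun r => (s - r) ^ c) (-(c * (s - r) ^ (c - 1))) r :=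
    fun r hr => by
      have := ((hasDerivAt_id r).const_sub s).rpow_const (p := c) (Or.inl (by
        simpa [sub_eq_zero] using hr.ne'))
      simpa only [id, neg_mul, one_mul] using this
  have hG' : ∀ r ∈ Ioo (min 0 δ) (max 0 δ), HasDerivAt (fun r => ∫ y in (0 : ℝ)..r, w y) (w r) r :=
    fun r hr => by
      rw [min_eq_left hδ, max_eq_right hδ] at hr
      have hr' : r ∈ Ioo 0 s := ⟨hr.1, hr.2.trans hδs⟩
      refine intervalIntegral.integral_hasDerivAt_right (hi.mono_set ?_) ?_
        (hw.continuousAt (isOpen_Ioo.mem_nhds hr'))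
      · rw [uIcc_of_le hr'.1.le, uIcc_of_le (hδ.trans hδs.le)]
        exact Icc_subset_Icc_right hr'.2.le
      · exact hw.stronglyMeasurableAtFilter isOpen_Ioo r hr'
  have hκ'c : ContinuousOn (fun r => -(c * (s - r) ^ (c - 1))) (Icc 0 δ) := by
    refine (continuousOn_const.mul (ContinuousOn.rpow_const (by fun_prop) fun r hr => ?_)).neg
    exact Or.inl (by have := hr.2; intro h; linarith)
  have hκ'i : IntervalIntegrable (fun r => -(c * (s - r) ^ (c - 1))) volume 0 δ :=
    ContinuousOn.intervalIntegrable (by rwa [hu])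
  rw [intervalIntegral.integral_mul_deriv_eq_deriv_mul_of_hasDerivAt hκ hG
    (fun r hr => hκ' r (by
      rw [max_eq_right hδ] at hr; exact hr.2.trans hδs)) hG' hκ'i hiδ]
  have hvar : ∫ r in (0 : ℝ)..δ, c * (s - r) ^ (c - 1) = s ^ c - (s - δ) ^ c := by
    have := intervalIntegral.integral_eq_sub_of_hasDerivAt (a := 0) (b := δ)
      (fun r hr => hκ' r (by rw [hu] at hr; exact hr.2.trans_lt hδs)) hκ'i
    rw [intervalIntegral.integral_neg, sub_zero] at this
    linarith
  have hrest : |∫ r in (0 : ℝ)..δ, -(c * (s - r) ^ (c - 1)) * ∫ y in (0 : ℝ)..r, w y|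
      ≤ (s ^ c - (s - δ) ^ c) * C := by
    rw [← hvar, ← intervalIntegral.integral_mul_const, ← Real.norm_eq_abs]
    refine intervalIntegral.norm_integral_le_of_norm_le hδ (Eventually.of_forall fun r hr => ?_)
      ((hκ'i.neg.congr fun r _ => neg_neg (c * (s - r) ^ (c - 1))).mul_const C)
    have h0 : 0 ≤ c * (s - r) ^ (c - 1) :=
      mul_nonneg hc.le (Real.rpow_nonneg (by linarith [hr.2]) _)
    rw [norm_mul, norm_neg, Real.norm_eq_abs, Real.norm_eq_abs, abs_of_nonneg h0]
    exact mul_le_mul_of_nonneg_left (hC r ⟨hr.1.le, hr.2⟩) h0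
  have hend : |(s - δ) ^ c * ∫ y in (0 : ℝ)..δ, w y| ≤ (s - δ) ^ c * C := by
    have h0 : 0 ≤ (s - δ) ^ c := Real.rpow_nonneg (by linarith) _
    rw [abs_mul, abs_of_nonneg h0]
    exact mul_le_mul_of_nonneg_left (hC δ ⟨hδ, le_rfl⟩) h0
  rw [intervalIntegral.integral_same, mul_zero, sub_zero]
  refine (abs_sub _ _).trans ((add_le_add hend hrest).trans (le_of_eq (by ring)))

lemma tendsto_neg_nhdsGT_zero : Tendsto (fun r : ℝ => -r) (𝓝[>] 0) (𝓝[<] 0) := by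
  simpa using tendsto_neg_nhdsGT (a := (0 : ℝ))

namespace IsSolution

variable {α β p q : ℝ} {u : ℝ → ℝ → ℝ} {f : ℝ → ℝ}

/-- The time derivative is bounded on `[a,b] × (-ε,0)` for some `ε > 0`. -/
lemma exists_bound_deriv (S : IsSolution α β p q u f) (hp : 0 < p) {a b : ℝ} (ha : 0 < a)
    (hb : b < 1) :
    ∃ M, ∃ ε > 0, ε ≤ p ∧ ∀ x ∈ Icc a b, ∀ r ∈ Ioo 0 ε, |deriv (u x) (-r)| ≤ M := by
  obtain ⟨M, U, hU, hKU, H⟩ := exists_bound_near_compact (S := domMinus p)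
    (F := fun z => deriv (u z.1) z.2)
    ((isCompact_Icc (a := a) (b := b)).prod (isCompact_singleton (x := (0 : ℝ)))) fun z hz => by
      have e : z = (z.1, 0) := Prod.ext rfl hz.2
      rw [e]; exact S.bdd_minus z.1 ⟨ha.trans_le hz.1.1, hz.1.2.trans_lt hb⟩
  obtain ⟨V, W, -, hW, hV, hW0, hVW⟩ := generalized_tube_lemma (isCompact_Icc (a := a) (b := b))
    (isCompact_singleton (x := (0 : ℝ))) hU hKU
  obtain ⟨ε, hε, hball⟩ := Metric.isOpen_iff.1 hW 0 (hW0 rfl)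
  refine ⟨M, min ε p, lt_min hε hp, min_le_right _ _, fun x hx r hr => ?_⟩
  have hr1 : r < ε := hr.2.trans_le (min_le_left _ _)
  have hr2 : r < p := hr.2.trans_le (min_le_right _ _)
  refine H (x, -r) (hVW ⟨hV hx, hball ?_⟩)
    ⟨⟨ha.trans_le hx.1, hx.2.trans_lt hb⟩, by simpa using hr2, by simpa using hr.1⟩
  simpa [abs_of_pos hr.1] using hr1

lemma continuousOn_caputoLeft_neg (S : IsSolution α β p q u f) :
    ContinuousOn (fun z : ℝ × ℝ => caputoLeft β (u z.1) (-z.2)) (Ioo 0 1 ×ˢ Ioo 0 p) :=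
  S.cont_minus.comp (f := fun z : ℝ × ℝ => (z.1, -z.2)) (by fun_prop) fun z hz =>
    ⟨hz.1, by simpa using hz.2.2, by simpa using hz.2.1⟩

/-- For `β < 2`, at each `x` separately: `u_tt` is integrable up to `t = 0`, and its first two
primitives are given by `u_t` and `u`. -/
lemma fracInt_deriv_deriv (S : IsSolution α β p q u f) (hβ1 : 1 < β) (hβ2 : β < 2)
    {x s l : ℝ} (hx : x ∈ Ioo (0 : ℝ) 1) (hs : s ∈ Ioo 0 p)
    (hl : Tendsto (fun t => -deriv (u x) t) (𝓝[<] 0) (𝓝 l)) :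
    IntervalIntegrable (fun r => deriv (deriv (u x)) (-r)) volume 0 s ∧
      fracInt 1 (fun r => deriv (deriv (u x)) (-r)) s = -deriv (u x) (-s) - l := by
  have h := S.exists_minus (x, -s) ⟨hx, by simpa using hs.2, by simpa using hs.1⟩
  rw [CaputoLeftExists, if_neg hβ2.ne] at h
  obtain ⟨-, hAC, hint⟩ := h
  have hns : -s < 0 := by linarith [hs.1]
  have hi : IntervalIntegrable (deriv (deriv (u x))) volume (-s) 0 := by
    have h1 : IntervalIntegrable (fun z => deriv (deriv (u x)) z / (z - -s) ^ (β - 1)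
        * (z - -s) ^ (β - 1)) volume (-s) 0 :=
      hint.mul_continuousOn (((Real.continuous_rpow_const (by linarith)).comp
        (continuous_id.sub continuous_const)).continuousOn)
    rw [intervalIntegrable_iff_integrableOn_Ioc_of_le hns.le] at h1 ⊢
    refine h1.congr_fun (fun z hz => ?_) measurableSet_Ioc
    have : 0 < (z - -s) ^ (β - 1) := Real.rpow_pos_of_pos (by linarith [hz.1]) _
    simp only []
    field_simp
  have hi' : IntervalIntegrable (fun r => deriv (deriv (u x)) (-r)) volume 0 s := by
    have := (IntervalIntegrable.iff_comp_neg (by simp)).1 hi.symm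
    rwa [neg_zero, neg_neg] at this
  refine ⟨hi', ?_⟩
  rw [fracInt_one]
  have e := intervalIntegral.integral_comp_neg (deriv (deriv (u x))) (a := 0) (b := s)
  rw [neg_zero] at e
  rw [e]
  have hcont : Tendsto (fun t => ∫ z in (-s)..t, deriv (deriv (u x)) z) (𝓝[<] 0)
      (𝓝 (∫ z in (-s)..0, deriv (deriv (u x)) z)) := by
    have h1 := (intervalIntegral.continuousOn_primitive_interval' hi left_mem_uIcc) 0 right_mem_uIcc
    refine h1.tendsto.mono_left ?_
    rw [uIcc_of_le hns.le, ← nhdsWithin_Ioo_eq_nhdsLT hns]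
    exact nhdsWithin_mono _ Ioo_subset_Icc_self
  have hlim : Tendsto (fun t => ∫ z in (-s)..t, deriv (deriv (u x)) z) (𝓝[<] 0)
      (𝓝 (-l - deriv (u x) (-s))) := by
    refine (hl.neg.sub_const (deriv (u x) (-s))).congr' ?_
    rw [← nhdsWithin_Ioo_eq_nhdsLT hns]
    filter_upwards [self_mem_nhdsWithin] with t ht
    rw [(hAC t ht).integral_deriv_eq_sub, neg_neg]
  rw [tendsto_nhds_unique hcont hlim]
  ring

/-- For `β < 2`, at each `x` separately: `I^β D^β u = u - u(·,0) - s u_s(·,0)`, where `s = -t`;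
and `D^β u` is integrable, with primitive `I^(2-β) (u_s - u_s(·,0))`. -/
lemma fracInt_caputoLeft (S : IsSolution α β p q u f) (hβ1 : 1 < β) (hβ2 : β < 2) (hq : 0 < q)
    {x s l : ℝ} (hx : x ∈ Ioo (0 : ℝ) 1) (hs : s ∈ Ioo 0 p)
    (hl : Tendsto (fun t => -deriv (u x) t) (𝓝[<] 0) (𝓝 l)) :
    IntervalIntegrable (fun r => (s - r) ^ (β - 1) * caputoLeft β (u x) (-r)) volume 0 s ∧
      fracInt β (fun r => caputoLeft β (u x) (-r)) s = u x (-s) - u x 0 - s * l ∧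
      IntervalIntegrable (fun r => caputoLeft β (u x) (-r)) volume 0 s ∧
      ∫ r in (0 : ℝ)..s, caputoLeft β (u x) (-r)
        = fracInt (2 - β) (fun r => -deriv (u x) (-r) - l) s := by
  set k : ℝ → ℝ := fun r => deriv (deriv (u x)) (-r) with hk
  have hki := (S.fracInt_deriv_deriv hβ1 hβ2 hx hs hl).1
  have hk1 : ∀ r ∈ Ioo 0 s, fracInt 1 k r = -deriv (u x) (-r) - l := fun r hr =>
    (S.fracInt_deriv_deriv hβ1 hβ2 hx ⟨hr.1, hr.2.trans hs.2⟩ hl).2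
  have hw : ∀ r, 0 ≤ r → caputoLeft β (u x) (-r) = fracInt (2 - β) k r := fun r hr =>
    caputoLeft_neg_eq_fracInt hβ2.ne (u x) hr
  have hIoo : ∀ r ∈ uIoo 0 s, 0 ≤ r := fun r hr => by
    rw [uIoo_of_le hs.1.le] at hr; exact hr.1.le
  have h2β : 0 < 2 - β := by linarith
  have hA := fracInt_fracInt (a := β) (b := 2 - β) (by linarith) h2β (by linarith) hs.1 hki
  have hB := fracInt_fracInt one_pos h2β (by linarith) hs.1 hki
  have hC := fracInt_fracInt h2β one_pos (by linarith) hs.1 hki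
  have hD := fracInt_fracInt one_pos one_pos (by norm_num) hs.1 hki
  have hFTC : fracInt 2 k s = u x (-s) - u x 0 - s * l := by
    have h1 : IntervalIntegrable (fracInt 1 k) volume 0 s := by simpa using hD.1
    have h2 : ∫ r in (0 : ℝ)..s, fracInt 1 k r = (u x (-s) - s * l) - (u x (-0) - 0 * l) := by
      refine intervalIntegral.integral_eq_sub_of_hasDerivAt_of_le
        (f := fun r => u x (-r) - r * l) hs.1.le ?_ (fun r hr => ?_) h1
      · refine ContinuousOn.sub ?_ (by fun_prop)
        exact (S.continuousOn_section (Ioo_subset_Icc_self hx)).comp (by fun_prop)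
          fun r hr => ⟨by linarith [hr.2, hs.2], by linarith [hr.1]⟩
      · rw [hk1 r hr]
        have h := S.exists_minus (x, -r) ⟨hx, by simpa using hr.2.trans hs.2, by simpa using hr.1⟩
        rw [CaputoLeftExists, if_neg hβ2.ne] at h
        have hd := (h.1 (-r) ⟨le_rfl, by linarith [hr.1]⟩).hasDerivAt
        have h3 := (hd.comp r (hasDerivAt_neg r)).sub ((hasDerivAt_id r).mul_const l)
        refine h3.congr_deriv ?_
        simp only []; ring
    rw [show (2 : ℝ) = 1 + 1 by norm_num, ← hD.2, fracInt_one, h2]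
    simp; ring
  refine ⟨hA.1.congr_uIoo fun r hr => ?_, ?_, hB.1.congr_uIoo fun r hr => ?_, ?_⟩
  · simp only [hw r (hIoo r hr), hk]
  · rw [fracInt_congr hs.1.le fun r hr => hw r hr.1.le, hA.2, add_sub_cancel, hFTC]
  · simp [hw r (hIoo r hr), hk]
  · rw [← fracInt_one (fun r => caputoLeft β (u x) (-r)),
      fracInt_congr hs.1.le fun r hr => hw r hr.1.le, hB.2, add_comm, ← hC.2]
    exact fracInt_congr hs.1.le hk1

/-- The truncated integrals `∫_δ^s (s - r) ^ (β - 1) D^β u` converge to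
`Γ(β) (u - u(·,0) - s u_s(·,0))` as `δ → 0`, boundedly in `x`. -/
lemma truncated_fracInt_caputoLeft (S : IsSolution α β p q u f) (hβ1 : 1 < β) (hβ2 : β ≤ 2)
    (hp : 0 < p) (hq : 0 < q) {a b s : ℝ} (ha : 0 < a) (hb : b < 1) (hs : s ∈ Ioo 0 p)
    {L : ℝ → ℝ}
    (hL : ∀ x ∈ Ioo (0 : ℝ) 1, Tendsto (fun t => -deriv (u x) t) (𝓝[<] 0) (𝓝 (L x))) :
    (∃ C, ∀ᶠ δ in 𝓝[>] (0 : ℝ), ∀ x ∈ Icc a b,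
      |∫ r in δ..s, (s - r) ^ (β - 1) * caputoLeft β (u x) (-r)| ≤ C) ∧
    ∀ x ∈ Icc a b,
      Tendsto (fun δ => ∫ r in δ..s, (s - r) ^ (β - 1) * caputoLeft β (u x) (-r)) (𝓝[>] 0)
        (𝓝 (Real.Gamma β * (u x (-s) - u x 0 - s * L x))) := by
  have hsub : Icc a b ⊆ Ioo 0 1 := fun x hx => ⟨ha.trans_le hx.1, hx.2.trans_lt hb⟩
  obtain ⟨M, ε, hε, hεp, hM⟩ := S.exists_bound_deriv hp ha hb
  obtain ⟨K, hK⟩ := (isCompact_Icc.prod isCompact_Icc).exists_bound_of_continuousOn S.cont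
  have hK' : ∀ x ∈ Icc a b, ∀ t ∈ Icc (-p) q, |u x t| ≤ K := fun x hx t ht =>
    hK (x, t) ⟨Ioo_subset_Icc_self (hsub hx), ht⟩
  have hLM : ∀ x ∈ Icc a b, |L x| ≤ M := fun x hx => by
    refine le_of_tendsto ((hL x (hsub hx)).abs.comp tendsto_neg_nhdsGT_zero) ?_
    filter_upwards [Ioo_mem_nhdsGT hε] with r hr
    simpa using hM x hx r hr
  have hs0 := hs.1
  have hwc : ∀ x ∈ Icc a b, ContinuousOn (fun r => caputoLeft β (u x) (-r)) (Ioo 0 p) :=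
    fun x hx => S.continuousOn_caputoLeft_neg.comp (f := fun r : ℝ => (x, r)) (by fun_prop)
      fun r hr => ⟨hsub hx, hr⟩
  have hKs : ∀ x ∈ Icc a b, |u x (-s) - u x 0 - s * L x| ≤ K + K + s * M := fun x hx => by
    have h1 := hK' x hx (-s) ⟨by linarith [hs.2], by linarith⟩
    have h2 := hK' x hx 0 ⟨by linarith, hq.le⟩
    have h3 : |s * L x| ≤ s * M := by
      rw [abs_mul, abs_of_pos hs0]; exact mul_le_mul_of_nonneg_left (hLM x hx) hs0.le
    exact (abs_sub _ _).trans (add_le_add ((abs_sub _ _).trans (add_le_add h1 h2)) h3)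
  rcases hβ2.eq_or_lt with rfl | hβ
  · -- For `β = 2` the truncated integral is computed by parts.
    have hval : ∀ x ∈ Icc a b, ∀ δ ∈ Ioo 0 s,
        ∫ r in δ..s, (s - r) ^ ((2 : ℝ) - 1) * caputoLeft 2 (u x) (-r)
          = (s - δ) * deriv (u x) (-δ) + (u x (-s) - u x (-δ)) := fun x hx δ hδ => by
      have hmem : ∀ r ∈ Icc δ s, (x, -r) ∈ domMinus p := fun r hr =>
        ⟨hsub hx, by simpa using hr.2.trans_lt hs.2, by simpa using hδ.1.trans_le hr.1⟩
      have hder : ∀ r ∈ Icc δ s, HasDerivAt (u x) (deriv (u x) (-r)) (-r) ∧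
          HasDerivAt (deriv (u x)) (deriv (deriv (u x)) (-r)) (-r) := fun r hr => by
        have h := S.exists_minus (x, -r) (hmem r hr)
        rw [CaputoLeftExists, if_pos rfl] at h
        exact ⟨h.1.self_of_nhds.hasDerivAt, h.2.hasDerivAt⟩
      have hd1 : ∀ r ∈ uIcc δ s, HasDerivAt (fun r => u x (-r)) (-deriv (u x) (-r)) r :=
        fun r hr => by
          rw [uIcc_of_le hδ.2.le] at hr
          exact ((hder r hr).1.comp r (hasDerivAt_neg r)).congr_deriv (by ring)
      have hd2 : ∀ r ∈ uIcc δ s,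
          HasDerivAt (fun r => -deriv (u x) (-r)) (deriv (deriv (u x)) (-r)) r := fun r hr => by
        rw [uIcc_of_le hδ.2.le] at hr
        exact ((hder r hr).2.comp r (hasDerivAt_neg r)).neg.congr_deriv (by ring)
      have hd3 : ∀ r ∈ uIcc δ s, HasDerivAt (fun r => s - r) (-1 : ℝ) r := fun r _ => by
        simpa using (hasDerivAt_id r).const_sub s
      have hc : ContinuousOn (fun r => deriv (deriv (u x)) (-r)) (uIcc δ s) := by
        rw [uIcc_of_le hδ.2.le]
        simpa only [caputoLeft_two] using
          (hwc x hx).mono fun r hr => ⟨hδ.1.trans_le hr.1, hr.2.trans_lt hs.2⟩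
      have hc1 : ContinuousOn (fun r => -deriv (u x) (-r)) (uIcc δ s) := fun r hr =>
        (hd2 r hr).continuousAt.continuousWithinAt
      have e : ∀ r, (s - r) ^ ((2 : ℝ) - 1) * caputoLeft 2 (u x) (-r)
          = (s - r) * deriv (deriv (u x)) (-r) := fun r => by
        rw [caputoLeft_two, show (2 : ℝ) - 1 = 1 by norm_num, Real.rpow_one]
      simp only [e]
      rw [intervalIntegral.integral_mul_deriv_eq_deriv_mul hd3 hd2
        intervalIntegrable_const hc.intervalIntegrable, intervalIntegral.integral_const_mul,
        intervalIntegral.integral_eq_sub_of_hasDerivAt hd1 hc1.intervalIntegrable]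
      ring
    refine ⟨⟨s * M + (K + K), ?_⟩, fun x hx => ?_⟩
    · filter_upwards [Ioo_mem_nhdsGT (lt_min hε hs0)] with δ hδ x hx
      have hδε : δ < ε := hδ.2.trans_le (min_le_left _ _)
      have hδs : δ < s := hδ.2.trans_le (min_le_right _ _)
      rw [hval x hx δ ⟨hδ.1, hδs⟩]
      have h1 := hK' x hx (-s) ⟨by linarith [hs.2], by linarith⟩
      have h2 := hK' x hx (-δ) ⟨by linarith [hs.2], by linarith [hδ.1]⟩
      have h3 : |(s - δ) * deriv (u x) (-δ)| ≤ s * M := by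
        rw [abs_mul, abs_of_pos (by linarith)]
        exact mul_le_mul (by linarith [hδ.1]) (hM x hx δ ⟨hδ.1, hδε⟩) (abs_nonneg _) hs0.le
      exact (abs_add_le _ _).trans (add_le_add h3 ((abs_sub _ _).trans (add_le_add h1 h2)))
    · have hd : Tendsto (fun δ => deriv (u x) (-δ)) (𝓝[>] 0) (𝓝 (-L x)) := by
        simpa using ((hL x (hsub hx)).comp tendsto_neg_nhdsGT_zero).neg
      have hu0 : Tendsto (fun δ => u x (-δ)) (𝓝[>] 0) (𝓝 (u x 0)) := by
        have hc := (S.continuousOn_section (Ioo_subset_Icc_self (hsub hx))).continuousAt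
          (Icc_mem_nhds (by linarith : -p < 0) hq)
        exact (hc.tendsto.mono_left nhdsWithin_le_nhds).comp tendsto_neg_nhdsGT_zero
      have hδ0 : Tendsto (fun δ : ℝ => δ) (𝓝[>] 0) (𝓝 0) := nhdsWithin_le_nhds
      have := ((hδ0.const_sub s).mul hd).add (hu0.const_sub (u x (-s)))
      have e : Real.Gamma 2 * (u x (-s) - u x 0 - s * L x)
          = (s - 0) * -L x + (u x (-s) - u x 0) := by rw [Real.Gamma_two]; ring
      rw [e]
      refine this.congr' ?_
      filter_upwards [Ioo_mem_nhdsGT hs0] with δ hδ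
      exact (hval x hx δ hδ).symm
  · -- For `β < 2` the missing piece `∫_0^δ` is controlled by the primitive of `D^β u`, which by
    -- `fracInt_caputoLeft` only involves `u_t`, bounded for times in `(0, ε)`.
    have hG := Real.Gamma_pos_of_pos (show 0 < β by linarith)
    have hmain : ∀ x ∈ Icc a b, ∀ r ∈ Ioo 0 p, _ := fun x hx r hr =>
      S.fracInt_caputoLeft hβ1 hβ hq (hsub hx) hr (hL x (hsub hx))
    have hfull : ∀ x ∈ Icc a b, ∫ r in (0 : ℝ)..s, (s - r) ^ (β - 1) * caputoLeft β (u x) (-r)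
        = Real.Gamma β * (u x (-s) - u x 0 - s * L x) := fun x hx => by
      rw [← (hmain x hx s hs).2.1, fracInt]; field_simp
    have hsplit : ∀ x ∈ Icc a b, ∀ δ ∈ Ioo 0 s,
        ∫ r in δ..s, (s - r) ^ (β - 1) * caputoLeft β (u x) (-r)
          = Real.Gamma β * (u x (-s) - u x 0 - s * L x)
            - ∫ r in (0 : ℝ)..δ, (s - r) ^ (β - 1) * caputoLeft β (u x) (-r) := fun x hx δ hδ => by
      have hi := (hmain x hx s hs).1
      rw [← hfull x hx, eq_sub_iff_add_eq, add_comm]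
      refine intervalIntegral.integral_add_adjacent_intervals (hi.mono_set ?_) (hi.mono_set ?_)
      · rw [uIcc_of_le hδ.1.le, uIcc_of_le hs0.le]; exact Icc_subset_Icc_right hδ.2.le
      · rw [uIcc_of_le hδ.2.le, uIcc_of_le hs0.le]; exact Icc_subset_Icc_left hδ.1.le
    have hG2 := Real.Gamma_pos_of_pos (show 0 < 2 - β + 1 by linarith)
    refine ⟨⟨Real.Gamma β * (K + K + s * M)
      + s ^ (β - 1) * ((M + M) * s ^ (2 - β) / Real.Gamma (2 - β + 1)), ?_⟩, fun x hx => ?_⟩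
    · filter_upwards [Ioo_mem_nhdsGT (lt_min hε hs0)] with δ hδ x hx
      have hδε : δ < ε := hδ.2.trans_le (min_le_left _ _)
      have hδs : δ < s := hδ.2.trans_le (min_le_right _ _)
      have hMM : 0 ≤ M + M := by
        have := (abs_nonneg _).trans (hLM x hx); linarith
      rw [hsplit x hx δ ⟨hδ.1, hδs⟩]
      refine (abs_sub _ _).trans (add_le_add ?_ ?_)
      · rw [abs_mul, abs_of_pos hG]
        exact mul_le_mul_of_nonneg_left (hKs x hx) hG.le
      · refine abs_integral_kernel_mul_le (by linarith) hδ.1.le hδs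
          ((hwc x hx).mono (Ioo_subset_Ioo_right hs.2.le)) (hmain x hx s hs).2.2.1 fun r hr => ?_
        rcases hr.1.eq_or_lt with rfl | hr0
        · rw [intervalIntegral.integral_same, abs_zero]
          have := Real.rpow_nonneg hs0.le (2 - β)
          positivity
        · rw [(hmain x hx r ⟨hr0, by linarith [hr.2, hs.2]⟩).2.2.2]
          refine (abs_fracInt_le (C := M + M) (by linarith) hr0.le fun y hy => ?_).trans ?_
          · refine (abs_sub _ _).trans (add_le_add ?_ (hLM x hx))
            rw [abs_neg]
            exact hM x hx y ⟨hy.1, by linarith [hy.2, hr.2]⟩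
          · gcongr
            · linarith [hr.2]
    · have hc := intervalIntegral.continuousOn_primitive_interval' (hmain x hx s hs).1
        left_mem_uIcc 0 left_mem_uIcc
      have h0 : Tendsto (fun δ => ∫ r in (0 : ℝ)..δ, (s - r) ^ (β - 1) * caputoLeft β (u x) (-r))
          (𝓝[>] 0) (𝓝 0) := by
        have h1 := hc.tendsto
        simp only [intervalIntegral.integral_same] at h1
        refine h1.mono_left ?_
        rw [uIcc_of_le hs0.le, ← nhdsWithin_Ioo_eq_nhdsGT hs0]
        exact nhdsWithin_mono _ Ioo_subset_Icc_self
      have h1 := h0.const_sub (Real.Gamma β * (u x (-s) - u x 0 - s * L x))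
      rw [sub_zero] at h1
      refine h1.congr' ?_
      filter_upwards [Ioo_mem_nhdsGT hs0] with δ hδ
      exact (hsplit x hx δ hδ).symm

/-- The equation for `t = -s < 0`, tested against `ψ` in `x` and integrated `β` times in `s`. -/
lemma integral_mul_sub_minus (S : IsSolution α β p q u f) (hβ1 : 1 < β) (hβ2 : β ≤ 2) (hp : 0 < p)
    (hq : 0 < q) {ψ : ℝ → ℝ} {a b : ℝ} (hψ : IsTest ψ a b) {s : ℝ} (hs : s ∈ Ioo 0 p)
    {L : ℝ → ℝ}
    (hL : ∀ x ∈ Ioo (0 : ℝ) 1, Tendsto (fun t => -deriv (u x) t) (𝓝[<] 0) (𝓝 (L x))) :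
    ∫ x in a..b, ψ x * (u x (-s) - u x 0 - s * L x)
      = (∫ x in a..b, ψ x * f x) * s ^ β / Real.Gamma (β + 1)
        + fracInt β (fun r => ∫ x in a..b, u x (-r) * deriv (deriv ψ) x) s := by
  have hβ0 : 0 < β := by linarith
  have hG := Real.Gamma_pos_of_pos hβ0
  obtain ⟨⟨C, hC⟩, hlim⟩ :=
    S.truncated_fracInt_caputoLeft hβ1 hβ2 hp hq hψ.pos hψ.lt_one hs hL
  set F := ∫ x in a..b, ψ x * f x with hF
  set V : ℝ → ℝ := fun r => ∫ x in a..b, u x (-r) * deriv (deriv ψ) x with hV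
  have hVc : ContinuousOn V (Icc 0 s) :=
    (continuousOn_integral_mul (by linarith) S.cont hψ.pos.le hψ.le hψ.lt_one.le
      (continuous_deriv_deriv hψ.contDiff)).comp (f := fun r : ℝ => -r) (by fun_prop)
      fun r hr => ⟨by linarith [hr.2, hs.2], by linarith [hr.1]⟩
  have hswap : ∀ δ ∈ Ioo 0 s,
      IntervalIntegrable (fun x => ψ x * ∫ r in δ..s, (s - r) ^ (β - 1) * caputoLeft β (u x) (-r))
        volume a b ∧
      ∫ x in a..b, ψ x * ∫ r in δ..s, (s - r) ^ (β - 1) * caputoLeft β (u x) (-r)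
        = ∫ r in δ..s, (s - r) ^ (β - 1) * (F + V r) := fun δ hδ => by
    have hsub : Icc a b ×ˢ Icc δ s ⊆ Ioo (0 : ℝ) 1 ×ˢ Ioo 0 p :=
      prod_mono hψ.Icc_subset fun r hr => ⟨hδ.1.trans_le hr.1, hr.2.trans_lt hs.2⟩
    obtain ⟨M, hM⟩ := (isCompact_Icc.prod isCompact_Icc).exists_bound_of_continuousOn
      (S.continuousOn_caputoLeft_neg.mono hsub)
    obtain ⟨h1, h2⟩ := integral_mul_integral_mul_swap
      (w := fun x r => caputoLeft β (u x) (-r)) (κ := fun r => (s - r) ^ (β - 1)) hψ.le hδ.2.le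
      (S.continuousOn_caputoLeft_neg.mono ((prod_mono_right Ioo_subset_Icc_self).trans hsub))
      (fun x hx r hr => hM (x, r) ⟨hx, Ioo_subset_Icc_self hr⟩)
      (intervalIntegrable_kernel hβ0 δ s s) hψ.contDiff.continuous.continuousOn
    refine ⟨h1, h2.trans (intervalIntegral.integral_congr fun r hr => ?_)⟩
    rw [uIcc_of_le hδ.2.le] at hr
    have hr' : -r ∈ Ioo (-p) 0 :=
      ⟨by linarith [hr.2, hs.2], by linarith [hr.1, hδ.1]⟩
    simp only [S.integral_mul_eq_add hψ (Or.inr hr') fun x hx => S.eq_minus (x, -r) ⟨hx, hr'⟩,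
      hV, hF]
  have hev : Ioo 0 s ∈ 𝓝[>] (0 : ℝ) := Ioo_mem_nhdsGT hs.1
  have hlhs : Tendsto (fun δ => ∫ x in a..b, ψ x * ∫ r in δ..s,
      (s - r) ^ (β - 1) * caputoLeft β (u x) (-r)) (𝓝[>] 0)
      (𝓝 (∫ x in a..b, ψ x * (Real.Gamma β * (u x (-s) - u x 0 - s * L x)))) := by
    refine intervalIntegral.tendsto_integral_filter_of_dominated_convergence
      (fun x => |ψ x| * C) ?_ ?_ ?_ ?_
    · filter_upwards [hev] with δ hδ
      rw [uIoc_of_le hψ.le]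
      exact ((intervalIntegrable_iff_integrableOn_Ioc_of_le hψ.le).1 (hswap δ hδ).1).1
    · filter_upwards [hC] with δ hδ
      rw [uIoc_of_le hψ.le]
      refine Eventually.of_forall fun x hx => ?_
      rw [norm_mul, Real.norm_eq_abs, Real.norm_eq_abs]
      exact mul_le_mul_of_nonneg_left (hδ x (Ioc_subset_Icc_self hx)) (abs_nonneg _)
    · exact (hψ.contDiff.continuous.abs.mul continuous_const).intervalIntegrable _ _
    · rw [uIoc_of_le hψ.le]
      exact Eventually.of_forall fun x hx => (hlim x (Ioc_subset_Icc_self hx)).const_mul _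
  have hi1 : IntervalIntegrable (fun r => (s - r) ^ (β - 1) * F) volume 0 s :=
    (intervalIntegrable_kernel hβ0 0 s s).mul_const _
  have hi2 := intervalIntegrable_kernel_mul hβ0 hs.1.le hVc
  have hi : IntervalIntegrable (fun r => (s - r) ^ (β - 1) * (F + V r)) volume 0 s := by
    simpa only [mul_add] using hi1.add hi2
  have hrhs : Tendsto (fun δ => ∫ x in a..b, ψ x * ∫ r in δ..s,
      (s - r) ^ (β - 1) * caputoLeft β (u x) (-r)) (𝓝[>] 0)
      (𝓝 (∫ r in (0 : ℝ)..s, (s - r) ^ (β - 1) * (F + V r))) := by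
    have hc := intervalIntegral.continuousOn_primitive_interval' hi right_mem_uIcc 0 left_mem_uIcc
    have h1 : Tendsto (fun δ => ∫ r in s..δ, (s - r) ^ (β - 1) * (F + V r)) (𝓝[>] 0)
        (𝓝 (∫ r in s..(0 : ℝ), (s - r) ^ (β - 1) * (F + V r))) := by
      refine hc.tendsto.mono_left ?_
      rw [uIcc_of_le hs.1.le, ← nhdsWithin_Ioo_eq_nhdsGT hs.1]
      exact nhdsWithin_mono _ Ioo_subset_Icc_self
    rw [intervalIntegral.integral_symm s 0]
    refine h1.neg.congr' ?_
    filter_upwards [hev] with δ hδ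
    rw [(hswap δ hδ).2, intervalIntegral.integral_symm δ s, neg_neg]
  have hfin := tendsto_nhds_unique hlhs hrhs
  rw [← fracInt_const hβ0, ← fracInt_add hi1 hi2, fracInt, ← hfin,
    ← intervalIntegral.integral_const_mul]
  refine intervalIntegral.integral_congr fun x _ => ?_
  field_simp

end IsSolution

/-! ### Moment equations -/

lemma tendsto_fracInt {a t C : ℝ} (ha : 0 < a) (ht : 0 ≤ t) {Z : ℕ → ℝ → ℝ} {Z₀ : ℝ → ℝ}
    (hZ : ∀ n, ContinuousOn (Z n) (Icc 0 t)) (hC : ∀ n, ∀ r ∈ Ioc 0 t, |Z n r| ≤ C)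
    (hlim : ∀ r ∈ Ioc 0 t, Tendsto (fun n => Z n r) atTop (𝓝 (Z₀ r))) :
    Tendsto (fun n => fracInt a (Z n) t) atTop (𝓝 (fracInt a Z₀ t)) := by
  refine Tendsto.const_mul _ ?_
  refine intervalIntegral.tendsto_integral_filter_of_dominated_convergence
    (fun r => (t - r) ^ (a - 1) * C) ?_ ?_ ((intervalIntegrable_kernel ha 0 t t).mul_const C) ?_
  · rw [uIoc_of_le ht]
    exact Eventually.of_forall fun n => (intervalIntegrable_kernel_mul ha ht (hZ n)).1.1
  · rw [uIoc_of_le ht]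
    refine Eventually.of_forall fun n => Eventually.of_forall fun r hr => ?_
    have h0 : 0 ≤ (t - r) ^ (a - 1) := Real.rpow_nonneg (sub_nonneg.2 hr.2) _
    rw [norm_mul, Real.norm_eq_abs, Real.norm_eq_abs, abs_of_nonneg h0]
    exact mul_le_mul_of_nonneg_left (hC n r hr) h0
  · rw [uIoc_of_le ht]
    exact Eventually.of_forall fun r hr => (hlim r hr).const_mul _

namespace IsSolution

variable {α β p q : ℝ} {u : ℝ → ℝ → ℝ} {f : ℝ → ℝ}

/-- The slope of `u` at the side `x = 0` is bounded, locally uniformly in `t`. -/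
lemma exists_abs_sub_le (S : IsSolution α β p q u f) {T₁ T₂ : ℝ} (hT₁ : -p < T₁) (hT₂ : T₂ < q) :
    ∃ M, 0 ≤ M ∧ ∀ t ∈ Icc T₁ T₂, t ≠ 0 → ∀ x ∈ Icc (0 : ℝ) 1, |u x t - u 0 t| ≤ M * x := by
  obtain ⟨M, U, hU, hKU, H⟩ := exists_bound_near_compact (S := domPlus q ∪ domMinus p)
    (F := fun z => dx u z.1 z.2)
    ((isCompact_singleton (x := (0 : ℝ))).prod (isCompact_Icc (a := T₁) (b := T₂))) fun z hz => by
      have e : z = (0, z.2) := Prod.ext hz.1 rfl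
      rw [e]; exact S.bdd_dx z.2 ⟨hT₁.trans_le hz.2.1, hz.2.2.trans_lt hT₂⟩
  obtain ⟨V, W, hV, -, hV0, hW, hVW⟩ := generalized_tube_lemma (isCompact_singleton (x := (0 : ℝ)))
    (isCompact_Icc (a := T₁) (b := T₂)) hU hKU
  obtain ⟨ε, hε, hball⟩ := Metric.isOpen_iff.1 hV 0 (hV0 rfl)
  obtain ⟨K, hK⟩ := (isCompact_Icc.prod isCompact_Icc).exists_bound_of_continuousOn S.cont
  refine ⟨|M| + 2 * |K| / ε, by positivity, fun t ht ht0 x hx => ?_⟩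
  have htI : t ∈ Icc (-p) q := ⟨by linarith [ht.1], by linarith [ht.2]⟩
  rcases hx.1.eq_or_lt with rfl | hx0
  · simp
  rcases lt_or_ge x ε with hxε | hxε
  · have hmem : ∀ y ∈ Ioo 0 x, (y, t) ∈ domPlus q ∪ domMinus p := fun y hy => by
      have hy1 : y ∈ Ioo (0 : ℝ) 1 := ⟨hy.1, hy.2.trans_le hx.2⟩
      rcases ht0.lt_or_gt with h | h
      · exact Or.inr ⟨hy1, by linarith [ht.1], h⟩
      · exact Or.inl ⟨hy1, h, by linarith [ht.2]⟩
    obtain ⟨c, hc, hc'⟩ := exists_deriv_eq_slope (fun y => u y t) hx0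
      ((S.continuousOn_slice htI).mono (Icc_subset_Icc_right hx.2))
      fun y hy => ((S.diff_x _ (hmem y hy)).1).differentiableWithinAt
    have h1 : |dx u c t| ≤ M := H (c, t) (hVW ⟨hball (by
      simpa [abs_of_pos hc.1] using hc.2.trans hxε), hW ht⟩) (hmem c hc)
    rw [dx, hc', sub_zero, abs_div, abs_of_pos hx0, div_le_iff₀ hx0] at h1
    refine h1.trans (mul_le_mul_of_nonneg_right ?_ hx0.le)
    have : 0 ≤ 2 * |K| / ε := by positivity
    linarith [le_abs_self M]
  · have h1 : |u x t| ≤ |K| := (hK (x, t) ⟨hx, htI⟩).trans (le_abs_self K)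
    have h2 : |u 0 t| ≤ |K| := (hK (0, t) ⟨by simp, htI⟩).trans (le_abs_self K)
    have h3 : 2 * |K| ≤ 2 * |K| / ε * x := by
      rw [div_mul_eq_mul_div, le_div_iff₀ hε]
      exact mul_le_mul_of_nonneg_left hxε (by positivity)
    have h4 : 0 ≤ |M| * x := by positivity
    have h5 := abs_sub (u x t) (u 0 t)
    linarith

/-- The equations satisfied by the moments of `u` against a function `Y` that satisfies the
adjoint boundary conditions. The numbers `F` and `Φ` play the role of the moments of `f` and of
the common limit in the transmitting condition, which need not be integrable on `(0,1)`. -/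
lemma exists_moment_equations (S : IsSolution α β p q u f) (hα0 : 0 < α) (hα1 : α ≤ 1)
    (hβ1 : 1 < β) (hβ2 : β ≤ 2) (hp : 0 < p) (hq : 0 < q) {Y : ℝ → ℝ} (hY : ContDiff ℝ 2 Y)
    (hY1 : Y 1 = 0) (hY' : deriv Y 0 = deriv Y 1) :
    ∃ F Φ : ℝ, Φ = F + ∫ x in (0 : ℝ)..1, u x 0 * deriv (deriv Y) x ∧
      (∀ t ∈ Ioo 0 q, (∫ x in (0 : ℝ)..1, u x t * Y x) - (∫ x in (0 : ℝ)..1, u x 0 * Y x)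
        = F * t ^ α / Real.Gamma (α + 1)
          + fracInt α (fun r => ∫ x in (0 : ℝ)..1, u x r * deriv (deriv Y) x) t) ∧
      (∀ s ∈ Ioo 0 p, (∫ x in (0 : ℝ)..1, u x (-s) * Y x) - (∫ x in (0 : ℝ)..1, u x 0 * Y x)
          - s * Φ = F * s ^ β / Real.Gamma (β + 1)
          + fracInt β (fun r => ∫ x in (0 : ℝ)..1, u x (-r) * deriv (deriv Y) x) s) := by
  have hpq : -p ≤ q := by linarith
  have hβ0 : 0 < β := by linarith
  choose! L hL₁ hL₂ using S.transmit
  set ψ := truncation Y with hψdef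
  have hψ : ∀ n, IsTest (ψ n) _ _ := isTest_truncation hY
  set U : (ℝ → ℝ) → ℝ → ℝ := fun ϕ t => ∫ x in (0 : ℝ)..1, u x t * ϕ x with hUdef
  have hUc : ∀ {ϕ : ℝ → ℝ}, Continuous ϕ → ContinuousOn (U ϕ) (Icc (-p) q) := fun hϕ =>
    continuousOn_integral_mul hpq S.cont le_rfl zero_le_one le_rfl hϕ
  have hψ''c : ∀ n, Continuous (deriv (deriv (ψ n))) := fun n =>
    continuous_deriv_deriv (hψ n).contDiff
  have hY''c := continuous_deriv_deriv hY
  have hslice : ∀ {t : ℝ}, t ∈ Icc (-p) q → ∀ {ϕ : ℝ → ℝ}, Continuous ϕ →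
      IntervalIntegrable (fun x => u x t * ϕ x) volume 0 1 := fun ht _ hϕ =>
    ContinuousOn.intervalIntegrable (by
      rw [uIcc_of_le zero_le_one]; exact (S.continuousOn_slice ht).mul hϕ.continuousOn)
  -- Convergence of the moments and of their second derivatives.
  have hU : ∀ t ∈ Icc (-p) q, Tendsto (fun n => U (ψ n) t) atTop (𝓝 (U Y t)) := fun t ht => by
    refine intervalIntegral.tendsto_integral_filter_of_dominated_convergence
      (fun x => 3 * |u x t * Y x|) ?_ ?_ ((hslice ht hY.continuous).abs.const_mul 3) ?_
    · rw [uIoc_of_le zero_le_one]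
      exact Eventually.of_forall fun n => (hslice ht (hψ n).contDiff.continuous).1.1
    · refine Eventually.of_forall fun n => Eventually.of_forall fun x _ => ?_
      rw [Real.norm_eq_abs, abs_mul, abs_mul, mul_left_comm]
      exact mul_le_mul_of_nonneg_left (abs_truncation_le Y n x) (abs_nonneg _)
    · have : ∀ᵐ x : ℝ, x ≠ 1 := by simp [ae_iff]
      filter_upwards [this] with x hx1 hx
      rw [uIoc_of_le zero_le_one] at hx
      exact (tendsto_truncation Y ⟨hx.1, lt_of_le_of_ne hx.2 hx1⟩).const_mul _
  have hZ : ∀ t ∈ Icc (-p) q,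
      Tendsto (fun n => U (deriv (deriv (ψ n))) t) atTop (𝓝 (U (deriv (deriv Y)) t)) :=
    fun t ht => tendsto_integral_deriv_deriv_truncation hY hY1 hY' (S.continuousOn_slice ht)
      (S.periodic t ht) (S.neumann t ht)
  have hZb : ∀ T₁ T₂, -p < T₁ → T₂ < q → ∃ C, ∀ n, ∀ t ∈ Icc T₁ T₂, t ≠ 0 →
      |U (deriv (deriv (ψ n))) t| ≤ C := fun T₁ T₂ hT₁ hT₂ => by
    obtain ⟨M, hM0, hM⟩ := S.exists_abs_sub_le hT₁ hT₂
    obtain ⟨C, hC0, hC⟩ := exists_abs_integral_truncation_sub_le hY hY1 hY'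
    obtain ⟨K, hK⟩ := (isCompact_Icc.prod isCompact_Icc).exists_bound_of_continuousOn S.cont
    obtain ⟨D, hD⟩ := isCompact_Icc.exists_bound_of_continuousOn (hUc hY''c)
    refine ⟨C * (M + 2 * |K|) + D, fun n t ht ht0 => ?_⟩
    have htI : t ∈ Icc (-p) q := ⟨by linarith [ht.1], by linarith [ht.2]⟩
    have hKx : ∀ x ∈ Icc (0 : ℝ) 1, |u x t| ≤ |K| := fun x hx =>
      (hK (x, t) ⟨hx, htI⟩).trans (le_abs_self K)
    have h1 := hC (fun x => u x t) (S.continuousOn_slice htI) (S.periodic t htI) n (M + 2 * |K|)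
      (by positivity) fun x hx => by
        have hx1 : x ≤ 1 := hx.2.trans (by
          have : (0 : ℝ) ≤ n := n.cast_nonneg
          rw [div_le_one (by linarith)]; linarith)
        refine ⟨(hM t ht ht0 x ⟨hx.1, hx1⟩).trans
          (mul_le_mul_of_nonneg_right (by linarith [abs_nonneg K]) hx.1), ?_⟩
        have h2 := hKx (1 - x) ⟨by linarith, by linarith [hx.1]⟩
        have h3 := hKx 1 (by simp)
        have h4 := abs_sub (u (1 - x) t) (u 1 t)
        linarith
    have h2 : |U (deriv (deriv Y)) t| ≤ D := hD t htI
    have h3 := abs_add_le (U (deriv (deriv (ψ n))) t - U (deriv (deriv Y)) t)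
      (U (deriv (deriv Y)) t)
    rw [sub_add_cancel] at h3
    exact h3.trans (add_le_add h1 h2)
  have hIα : ∀ t ∈ Ioo 0 q, Tendsto (fun n => fracInt α (U (deriv (deriv (ψ n)))) t) atTop
      (𝓝 (fracInt α (U (deriv (deriv Y))) t)) := fun t ht => by
    obtain ⟨C, hC⟩ := hZb 0 t (by linarith) ht.2
    exact tendsto_fracInt hα0 ht.1.le
      (fun n => (hUc (hψ''c n)).mono (Icc_subset_Icc (by linarith) ht.2.le))
      (fun n r hr => hC n r ⟨hr.1.le, hr.2⟩ hr.1.ne')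
      fun r hr => hZ r ⟨by linarith [hr.1], by linarith [hr.2, ht.2]⟩
  have hIβ : ∀ s ∈ Ioo 0 p, Tendsto (fun n => fracInt β (fun r => U (deriv (deriv (ψ n))) (-r)) s)
      atTop (𝓝 (fracInt β (fun r => U (deriv (deriv Y)) (-r)) s)) := fun s hs => by
    obtain ⟨C, hC⟩ := hZb (-s) 0 (by linarith [hs.2]) hq
    exact tendsto_fracInt hβ0 hs.1.le
      (fun n => (hUc (hψ''c n)).comp (by fun_prop) fun r hr =>
        ⟨by linarith [hr.2, hs.2], by linarith [hr.1]⟩)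
      (fun n r hr => hC n (-r) ⟨by linarith [hr.2], by linarith [hr.1]⟩ (by linarith [hr.1]))
      fun r hr => hZ (-r) ⟨by linarith [hr.2, hs.2], by linarith [hr.1]⟩
  -- The equations for the truncations.
  set F : ℕ → ℝ := fun n =>
    ∫ x in (1 / ((n : ℝ) + 3))..(1 - 1 / ((n : ℝ) + 3)), ψ n x * f x with hF
  have hplus : ∀ n, ∀ t ∈ Ioo 0 q, U (ψ n) t - U (ψ n) 0
      = F n * t ^ α / Real.Gamma (α + 1) + fracInt α (U (deriv (deriv (ψ n)))) t :=
    fun n t ht => by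
      have h := S.integral_mul_sub_plus hα0 hα1 hp (hψ n) ht
      simp only [(hψ n).integral_mul_deriv_deriv_eq] at h
      rw [← h]
      have e : ∀ x, ψ n x * (u x t - u x 0) = (u x t - u x 0) * ψ n x := fun x => mul_comm _ _
      simp only [e]
      rw [(hψ n).integral_mul_eq]
      simp only [sub_mul, hUdef]
      rw [intervalIntegral.integral_sub
        (hslice ⟨by linarith [ht.1], ht.2.le⟩ (hψ n).contDiff.continuous)
        (hslice ⟨by linarith, hq.le⟩ (hψ n).contDiff.continuous)]
  have hminus : ∀ n, ∀ s ∈ Ioo 0 p,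
      U (ψ n) (-s) - U (ψ n) 0 - s * (F n + U (deriv (deriv (ψ n))) 0)
      = F n * s ^ β / Real.Gamma (β + 1)
        + fracInt β (fun r => U (deriv (deriv (ψ n))) (-r)) s := fun n s hs => by
    obtain ⟨hLi, hLe⟩ := S.integral_mul_limit hp hq (hψ n) hL₁
    have h := S.integral_mul_sub_minus hβ1 hβ2 hp hq (hψ n) hs hL₂
    simp only [(hψ n).integral_mul_deriv_deriv_eq] at h hLe
    have hc : ContinuousOn (fun x => (u x (-s) - u x 0) * ψ n x) (Icc 0 1) :=
      ((S.continuousOn_slice ⟨by linarith [hs.2], by linarith [hs.1]⟩).sub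
        (S.continuousOn_slice ⟨by linarith, hq.le⟩)).mul (hψ n).contDiff.continuous.continuousOn
    have hci : IntervalIntegrable (fun x => (u x (-s) - u x 0) * ψ n x) volume
        (1 / ((n : ℝ) + 3)) (1 - 1 / ((n : ℝ) + 3)) := ContinuousOn.intervalIntegrable (by
      rw [uIcc_of_le (hψ n).le]
      exact hc.mono (Icc_subset_Icc (hψ n).pos.le (hψ n).lt_one.le))
    have e : ∀ x, ψ n x * (u x (-s) - u x 0 - s * L x)
        = (u x (-s) - u x 0) * ψ n x - s * (ψ n x * L x) := fun x => by ring
    simp only [e] at h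
    rw [intervalIntegral.integral_sub hci (hLi.const_mul s), intervalIntegral.integral_const_mul,
      hLe, (hψ n).integral_mul_eq] at h
    simp only [sub_mul] at h
    rw [intervalIntegral.integral_sub
        (hslice ⟨by linarith [hs.2], by linarith [hs.1]⟩ (hψ n).contDiff.continuous)
        (hslice ⟨by linarith, hq.le⟩ (hψ n).contDiff.continuous)] at h
    exact h
  have h0I : (0 : ℝ) ∈ Icc (-p) q := ⟨by linarith, hq.le⟩
  have hGα := Real.Gamma_pos_of_pos (show 0 < α + 1 by linarith)
  -- The first equation at a single time shows that the moments of `f` converge.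
  have hqm : q / 2 ∈ Ioo 0 q := ⟨by linarith, by linarith⟩
  have hFlim : ∃ F₀, Tendsto F atTop (𝓝 F₀) := by
    have hqα : 0 < (q / 2) ^ α := Real.rpow_pos_of_pos hqm.1 _
    refine ⟨_, Tendsto.congr (fun n => ?_)
      ((((hU (q / 2) ⟨by linarith, by linarith⟩).sub (hU 0 h0I)).sub (hIα _ hqm)).mul_const
        (Real.Gamma (α + 1) / (q / 2) ^ α))⟩
    rw [hplus n _ hqm]
    field_simp
    ring
  obtain ⟨F₀, hF₀⟩ := hFlim
  refine ⟨F₀, F₀ + U (deriv (deriv Y)) 0, rfl, fun t ht => ?_, fun s hs => ?_⟩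
  · have h1 := (hU t ⟨by linarith [ht.1], ht.2.le⟩).sub (hU 0 h0I)
    have h2 := ((hF₀.mul_const (t ^ α)).div_const (Real.Gamma (α + 1))).add (hIα t ht)
    exact tendsto_nhds_unique h1 (h2.congr fun n => (hplus n t ht).symm)
  · have h1 := ((hU (-s) ⟨by linarith [hs.2], by linarith [hs.1]⟩).sub (hU 0 h0I)).sub
      ((hF₀.add (hZ 0 h0I)).const_mul s)
    have h2 := ((hF₀.mul_const (s ^ β)).div_const (Real.Gamma (β + 1))).add (hIβ s hs)
    exact tendsto_nhds_unique h1 (h2.congr fun n => (hminus n s hs).symm)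

end IsSolution

/-- The one-dimensional problem for a moment `V` of the solution: the two halves are
`V - V 0 = Φ t ^ α E_{α,α+1}(-μ t ^ α)` and
`V - V 0 = Φ (s E_{β,2}(-μ s ^ β) + s ^ β E_{β,β+1}(-μ s ^ β))`. At `t = q` and `s = p` both equal
`-V 0`, so that `Φ` times the determinant vanishes. -/
lemma eq_zero_of_moment_equations {α β p q μ F Φ : ℝ} (hα0 : 0 < α) (hβ1 : 1 < β) (hp : 0 < p)
    (hq : 0 < q) {V : ℝ → ℝ} (hV : ContinuousOn V (Icc (-p) q)) (hVq : V q = 0) (hVp : V (-p) = 0)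
    (hΦ : Φ = F + -μ * V 0)
    (hplus : ∀ t ∈ Ioo 0 q, V t - V 0
      = F * t ^ α / Real.Gamma (α + 1) + fracInt α (fun r => -μ * V r) t)
    (hminus : ∀ s ∈ Ioo 0 p, V (-s) - V 0 - s * Φ
      = F * s ^ β / Real.Gamma (β + 1) + fracInt β (fun r => -μ * V (-r)) s)
    (hΔ : p ^ β * mittagLeffler β (β + 1) (-μ * p ^ β) + p * mittagLeffler β 2 (-μ * p ^ β)
      - q ^ α * mittagLeffler α (α + 1) (-μ * q ^ α) ≠ 0) :
    ∀ t ∈ Icc (-p) q, V t = 0 := by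
  have hβ0 : 0 < β := by linarith
  have hVr : ContinuousOn (fun s => V (-s)) (Icc 0 p) :=
    hV.comp (by fun_prop) fun s hs => ⟨by linarith [hs.2], by linarith [hs.1]⟩
  have hcρ : ∀ {c : ℝ}, 0 ≤ c → Continuous fun t : ℝ => t ^ c := fun hc =>
    Real.continuous_rpow_const hc
  -- The constant `V 0` contributes to the inhomogeneity, turning `F` into `Φ`.
  have hshift : ∀ {a s : ℝ}, 0 < a → 0 ≤ s → ∀ {G : ℝ → ℝ}, ContinuousOn G (Icc 0 s) →
      fracInt a (fun r => -μ * G r) s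
        = -μ * V 0 * s ^ a / Real.Gamma (a + 1) - μ * fracInt a (fun r => G r - V 0) s := by
    intro a s ha hs G hG
    have e : (fun r => -μ * G r) = fun r => -μ * V 0 + -μ * (G r - V 0) := by funext r; ring
    have hG0 : ContinuousOn (fun r => -μ * (G r - V 0)) (Icc 0 s) :=
      continuousOn_const.mul (hG.sub continuousOn_const)
    rw [e, fracInt_add (intervalIntegrable_kernel_mul ha hs continuousOn_const)
      (intervalIntegrable_kernel_mul ha hs hG0), fracInt_const ha, fracInt_const_mul]
    ring
  have hP : EqOn (fun t => V t - V 0)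
      (fun t => Φ * (t ^ α * mittagLeffler α (α + 1) (-μ * t ^ α))) (Icc 0 q) := by
    refine EqOn.of_subset_closure (s := Ioo 0 q) (fun t ht => ?_)
      ((hV.mono (Icc_subset_Icc_left (by linarith))).sub continuousOn_const) ?_
      Ioo_subset_Icc_self (closure_Ioo hq.ne).ge
    · have hVt : ContinuousOn V (Icc 0 t) := hV.mono (Icc_subset_Icc (by linarith) ht.2.le)
      have h := eq_mittagLeffler_of_volterra (a := α) (b₁ := α + 1) (b₂ := 1) (μ := μ) (c₁ := Φ)
        (c₂ := 0) (T := t) (X := fun t => V t - V 0) hα0 (by linarith) le_rfl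
        (hVt.sub continuousOn_const) (fun r hr => by
          rw [hplus r ⟨hr.1, hr.2.trans_lt ht.2⟩, hshift hα0 hr.1.le
            (hVt.mono (Icc_subset_Icc_right hr.2)), hΦ, add_sub_cancel_right]
          ring) t ⟨ht.1, le_rfl⟩
      simpa using h
    · exact (continuous_const.mul ((hcρ hα0.le).mul ((continuous_mittagLeffler hα0
        (by linarith)).comp (continuous_const.mul (hcρ hα0.le))))).continuousOn
  have hM : EqOn (fun s => V (-s) - V 0)
      (fun s => Φ * (s ^ β * mittagLeffler β (β + 1) (-μ * s ^ β)
        + s * mittagLeffler β 2 (-μ * s ^ β))) (Icc 0 p) := by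
    refine EqOn.of_subset_closure (s := Ioo 0 p) (fun s hs => ?_)
      (hVr.sub continuousOn_const) ?_ Ioo_subset_Icc_self (closure_Ioo hp.ne).ge
    · have hVs : ContinuousOn (fun s => V (-s)) (Icc 0 s) :=
        hVr.mono (Icc_subset_Icc_right hs.2.le)
      have h := eq_mittagLeffler_of_volterra (a := β) (b₁ := β + 1) (b₂ := 2) (μ := μ) (c₁ := Φ)
        (c₂ := Φ) (T := s) (X := fun s => V (-s) - V 0) hβ0 (by linarith) one_le_two
        (hVs.sub continuousOn_const) (fun r hr => by
          have h1 := hminus r ⟨hr.1, hr.2.trans_lt hs.2⟩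
          rw [hshift hβ0 hr.1.le (hVs.mono (Icc_subset_Icc_right hr.2))] at h1
          have e2 : r ^ ((2 : ℝ) - 1) = r := by
            rw [show (2 : ℝ) - 1 = 1 by norm_num, Real.rpow_one]
          rw [e2, Real.Gamma_two, add_sub_cancel_right]
          have h2 : Φ * (r ^ β / Real.Gamma (β + 1)) = F * r ^ β / Real.Gamma (β + 1)
              + -μ * V 0 * r ^ β / Real.Gamma (β + 1) := by rw [hΦ]; ring
          rw [h2]
          linarith) s ⟨hs.1, le_rfl⟩
      have e2 : s ^ ((2 : ℝ) - 1) = s := by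
        rw [show (2 : ℝ) - 1 = 1 by norm_num, Real.rpow_one]
      rw [e2, add_sub_cancel_right] at h
      simp only [h]; ring
    · have hc : ∀ b : ℝ, 1 ≤ b → Continuous fun s : ℝ => mittagLeffler β b (-μ * s ^ β) :=
        fun b hb => (continuous_mittagLeffler hβ0 hb).comp (continuous_const.mul (hcρ hβ0.le))
      exact (continuous_const.mul (((hcρ hβ0.le).mul (hc _ (by linarith))).add
        (continuous_id.mul (hc 2 one_le_two)))).continuousOn
  have hq' := hP (right_mem_Icc.2 hq.le)
  have hp' := hM (right_mem_Icc.2 hp.le)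
  simp only [hVq] at hq'
  simp only [hVp] at hp'
  have hΦ0 : Φ = 0 := by
    have : Φ * (p ^ β * mittagLeffler β (β + 1) (-μ * p ^ β) + p * mittagLeffler β 2 (-μ * p ^ β)
      - q ^ α * mittagLeffler α (α + 1) (-μ * q ^ α)) = 0 := by
      rw [mul_sub, ← hp', ← hq', sub_self]
    exact (mul_eq_zero.1 this).resolve_right hΔ
  have hV0 : V 0 = 0 := by rw [hΦ0, zero_mul] at hq'; linarith
  intro t ht
  rcases le_total 0 t with h | h
  · have := hP ⟨h, ht.2⟩
    simpa [hΦ0, hV0] using this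
  · have := hM (x := -t) ⟨by linarith, by linarith [ht.1]⟩
    simpa [hΦ0, hV0] using this

/-! ### Uniqueness -/

lemma delta_zero (α β p q : ℝ) : delta α β p q 0 = delta0 α β p q := by
  simp [delta, delta0, mittagLeffler_zero]
  ring

/-- The sine `sin 2kπx`, an eigenfunction of the adjoint spatial problem. -/
def adjointSin (k : ℕ) (x : ℝ) : ℝ := Real.sin (2 * k * Real.pi * x)

/-- The function `(1 - x) cos 2kπx`, an associated function of the adjoint spatial problem (an
eigenfunction for `k = 0`). -/
def adjointCos (k : ℕ) (x : ℝ) : ℝ := (1 - x) * Real.cos (2 * k * Real.pi * x)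

lemma contDiff_adjointSin (k : ℕ) : ContDiff ℝ 2 (adjointSin k) := by
  unfold adjointSin; fun_prop

lemma contDiff_adjointCos (k : ℕ) : ContDiff ℝ 2 (adjointCos k) := by
  unfold adjointCos; fun_prop

lemma hasDerivAt_sin_const_mul (c x : ℝ) :
    HasDerivAt (fun x => Real.sin (c * x)) (c * Real.cos (c * x)) x := by
  have := ((hasDerivAt_id x).const_mul c).sin
  simpa [mul_comm] using this

lemma hasDerivAt_cos_const_mul (c x : ℝ) :
    HasDerivAt (fun x => Real.cos (c * x)) (-(c * Real.sin (c * x))) x := by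
  have := ((hasDerivAt_id x).const_mul c).cos
  simpa [mul_comm] using this

lemma deriv_adjointSin (k : ℕ) :
    deriv (adjointSin k) = fun x => 2 * k * Real.pi * Real.cos (2 * k * Real.pi * x) :=
  funext fun x => (hasDerivAt_sin_const_mul (2 * k * Real.pi) x).deriv

lemma deriv_deriv_adjointSin (k : ℕ) (x : ℝ) :
    deriv (deriv (adjointSin k)) x = -(2 * k * Real.pi) ^ 2 * adjointSin k x := by
  rw [deriv_adjointSin,
    ((hasDerivAt_cos_const_mul (2 * k * Real.pi) x).const_mul (2 * k * Real.pi)).deriv, adjointSin]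
  ring

lemma deriv_adjointCos (k : ℕ) : deriv (adjointCos k) = fun x =>
    -Real.cos (2 * k * Real.pi * x)
      + (1 - x) * -(2 * k * Real.pi * Real.sin (2 * k * Real.pi * x)) :=
  funext fun x => by
    have h1 : HasDerivAt (fun x : ℝ => 1 - x) (-1) x := (hasDerivAt_id x).const_sub 1
    rw [← neg_one_mul (Real.cos _)]
    exact (h1.mul (hasDerivAt_cos_const_mul (2 * k * Real.pi) x)).deriv

lemma deriv_deriv_adjointCos (k : ℕ) (x : ℝ) :
    deriv (deriv (adjointCos k)) x
      = -(2 * k * Real.pi) ^ 2 * adjointCos k x + 2 * (2 * k * Real.pi) * adjointSin k x := by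
  have h1 : HasDerivAt (fun x : ℝ => 1 - x) (-1) x := (hasDerivAt_id x).const_sub 1
  have h2 := (hasDerivAt_cos_const_mul (2 * k * Real.pi) x).neg.add
    (h1.mul ((hasDerivAt_sin_const_mul (2 * k * Real.pi) x).const_mul (2 * k * Real.pi)).neg)
  rw [deriv_adjointCos]
  refine Eq.trans h2.deriv ?_
  simp only [adjointCos, adjointSin, Pi.neg_apply]
  ring

lemma cos_two_mul_nat_mul_pi (k : ℕ) : Real.cos (2 * k * Real.pi) = 1 := by
  rw [show 2 * k * Real.pi = k * (2 * Real.pi) by ring, Real.cos_nat_mul_two_pi]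

lemma sin_two_mul_nat_mul_pi (k : ℕ) : Real.sin (2 * k * Real.pi) = 0 := by
  have := Real.sin_nat_mul_pi (2 * k)
  push_cast at this
  exact this

lemma eventuallyEq_zero_of_Icc {g : ℝ → ℝ} {c d t : ℝ} (h : ∀ y ∈ Icc c d, g y = 0)
    (ht : t ∈ Ioo c d) : g =ᶠ[𝓝 t] fun _ => 0 := by
  filter_upwards [isOpen_Ioo.mem_nhds ht] with y hy using h y (Ioo_subset_Icc_self hy)

lemma eventuallyEq_zero_deriv {g : ℝ → ℝ} {t : ℝ} (h : g =ᶠ[𝓝 t] fun _ => 0) :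
    deriv g =ᶠ[𝓝 t] fun _ => 0 := by
  simpa using h.deriv

lemma caputoRight_eq_zero {α q : ℝ} {g : ℝ → ℝ} (h : ∀ y ∈ Icc 0 q, g y = 0) {t : ℝ}
    (ht : t ∈ Ioo 0 q) : caputoRight α g t = 0 := by
  have hd : ∀ r ∈ Ioo 0 q, deriv g r = 0 := fun r hr =>
    (eventuallyEq_zero_deriv (eventuallyEq_zero_of_Icc h hr)).self_of_nhds
  rcases eq_or_ne α 1 with rfl | hα
  · rw [caputoRight_one, hd t ht]
  · rw [caputoRight_eq_fracInt hα g ht.1.le,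
      fracInt_congr (h := fun _ => 0) ht.1.le fun r hr => hd r ⟨hr.1, hr.2.trans ht.2⟩]
    simp [fracInt]

lemma caputoLeft_eq_zero {β p : ℝ} {g : ℝ → ℝ} (h : ∀ y ∈ Icc (-p) 0, g y = 0) {t : ℝ}
    (ht : t ∈ Ioo (-p) 0) : caputoLeft β g t = 0 := by
  have hd : ∀ r ∈ Ioo (-p) 0, deriv (deriv g) r = 0 := fun r hr =>
    (eventuallyEq_zero_deriv
      (eventuallyEq_zero_deriv (eventuallyEq_zero_of_Icc h hr))).self_of_nhds
  rcases eq_or_ne β 2 with rfl | hβ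
  · rw [caputoLeft_two, hd t ht]
  · have ht0 : 0 ≤ -t := by linarith [ht.2]
    rw [← neg_neg t, caputoLeft_neg_eq_fracInt hβ g ht0,
      fracInt_congr (h := fun _ => 0) ht0 fun r hr => hd (-r)
        ⟨by linarith [hr.2, ht.1], by linarith [hr.1]⟩]
    simp [fracInt]

namespace IsSolution

variable {α β p q : ℝ} {u : ℝ → ℝ → ℝ} {f : ℝ → ℝ}

lemma continuousOn_moment (S : IsSolution α β p q u f) (hp : 0 < p) (hq : 0 < q) {Y : ℝ → ℝ}
    (hY : Continuous Y) :
    ContinuousOn (fun t => ∫ x in (0 : ℝ)..1, u x t * Y x) (Icc (-p) q) :=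
  continuousOn_integral_mul (by linarith) S.cont le_rfl zero_le_one le_rfl hY

/-- A moment of the solution against a function `Y` in the adjoint domain vanishes if its second
derivative moment is a multiple of it. -/
lemma moment_eq_zero (S : IsSolution α β p q u f) (hα0 : 0 < α) (hα1 : α ≤ 1)
    (hβ1 : 1 < β) (hβ2 : β ≤ 2) (hp : 0 < p) (hq : 0 < q) {Y : ℝ → ℝ} (hY : ContDiff ℝ 2 Y)
    (hY1 : Y 1 = 0) (hY' : deriv Y 0 = deriv Y 1) {k : ℕ} (hΔ : delta α β p q k ≠ 0)
    (hY'' : ∀ t ∈ Icc (-p) q, ∫ x in (0 : ℝ)..1, u x t * deriv (deriv Y) x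
      = -(2 * k * Real.pi) ^ 2 * ∫ x in (0 : ℝ)..1, u x t * Y x) :
    ∀ t ∈ Icc (-p) q, ∫ x in (0 : ℝ)..1, u x t * Y x = 0 := by
  obtain ⟨F, Φ, hΦ, hplus, hminus⟩ :=
    S.exists_moment_equations hα0 hα1 hβ1 hβ2 hp hq hY hY1 hY'
  refine eq_zero_of_moment_equations (μ := (2 * k * Real.pi) ^ 2) (F := F) (Φ := Φ) hα0 hβ1 hp hq
    (V := fun t => ∫ x in (0 : ℝ)..1, u x t * Y x) (S.continuousOn_moment hp hq hY.continuous)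
    ?_ ?_ ?_ (fun t ht => ?_) (fun s hs => ?_) hΔ
  · rw [intervalIntegral.integral_congr (g := fun _ => 0)]
    · simp
    · intro x hx
      rw [uIcc_of_le zero_le_one] at hx
      simp [S.top x hx]
  · rw [intervalIntegral.integral_congr (g := fun _ => 0)]
    · simp
    · intro x hx
      rw [uIcc_of_le zero_le_one] at hx
      simp [S.bottom x hx]
  · rw [hΦ, hY'' 0 ⟨by linarith, hq.le⟩]
  · rw [hplus t ht]
    congr 1
    exact fracInt_congr ht.1.le fun r hr =>
      hY'' r ⟨by linarith [hr.1], by linarith [hr.2, ht.2]⟩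
  · rw [hminus s hs]
    congr 1
    exact fracInt_congr hs.1.le fun r hr =>
      hY'' (-r) ⟨by linarith [hr.2, hs.2], by linarith [hr.1]⟩

lemma moment_adjointSin_eq_zero (S : IsSolution α β p q u f) (hα0 : 0 < α) (hα1 : α ≤ 1)
    (hβ1 : 1 < β) (hβ2 : β ≤ 2) (hp : 0 < p) (hq : 0 < q) {k : ℕ} (hΔ : delta α β p q k ≠ 0) :
    ∀ t ∈ Icc (-p) q, ∫ x in (0 : ℝ)..1, u x t * adjointSin k x = 0 := by
  refine S.moment_eq_zero hα0 hα1 hβ1 hβ2 hp hq (contDiff_adjointSin k) ?_ ?_ hΔ fun t _ => ?_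
  · rw [adjointSin, mul_one, sin_two_mul_nat_mul_pi]
  · simp only [deriv_adjointSin, mul_zero, mul_one, cos_two_mul_nat_mul_pi, Real.cos_zero]
  · rw [← intervalIntegral.integral_const_mul]
    refine intervalIntegral.integral_congr fun x _ => ?_
    simp only [deriv_deriv_adjointSin]
    ring

lemma moment_adjointCos_eq_zero (S : IsSolution α β p q u f) (hα0 : 0 < α) (hα1 : α ≤ 1)
    (hβ1 : 1 < β) (hβ2 : β ≤ 2) (hp : 0 < p) (hq : 0 < q) {k : ℕ} (hΔ : delta α β p q k ≠ 0) :
    ∀ t ∈ Icc (-p) q, ∫ x in (0 : ℝ)..1, u x t * adjointCos k x = 0 := by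
  refine S.moment_eq_zero hα0 hα1 hβ1 hβ2 hp hq (contDiff_adjointCos k) ?_ ?_ hΔ fun t ht => ?_
  · simp [adjointCos]
  · simp only [deriv_adjointCos, mul_zero, mul_one, cos_two_mul_nat_mul_pi, Real.cos_zero,
      Real.sin_zero, sub_self, zero_mul, neg_zero]
  · have hi : ∀ {Y : ℝ → ℝ}, Continuous Y →
        IntervalIntegrable (fun x => u x t * Y x) volume 0 1 := fun hY =>
      ContinuousOn.intervalIntegrable (by
        rw [uIcc_of_le zero_le_one]; exact (S.continuousOn_slice ht).mul hY.continuousOn)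
    have e : ∀ x, u x t * deriv (deriv (adjointCos k)) x
        = -(2 * k * Real.pi) ^ 2 * (u x t * adjointCos k x)
          + 2 * (2 * k * Real.pi) * (u x t * adjointSin k x) := fun x => by
      rw [deriv_deriv_adjointCos]; ring
    simp only [e]
    rw [intervalIntegral.integral_add ((hi (contDiff_adjointCos k).continuous).const_mul _)
      ((hi (contDiff_adjointSin k).continuous).const_mul _), intervalIntegral.integral_const_mul,
      intervalIntegral.integral_const_mul,
      S.moment_adjointSin_eq_zero hα0 hα1 hβ1 hβ2 hp hq hΔ t ht, mul_zero, add_zero]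

end IsSolution

lemma dxx_eq_zero {u : ℝ → ℝ → ℝ} {t : ℝ} (h : ∀ x ∈ Icc (0 : ℝ) 1, u x t = 0) {x : ℝ}
    (hx : x ∈ Ioo (0 : ℝ) 1) : dxx u x t = 0 :=
  (eventuallyEq_zero_deriv
    (eventuallyEq_zero_deriv (eventuallyEq_zero_of_Icc h hx))).self_of_nhds

/-- Functions vanishing on the closed rectangle solve the problem with zero source, whatever
their values outside. -/
lemma isSolution_of_eq_zero {α β p q : ℝ} (hp : 0 < p) (hq : 0 < q) {u : ℝ → ℝ → ℝ} {f : ℝ → ℝ}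
    (hu : ∀ x ∈ Icc (0 : ℝ) 1, ∀ t ∈ Icc (-p) q, u x t = 0) (hf : ∀ x ∈ Ioo (0 : ℝ) 1, f x = 0) :
    IsSolution α β p q u f := by
  have hcol : ∀ t ∈ Icc (-p) q, ∀ x ∈ Icc (0 : ℝ) 1, u x t = 0 := fun t ht x hx => hu x hx t ht
  have hrow : ∀ x ∈ Ioo (0 : ℝ) 1, ∀ t ∈ Icc (-p) q, u x t = 0 := fun x hx =>
    hu x (Ioo_subset_Icc_self hx)
  have hplus : ∀ z ∈ domPlus q, caputoRight α (u z.1) z.2 = 0 := fun z hz =>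
    caputoRight_eq_zero (fun y hy => hrow z.1 hz.1 y ⟨by linarith [hy.1], hy.2⟩) hz.2
  have hminus : ∀ z ∈ domMinus p, caputoLeft β (u z.1) z.2 = 0 := fun z hz =>
    caputoLeft_eq_zero (fun y hy => hrow z.1 hz.1 y ⟨hy.1, by linarith [hy.2]⟩) hz.2
  have hdom : ∀ z ∈ domPlus q ∪ domMinus p, z.1 ∈ Ioo (0 : ℝ) 1 ∧ z.2 ∈ Icc (-p) q := by
    rintro z (hz | hz)
    · exact ⟨hz.1, by linarith [hz.2.1], hz.2.2.le⟩
    · exact ⟨hz.1, hz.2.1.le, by linarith [hz.2.2]⟩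
  have hdx : ∀ z ∈ domPlus q ∪ domMinus p,
      (fun y => u y z.2) =ᶠ[𝓝 z.1] (fun _ => 0) ∧ (fun y => dx u y z.2) =ᶠ[𝓝 z.1] fun _ => 0 :=
    fun z hz => by
      have h := eventuallyEq_zero_of_Icc (hcol z.2 (hdom z hz).2) (hdom z hz).1
      exact ⟨h, eventuallyEq_zero_deriv h⟩
  have hdt : ∀ x ∈ Ioo (0 : ℝ) 1, ∀ t ∈ Ioo (-p) q,
      u x =ᶠ[𝓝 t] (fun _ => 0) ∧ deriv (u x) =ᶠ[𝓝 t] fun _ => 0 := fun x hx t ht => by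
    have h := eventuallyEq_zero_of_Icc (hrow x hx) ht
    exact ⟨h, eventuallyEq_zero_deriv h⟩
  have hdiff : ∀ {g : ℝ → ℝ} {t : ℝ}, g =ᶠ[𝓝 t] (fun _ => 0) → DifferentiableAt ℝ g t :=
    fun h => (differentiableAt_const (0 : ℝ)).congr_of_eventuallyEq h
  have hdxx : ∀ z ∈ domPlus q ∪ domMinus p, dxx u z.1 z.2 = 0 := fun z hz =>
    dxx_eq_zero (hcol z.2 (hdom z hz).2) (hdom z hz).1
  have hAC : ∀ {g : ℝ → ℝ} {c d : ℝ}, (∀ y ∈ uIcc c d, g y = 0) →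
      AbsolutelyContinuousOnInterval g c d := fun h =>
    LipschitzOnWith.absolutelyContinuousOnInterval (K := 0) fun x hx y hy => by
      simp [h x hx, h y hy]
  refine
    { cont := (continuousOn_const (c := (0 : ℝ))).congr fun z hz => hu z.1 hz.1 z.2 hz.2
      diff_x := fun z hz => ⟨hdiff (hdx z hz).1, hdiff (hdx z hz).2⟩
      cont_dxx := (continuousOn_const (c := (0 : ℝ))).congr hdxx
      exists_plus := fun z hz => ?_
      cont_plus := (continuousOn_const (c := (0 : ℝ))).congr hplus
      exists_minus := fun z hz => ?_
      cont_minus := (continuousOn_const (c := (0 : ℝ))).congr hminus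
      cont_f := (continuousOn_const (c := (0 : ℝ))).congr hf
      eq_plus := fun z hz => by rw [hf z.1 hz.1, hplus z hz, hdxx z (Or.inl hz), sub_zero]
      eq_minus := fun z hz => by rw [hf z.1 hz.1, hminus z hz, hdxx z (Or.inr hz), sub_zero]
      periodic := fun t ht => by rw [hu 0 (by simp) t ht, hu 1 (by simp) t ht]
      neumann := fun t ht => ?_
      bottom := fun x hx => hu x hx _ ⟨le_rfl, by linarith⟩
      top := fun x hx => hu x hx _ ⟨by linarith, le_rfl⟩
      transmit := fun x hx => ⟨0, ?_, ?_⟩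
      bdd_dx := fun t₀ _ => ⟨0, ?_⟩
      bdd_plus := fun x₀ _ => ⟨0, ?_⟩
      bdd_minus := fun x₀ _ => ⟨0, ?_⟩ }
  · have hI : ∀ r ∈ Ioo 0 z.2, deriv (u z.1) r = 0 := fun r hr =>
      (hdt z.1 hz.1 r ⟨by linarith [hr.1], hr.2.trans hz.2.2⟩).2.self_of_nhds
    rw [CaputoRightExists]
    split_ifs
    · exact hdiff (hdt z.1 hz.1 z.2 ⟨by linarith [hz.2.1], hz.2.2⟩).1
    · refine ⟨hAC fun y hy => ?_, ?_⟩
      · rw [uIcc_of_le hz.2.1.le] at hy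
        exact hrow z.1 hz.1 y ⟨by linarith [hy.1], hy.2.trans hz.2.2.le⟩
      · refine (intervalIntegrable_const (c := (0 : ℝ))).congr_uIoo fun r hr => ?_
        rw [uIoo_of_le hz.2.1.le] at hr
        simp [hI r hr]
  · have hI : ∀ r ∈ Ico z.2 0, r ∈ Ioo (-p) q := fun r hr =>
      ⟨hz.2.1.trans_le hr.1, hr.2.trans hq⟩
    rw [CaputoLeftExists]
    split_ifs
    · have h := hdt z.1 hz.1 z.2 (hI z.2 ⟨le_rfl, hz.2.2⟩)
      exact ⟨h.1.eventuallyEq_nhds.mono fun s hs => hdiff hs, hdiff h.2⟩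
    · refine ⟨fun r hr => hdiff (hdt z.1 hz.1 r (hI r hr)).1, fun s hs => hAC fun y hy => ?_, ?_⟩
      · rw [uIcc_of_le hs.1.le] at hy
        exact (hdt z.1 hz.1 y (hI y ⟨hy.1, hy.2.trans_lt hs.2⟩)).2.self_of_nhds
      · refine (intervalIntegrable_const (c := (0 : ℝ))).congr_uIoo fun r hr => ?_
        rw [uIoo_of_le hz.2.2.le] at hr
        simp [(eventuallyEq_zero_deriv
          (hdt z.1 hz.1 r (hI r ⟨hr.1.le, hr.2⟩)).2).self_of_nhds]
  · refine (hasDerivWithinAt_const 0 (Ici (0 : ℝ)) (0 : ℝ)).congr_of_eventuallyEq ?_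
      (hu 0 (by simp) t ht)
    filter_upwards [Icc_mem_nhdsGE (zero_lt_one' ℝ)] with y hy using hu y hy t ht
  · refine tendsto_const_nhds.congr' ?_
    filter_upwards [Ioo_mem_nhdsGT hq] with t ht using (hplus (x, t) ⟨hx, ht⟩).symm
  · refine tendsto_const_nhds.congr' ?_
    filter_upwards [Ioo_mem_nhdsLT (neg_neg_of_pos hp)] with t ht
    rw [(hdt x hx t ⟨ht.1, ht.2.trans hq⟩).2.self_of_nhds, neg_zero]
  · filter_upwards [self_mem_nhdsWithin] with z hz
    have h : dx u z.1 z.2 = 0 := (hdx z hz).2.self_of_nhds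
    rw [h, abs_zero]
  · filter_upwards [self_mem_nhdsWithin] with z hz
    rw [hplus z hz, abs_zero]
  · filter_upwards [self_mem_nhdsWithin] with z hz
    rw [(hdt z.1 hz.1 z.2 ⟨hz.2.1, hz.2.2.trans hq⟩).2.self_of_nhds, abs_zero]

end MixedFractional

end

theorem theorem1 (α β p q : ℝ) (hα0 : 0 < α) (hα1 : α ≤ 1) (hβ1 : 1 < β) (hβ2 : β ≤ 2)
    (hp : 0 < p) (hq : 0 < q)
    (hΔ0 : MixedFractional.delta0 α β p q ≠ 0)
    (hΔ : ∀ k : ℕ, 1 ≤ k → MixedFractional.delta α β p q k ≠ 0)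
    (u : ℝ → ℝ → ℝ) (f : ℝ → ℝ) :
    MixedFractional.IsSolution α β p q u f ↔
      (∀ x ∈ Icc (0 : ℝ) 1, ∀ t ∈ Icc (-p) q, u x t = 0) ∧ (∀ x ∈ Ioo (0 : ℝ) 1, f x = 0) := by
  refine ⟨fun S => ?_, fun h => MixedFractional.isSolution_of_eq_zero hp hq h.1 h.2⟩
  have hΔ' : ∀ k : ℕ, MixedFractional.delta α β p q k ≠ 0 := fun k => by
    rcases Nat.eq_zero_or_pos k with rfl | hk
    · rwa [MixedFractional.delta_zero]
    · exact hΔ k hk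
  have hu : ∀ t ∈ Icc (-p) q, ∀ x ∈ Icc (0 : ℝ) 1, u x t = 0 := fun t ht =>
    MixedFractional.eq_zero_of_orthogonal (S.continuousOn_slice ht) (S.periodic t ht)
      (fun k _ => S.moment_adjointSin_eq_zero hα0 hα1 hβ1 hβ2 hp hq (hΔ' k) t ht)
      fun k => S.moment_adjointCos_eq_zero hα0 hα1 hβ1 hβ2 hp hq (hΔ' k) t ht
  refine ⟨fun x hx t ht => hu t ht x hx, fun x hx => ?_⟩
  have hq2 : q / 2 ∈ Ioo 0 q := ⟨by linarith, by linarith⟩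
  have h := S.eq_plus (x, q / 2) ⟨hx, hq2⟩
  rw [MixedFractional.caputoRight_eq_zero (q := q) (fun y hy =>
      hu y ⟨by linarith [hy.1], hy.2⟩ x (Ioo_subset_Icc_self hx)) hq2,
    MixedFractional.dxx_eq_zero (hu (q / 2) ⟨by linarith, hq2.2.le⟩) hx, sub_zero] at h
  exact h
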